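/- **Theorem 2.7.** Setting. For each $n$ let $0=x_0\le x_1\le\dots\le x_n\le x_{n+1}=1$ be fixed design points (depending on $n$) with $\max_{0\le i\le n}(x_{i+1}-x_i)=O(n^{-1})$, and let $$y_i=g(x_i)+\sqrt{V(x_i)}\,\epsilon_i,\qquad i=1,\dots,n,$$ where the $\epsilon_i$ are i.i.d. with mean $0$, variance $1$ and finite fourth moment. Let $d_0,\dots,d_r$ satisfy $\sum_j d_j=0$, $\sum_j d_j^2=1$, and put $\Delta_i=\sum_{j=0}^r d_j\,y_{j+i-\lfloor r/2\rfloor}$ for $i=\lfloor r/2\rfloor+1,\dots,n+\lfloor r/2\rfloor-r$. Let $K\ge 0$ be bounded, supported on $[-1,1]$, with $\int K=1$ and $K\ge c$ on $[-\tau,\tau]$ for some $c,\tau>0$. For $h>0$ and $x\in[0,1]$ let $\hat V_h(x)=\hat a_0$, where $$(\hat a_0,\dots,\hat a_p)=\arg\min_{a_0,\dots,a_p}\sum_i\bigl[\Delta_i^2-a_0-a_1(x-x_i)-\dots-a_p(x-x_i)^p\bigr]^2K\Bigl(\frac{x-x_i}{h}\Bigr)$$ (with $\hat V_h(x)=0$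 if the minimizer is not unique), and let $R(V,\hat V_h)=E\int_0^1(\hat V_h(x)-V(x))^2\,dx$. For $\alpha>0$ let $\lfloor\alpha\rfloor$ be the greatest integer strictly less than $\alpha$, and, for fixed $C_1,C_2>0$, let $\mathcal C_\alpha$ be the class of continuous $f:[0,1]\to\mathbb R$ that are $\lfloor\alpha\rfloor$ times differentiable on $(0,1)$ with $|f^{(\lfloor\alpha\rfloor)}(x)-f^{(\lfloor\alpha\rfloor)}(y)|\le C_1|x-y|^{\alpha-\lfloor\alpha\rfloor}$ and $|f^{(k)}(x)|\le C_2$ for $0\le k\le\lfloor\alpha\rfloor-1$ and all $x,y\in(0,1)$. The mean function $g$ ranges over $\mathcal C_\beta$, and the variance function $V$ over $\mathcal V_\gamma=\{V\in\mathcal C_\gamma:0\le V\le C_2\}$. Call $h_n>0$ an optimal bandwidth if it minimizes $h\mapsto\sup\{R(V,\hat V_h):V\in\mathcal V_\gamma,\ g\in\mathcal C_\beta\}$ over all $h>0$. Claim. Let $\gamma>0$ and let $p>\lfloor\gamma\rfloor$ be an integer. The constants $b_1,b_2,\underline B,\bar B,\underline B_\delta$ below are positive and finite and do not depend on $n$,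 $g$, $V$, $h$ or $\beta$. 1. There are $b_1\le b_2$ such that for every $\beta>\gamma/(4\gamma+2)$ and all sufficiently large $n$ an optimal bandwidth exists, and every optimal bandwidth $h_n$ satisfies $b_1n^{-1/(2\gamma+1)}\le h_n\le b_2n^{-1/(2\gamma+1)}$. 2. Let $0<\underline a\le\bar a<\infty$. There are $\underline B\le\bar B$ such that for every $\beta>\gamma/(4\gamma+2)$, all sufficiently large $n$ and all $h$ with $\underline a\le n^{1/(2\gamma+1)}h\le\bar a$, the minimizer defining $\hat V_h(x)$ is unique for every $x\in[0,1]$ and all data, $R(V,\hat V_h)\le\bar B\,n^{-2\gamma/(2\gamma+1)}$ for all $g\in\mathcal C_\beta$, $V\in\mathcal V_\gamma$, and $$\sup\{R(V,\hat V_h):V\in\mathcal V_\gamma,\ g\in\mathcal C_\beta\}\ \ge\ \underline B\,n^{-2\gamma/(2\gamma+1)} .$$ 3. Let $0<\underline a\le\bar a<\infty$. For every $\delta>0$ there is $\underline B_\delta$ such that for every $\beta>\gamma/(4\gamma+2)$, all sufficiently large $n$, all $h$ with $\underline a\le n^{1/(2\gamma+1)}h\le\bar a$, all $g\in\mathcal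 C_\beta$ and all $V\in\mathcal V_\gamma$ with $V\ge\delta$ on $[0,1]$, one has $R(V,\hat V_h)\ge\underline B_\delta\,n^{-2\gamma/(2\gamma+1)}$. In 1–3, "sufficiently large" may depend on $\beta$ (and in 3 on $\delta$), but not on $g$, $V$ or $h$. -/

import Mathlib

open MeasureTheory ProbabilityTheory Filter Set
open scoped ENNReal

noncomputable section

namespace VarDiff

/-- The greatest integer strictly less than `γ` (used for `γ > 0`). -/
def strictFloor (γ : ℝ) : ℕ := ⌈γ⌉₊ - 1

/-- The Lipschitz ball `C_γ` with constants `C₁, C₂`: with `m` the greatest integer less than `γ`,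
the function has `m` derivatives on `(0,1)`, the `m`-th one is Hölder with exponent `γ - m` and
constant `C₁`, and the derivatives of order `0, …, m - 1` are bounded by `C₂`.
A function satisfying this on `(0,1)` has a unique continuous extension to `[0,1]`; the continuity
requirement only says that its values at the two end points are those of the extension. -/
structure HolderClass (γ C₁ C₂ : ℝ) (f : ℝ → ℝ) : Prop where
  continuousOn : ContinuousOn f (Icc 0 1)
  contDiffOn : ContDiffOn ℝ (strictFloor γ) f (Ioo 0 1)
  holder : ∀ x ∈ Ioo (0 : ℝ) 1, ∀ y ∈ Ioo (0 : ℝ) 1,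
    |iteratedDerivWithin (strictFloor γ) f (Ioo 0 1) x
        - iteratedDerivWithin (strictFloor γ) f (Ioo 0 1) y|
      ≤ C₁ * |x - y| ^ (γ - (strictFloor γ : ℝ))
  bound : ∀ k < strictFloor γ, ∀ x ∈ Ioo (0 : ℝ) 1,
    |iteratedDerivWithin k f (Ioo 0 1) x| ≤ C₂

/-- The variance functions in `C_γ`: nonnegative and bounded by `C₂`. The upper bound is already
part of `HolderClass` when `γ > 1`. -/
structure VarianceClass (γ C₁ C₂ : ℝ) (V : ℝ → ℝ) : Prop where
  holderClass : HolderClass γ C₁ C₂ V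
  nonneg : ∀ x ∈ Icc (0 : ℝ) 1, 0 ≤ V x
  le : ∀ x ∈ Icc (0 : ℝ) 1, V x ≤ C₂

/-- A fixed design: for sample size `n` the design points are `x n 1 ≤ … ≤ x n n`, with the
convention `x n 0 = 0` and `x n (n+1) = 1`, and the largest gap is `O(1/n)`. -/
structure IsDesign (x : ℕ → ℕ → ℝ) : Prop where
  left : ∀ n, x n 0 = 0
  right : ∀ n, x n (n + 1) = 1
  mono : ∀ n, ∀ i ≤ n, x n i ≤ x n (i + 1)
  gap : ∃ C : ℝ, ∀ n : ℕ, 1 ≤ n → ∀ i ≤ n, x n (i + 1) - x n i ≤ C / n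

/-- The errors are i.i.d. with mean zero, variance one and finite fourth moment. -/
structure IsErrorSequence {Ω : Type*} [MeasurableSpace Ω] (μ : Measure Ω)
    (ε : ℕ → Ω → ℝ) : Prop where
  measurable : ∀ i, Measurable (ε i)
  indep : iIndepFun ε μ
  identDistrib : ∀ i, IdentDistrib (ε i) (ε 0) μ μ
  memLp : MemLp (ε 0) 4 μ
  mean : ∫ ω, ε 0 ω ∂μ = 0
  variance : ∫ ω, (ε 0 ω) ^ 2 ∂μ = 1

/-- A difference sequence `d_0, …, d_r` of order `r`. -/
structure IsDifferenceSequence {r : ℕ} (d : Fin (r + 1) → ℝ) : Prop where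
  sum_eq_zero : ∑ j, d j = 0
  sum_sq_eq_one : ∑ j, d j ^ 2 = 1

/-- The weight function: nonnegative, bounded, supported on `[-1,1]`, with integral one, and
bounded away from zero in a neighbourhood of the origin. -/
structure IsWeight (K : ℝ → ℝ) : Prop where
  nonneg : ∀ u, 0 ≤ K u
  bounded : ∃ M : ℝ, ∀ u, K u ≤ M
  support : ∀ u, 1 < |u| → K u = 0
  integral_eq_one : ∫ u, K u = 1
  pos_near_zero : ∃ c > 0, ∃ τ > 0, ∀ u, |u| ≤ τ → c ≤ K u

/-- The observations `y_i = g(x_i) + √V(x_i) ε_i`. -/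
def response (x : ℕ → ℝ) (g V : ℝ → ℝ) (e : ℕ → ℝ) (i : ℕ) : ℝ :=
  g (x i) + √(V (x i)) * e i

/-- The pseudoresidual `Δ_i = ∑_{j=0}^r d_j y_{j+i-⌊r/2⌋}`, used for `i > ⌊r/2⌋`. -/
def pseudoresidual {r : ℕ} (d : Fin (r + 1) → ℝ) (y : ℕ → ℝ) (i : ℕ) : ℝ :=
  ∑ j : Fin (r + 1), d j * y ((j : ℕ) + i - r / 2)

/-- The range `⌊r/2⌋ + 1, …, n + ⌊r/2⌋ - r` of indices of the pseudoresiduals. -/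
def residualIndices (r n : ℕ) : Finset ℕ := Finset.Icc (r / 2 + 1) (n + r / 2 - r)

/-- The weighted least squares criterion at the point `t`, for data `z_i` at the points `x_i`,
`i ∈ I`, and the polynomial with coefficients `a_0, …, a_p`. -/
def localLoss (p : ℕ) (K : ℝ → ℝ) (h : ℝ) (x : ℕ → ℝ) (I : Finset ℕ) (z : ℕ → ℝ) (t : ℝ)
    (a : Fin (p + 1) → ℝ) : ℝ :=
  ∑ i ∈ I, (z i - ∑ k : Fin (p + 1), a k * (t - x i) ^ (k : ℕ)) ^ 2 * K ((t - x i) / h)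

/-- `a` minimizes the weighted least squares criterion. -/
def IsLocalFit (p : ℕ) (K : ℝ → ℝ) (h : ℝ) (x : ℕ → ℝ) (I : Finset ℕ) (z : ℕ → ℝ) (t : ℝ)
    (a : Fin (p + 1) → ℝ) : Prop :=
  ∀ b : Fin (p + 1) → ℝ, localLoss p K h x I z t a ≤ localLoss p K h x I z t b

open Classical in
/-- The local polynomial regression estimator: the coefficient `a_0` of the minimizer. Where the
minimizer is not unique (too few points carry positive weight) the value is set to `0`. -/
def localPoly (p : ℕ) (K : ℝ → ℝ) (h : ℝ) (x : ℕ → ℝ) (I : Finset ℕ) (z : ℕ → ℝ) (t : ℝ) : ℝ :=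
  if H : ∃! a : Fin (p + 1) → ℝ, IsLocalFit p K h x I z t a then H.choose 0 else 0

/-- The variance estimator: local polynomial regression on the squared pseudoresiduals. -/
def varianceEstimator {r : ℕ} (d : Fin (r + 1) → ℝ) (p : ℕ) (K : ℝ → ℝ) (h : ℝ) (n : ℕ)
    (x : ℕ → ℝ) (y : ℕ → ℝ) (t : ℝ) : ℝ :=
  localPoly p K h x (residualIndices r n) (fun i => pseudoresidual d y i ^ 2) t

/-- The global mean squared risk `E ∫₀¹ (V̂_h(t) - V(t))² dt`, with values in `[0,∞]`. -/
def risk {Ω : Type*} [MeasurableSpace Ω] (μ : Measure Ω) (ε : ℕ → Ω → ℝ) {r : ℕ}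
    (d : Fin (r + 1) → ℝ) (p : ℕ) (K : ℝ → ℝ) (n : ℕ) (x : ℕ → ℝ) (g V : ℝ → ℝ) (h : ℝ) : ℝ≥0∞ :=
  ∫⁻ ω, (∫⁻ t in Icc (0 : ℝ) 1, ENNReal.ofReal
    ((varianceEstimator d p K h n x (response x g V (fun i => ε i ω)) t - V t) ^ 2)) ∂μ

/-- The supremum of the global risk over `g ∈ C_β` and `V ∈ C_γ`. -/
def worstRisk {Ω : Type*} [MeasurableSpace Ω] (μ : Measure Ω) (ε : ℕ → Ω → ℝ) {r : ℕ}
    (d : Fin (r + 1) → ℝ) (p : ℕ) (K : ℝ → ℝ) (n : ℕ) (x : ℕ → ℝ) (β γ C₁ C₂ : ℝ) (h : ℝ) : ℝ≥0∞ :=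
  ⨆ (g : ℝ → ℝ) (V : ℝ → ℝ) (_ : HolderClass β C₁ C₂ g) (_ : VarianceClass γ C₁ C₂ V),
    risk μ ε d p K n x g V h

/-- `h` is a globally optimal bandwidth in the minimax sense: it minimizes the worst-case risk
over all positive bandwidths. -/
def IsOptimalBandwidth {Ω : Type*} [MeasurableSpace Ω] (μ : Measure Ω) (ε : ℕ → Ω → ℝ) {r : ℕ}
    (d : Fin (r + 1) → ℝ) (p : ℕ) (K : ℝ → ℝ) (n : ℕ) (x : ℕ → ℝ) (β γ C₁ C₂ : ℝ) (h : ℝ) : Prop :=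
  0 < h ∧ ∀ h' : ℝ, 0 < h' →
    worstRisk μ ε d p K n x β γ C₁ C₂ h ≤ worstRisk μ ε d p K n x β γ C₁ C₂ h'

end VarDiff

end

noncomputable section

namespace VarDiff

/-! The estimator is linear in the squared pseudoresiduals, with weights w that reproduce
polynomials of degree at most `p`. Its mean squared error at t is governed by S(t), the sum of the
squared weights, and by N(t), the number of design points within `h` of t. Since the mesh is O(1/n),
a polynomial is controlled near t by its values at the design points of a window
(`HasMesh.polyVal_sq_le`), and this gives S = O(1/(n min(h,1))) uniformly in t. The design may
cluster, so N need not be O(nh) pointwise, but its integral over [0,1] is at most 2nh, and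
Cauchy–Schwarz gives (∑|w|)² ≤ N S.

Upper bound (`risk_le`). Subtracting the Taylor polynomial of V at t bounds the bias by (E + C₁ h^γ)
∑|w|, where E bounds the bias of the squared pseudoresiduals. The condition β > γ/(4γ+2) makes E at
most h^γ for large n. Integration gives O(h^(2γ)) + O(1/(nh)), balanced at h of order n^(-1/(2γ+1)).

Lower bound from the variance (`div_le_risk`). The products of the two errors carrying the extreme
nonzero coefficients of `d` are orthonormal, and each correlates with only one squared
pseudoresidual; Bessel's inequality bounds the mean squared error below by a multiple of S. If the
fit is unique the weights sum to one, so S ≥ 1/N; otherwise the estimate is 0 and the error is V².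
Convexity of 1/(1+N) then gives a multiple of 1/(1+nh) for every h > 0, whenever V is bounded below.
This alone yields the lower bounds at the optimal rate.

Lower bound from the bias (`oscillation_le_worstRisk`), needed to exclude large bandwidths. A single
oscillating V might be tracked by accident, so the risk is averaged over the frequencies 2πk, L < k
≤ 2L, with L of order 1/min(h,1), and over two phases. Weights with small S cannot follow all of
these, because the averaged cosine is small in L². The amplitude ξ^(-γ) keeps the functions in the
class, and the worst-case risk is at least a multiple of min(h,1)^(2γ).

Comparison with the risk at n^(-1/(2γ+1)) confines all competitive bandwidths to a compact interval
of that order. A minimizer exists there because the worst-case risk is lower semicontinuous: dilates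
of `K` converge almost everywhere along subsequences together with their zero sets, and Fatou's
lemma applies. -/

/-- The Gram matrix of the monomials of degree at most `p` at the points `t - x i`, with
weights `k i`. -/
def gram (p : ℕ) (x : ℕ → ℝ) (I : Finset ℕ) (t : ℝ) (k : ℕ → ℝ) :
    Matrix (Fin (p + 1)) (Fin (p + 1)) ℝ :=
  Matrix.of fun a b => ∑ i ∈ I, k i * ((t - x i) ^ (a : ℕ) * (t - x i) ^ (b : ℕ))

/-- The effective weights of local polynomial regression; they vanish when the Gram matrix is
singular. -/
def lpWeight (p : ℕ) (x : ℕ → ℝ) (I : Finset ℕ) (t : ℝ) (k : ℕ → ℝ) (i : ℕ) : ℝ :=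
  k i * ∑ l : Fin (p + 1), (gram p x I t k)⁻¹ 0 l * (t - x i) ^ (l : ℕ)

/-- The polynomial with coefficients `c`. -/
def polyVal {p : ℕ} (c : Fin (p + 1) → ℝ) (v : ℝ) : ℝ := ∑ k : Fin (p + 1), c k * v ^ (k : ℕ)

lemma polyVal_add {p : ℕ} (a b : Fin (p + 1) → ℝ) (v : ℝ) :
    polyVal (a + b) v = polyVal a v + polyVal b v := by
  simp [polyVal, add_mul, Finset.sum_add_distrib]

lemma polyVal_smul {p : ℕ} (s : ℝ) (b : Fin (p + 1) → ℝ) (v : ℝ) :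
    polyVal (s • b) v = s * polyVal b v := by
  simp [polyVal, Finset.mul_sum, mul_assoc]

lemma polyVal_zero_right {p : ℕ} (c : Fin (p + 1) → ℝ) : polyVal c 0 = c 0 := by
  rw [polyVal, Fin.sum_univ_succ]
  simp

lemma gram_mulVec (p : ℕ) (x : ℕ → ℝ) (I : Finset ℕ) (t : ℝ) (k : ℕ → ℝ)
    (c : Fin (p + 1) → ℝ) (a : Fin (p + 1)) :
    (gram p x I t k).mulVec c a
      = ∑ i ∈ I, k i * polyVal c (t - x i) * (t - x i) ^ (a : ℕ) := by
  simp only [Matrix.mulVec, dotProduct, gram, Matrix.of_apply, polyVal, Finset.sum_mul,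
    Finset.mul_sum]
  rw [Finset.sum_comm]
  refine Finset.sum_congr rfl fun i _ => Finset.sum_congr rfl fun l _ => by ring

lemma gram_quadratic (p : ℕ) (x : ℕ → ℝ) (I : Finset ℕ) (t : ℝ) (k : ℕ → ℝ)
    (c b : Fin (p + 1) → ℝ) :
    ∑ a, b a * (gram p x I t k).mulVec c a
      = ∑ i ∈ I, k i * (polyVal c (t - x i) * polyVal b (t - x i)) := by
  simp only [gram_mulVec, Finset.mul_sum]
  rw [Finset.sum_comm]
  refine Finset.sum_congr rfl fun i _ => ?_
  conv_rhs => rw [polyVal.eq_1 b, Finset.mul_sum, Finset.mul_sum]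
  exact Finset.sum_congr rfl fun l _ => by ring

/-! ### Weighted least squares: normal equations and linearity of the fit in the data. -/

section Fit

variable {p : ℕ} {K : ℝ → ℝ} {h : ℝ} {x : ℕ → ℝ} {I : Finset ℕ} {z : ℕ → ℝ} {t : ℝ}

/-- The loss is quadratic in the coefficients, so this expansion is exact; vanishing of the linear
term for all `b` is the system of normal equations. -/
lemma localLoss_add (a b : Fin (p + 1) → ℝ) :
    localLoss p K h x I z t (a + b) = localLoss p K h x I z t a
      - 2 * ∑ i ∈ I, K ((t - x i) / h) * (z i - polyVal a (t - x i)) * polyVal b (t - x i)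
      + ∑ i ∈ I, K ((t - x i) / h) * polyVal b (t - x i) ^ 2 := by
  simp only [localLoss]
  rw [Finset.mul_sum, ← Finset.sum_sub_distrib, ← Finset.sum_add_distrib]
  refine Finset.sum_congr rfl fun i _ => ?_
  have := polyVal_add a b (t - x i)
  simp only [polyVal] at this ⊢
  rw [this]
  ring

lemma isLocalFit_of_normal (hK : ∀ u, 0 ≤ K u) (a : Fin (p + 1) → ℝ)
    (H : ∀ b : Fin (p + 1) → ℝ,
      ∑ i ∈ I, K ((t - x i) / h) * (z i - polyVal a (t - x i)) * polyVal b (t - x i) = 0) :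
    IsLocalFit p K h x I z t a := by
  intro b
  have h1 := localLoss_add (K := K) (h := h) (x := x) (I := I) (z := z) (t := t) a (b - a)
  rw [H, add_sub_cancel] at h1
  rw [h1]
  have : 0 ≤ ∑ i ∈ I, K ((t - x i) / h) * polyVal (b - a) (t - x i) ^ 2 :=
    Finset.sum_nonneg fun i _ => mul_nonneg (hK _) (sq_nonneg _)
  linarith

lemma IsLocalFit.normal (a : Fin (p + 1) → ℝ) (H : IsLocalFit p K h x I z t a)
    (b : Fin (p + 1) → ℝ) :
    ∑ i ∈ I, K ((t - x i) / h) * (z i - polyVal a (t - x i)) * polyVal b (t - x i) = 0 := by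
  set L := ∑ i ∈ I, K ((t - x i) / h) * (z i - polyVal a (t - x i)) * polyVal b (t - x i) with hL
  set Q := ∑ i ∈ I, K ((t - x i) / h) * polyVal b (t - x i) ^ 2 with hQ
  have key : ∀ s : ℝ, 0 ≤ s ^ 2 * Q - 2 * (s * L) := by
    intro s
    have h1 := localLoss_add (K := K) (h := h) (x := x) (I := I) (z := z) (t := t) a (s • b)
    have h2 := H (a + s • b)
    have h3 : ∑ i ∈ I, K ((t - x i) / h) * (z i - polyVal a (t - x i))
        * polyVal (s • b) (t - x i) = s * L := by
      rw [hL, Finset.mul_sum]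
      exact Finset.sum_congr rfl fun i _ => by rw [polyVal_smul]; ring
    have h4 : ∑ i ∈ I, K ((t - x i) / h) * polyVal (s • b) (t - x i) ^ 2 = s ^ 2 * Q := by
      rw [hQ, Finset.mul_sum]
      exact Finset.sum_congr rfl fun i _ => by rw [polyVal_smul]; ring
    rw [h3, h4] at h1
    linarith
  by_contra hne
  have hQ' : 0 < |Q| + 1 := by positivity
  -- Dividing by `|Q| + 1` instead of `Q` gives a step at which the quadratic is negative even when
  -- `Q = 0`.
  have := key (L / (|Q| + 1))
  have h5 : (L / (|Q| + 1)) ^ 2 * Q ≤ L ^ 2 / (|Q| + 1) := by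
    rw [div_pow, div_mul_eq_mul_div, div_le_div_iff₀ (by positivity) hQ']
    have : Q ≤ |Q| + 1 := by linarith [le_abs_self Q]
    have : 0 ≤ L ^ 2 * (|Q| + 1) * ((|Q| + 1) - Q) := by
      apply mul_nonneg (by positivity); linarith
    nlinarith
  have h6 : L / (|Q| + 1) * L = L ^ 2 / (|Q| + 1) := by ring
  have h7 : 0 < L ^ 2 / (|Q| + 1) := by positivity
  rw [h6] at this
  linarith

/-- A direction in the kernel of the Gram matrix is invisible to the weights. -/
lemma weight_mul_polyVal_eq_zero {k : ℕ → ℝ} (hk : ∀ i, 0 ≤ k i) (c : Fin (p + 1) → ℝ)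
    (hc : (gram p x I t k).mulVec c = 0) : ∀ i ∈ I, k i * polyVal c (t - x i) = 0 := by
  have h1 := gram_quadratic p x I t k c c
  simp only [hc, Pi.zero_apply, mul_zero, Finset.sum_const_zero] at h1
  have h2 := (Finset.sum_eq_zero_iff_of_nonneg
    (fun i _ => mul_nonneg (hk i) (mul_self_nonneg (polyVal c (t - x i))))).1 h1.symm
  intro i hi
  have := h2 i hi
  rcases mul_eq_zero.1 this with h | h
  · simp [h]
  · simp [mul_self_eq_zero.1 h]

/-- The quadratic form of the Gram matrix is a weighted sum of squares of values of the polynomial,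
so with nonnegative weights a null vector is a polynomial vanishing at every point of positive
weight. The converse is the next lemma. -/
lemma gram_det_ne_zero {k : ℕ → ℝ} (hk : ∀ i, 0 ≤ k i)
    (H : ∀ c : Fin (p + 1) → ℝ, (∀ i ∈ I, k i * polyVal c (t - x i) = 0) → c = 0) :
    (gram p x I t k).det ≠ 0 := by
  intro hdet
  obtain ⟨c, hc0, hc⟩ := Matrix.exists_mulVec_eq_zero_iff.2 hdet
  exact hc0 (H c (weight_mul_polyVal_eq_zero hk c hc))

lemma eq_zero_of_gram_det_ne_zero {k : ℕ → ℝ} (hdet : (gram p x I t k).det ≠ 0)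
    (c : Fin (p + 1) → ℝ) (hc : ∀ i ∈ I, k i * polyVal c (t - x i) = 0) : c = 0 := by
  by_contra hne
  refine hdet (Matrix.exists_mulVec_eq_zero_iff.1 ⟨c, hne, ?_⟩)
  ext a
  rw [gram_mulVec, Pi.zero_apply]
  exact Finset.sum_eq_zero fun i hi => by rw [hc i hi, zero_mul]

/-- Whether the Gram matrix is singular depends only on the support of the weights. -/
lemma gram_det_eq_zero_iff_of_support {k k' : ℕ → ℝ} (hk : ∀ i, 0 ≤ k i) (hk' : ∀ i, 0 ≤ k' i)
    (H : ∀ i ∈ I, (k i = 0 ↔ k' i = 0)) :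
    (gram p x I t k).det = 0 ↔ (gram p x I t k').det = 0 := by
  rw [← not_iff_not]
  constructor <;> intro h1
  · refine gram_det_ne_zero hk' fun c hc => eq_zero_of_gram_det_ne_zero h1 c fun i hi => ?_
    have := hc i hi
    rw [mul_eq_zero] at this ⊢
    rwa [H i hi]
  · refine gram_det_ne_zero hk fun c hc => eq_zero_of_gram_det_ne_zero h1 c fun i hi => ?_
    have := hc i hi
    rw [mul_eq_zero] at this ⊢
    rwa [← H i hi]

/-- A singular matrix has inverse `0` by convention. This matches the value `0` of the estimator
when the minimizer is not unique, so one linear formula covers both cases. -/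
lemma lpWeight_eq_zero_of_det {k : ℕ → ℝ} (hdet : (gram p x I t k).det = 0) (i : ℕ) :
    lpWeight p x I t k i = 0 := by
  have : (gram p x I t k)⁻¹ = 0 := Matrix.nonsing_inv_apply_not_isUnit _ (by simp [hdet])
  simp [lpWeight, this]

lemma lpWeight_eq_zero_of_weight {k : ℕ → ℝ} {i : ℕ} (hi : k i = 0) :
    lpWeight p x I t k i = 0 := by
  simp [lpWeight, hi]

/-- The intercept of the solution of the normal equations. -/
lemma sum_lpWeight_mul (k z : ℕ → ℝ) :
    ∑ i ∈ I, lpWeight p x I t k i * z i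
      = ((gram p x I t k)⁻¹.mulVec fun l => ∑ i ∈ I, k i * z i * (t - x i) ^ (l : ℕ)) 0 := by
  simp only [lpWeight, Matrix.mulVec, dotProduct, Finset.mul_sum, Finset.sum_mul]
  rw [Finset.sum_comm]
  exact Finset.sum_congr rfl fun i _ => Finset.sum_congr rfl fun l _ => by ring

/-- For polynomial data the right-hand side of the normal equations is the Gram matrix applied to
the coefficients. Because of this reproduction property only the Taylor remainder contributes to the
bias. -/
lemma sum_lpWeight_polyVal {k : ℕ → ℝ} (hdet : (gram p x I t k).det ≠ 0)
    (c : Fin (p + 1) → ℝ) :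
    ∑ i ∈ I, lpWeight p x I t k i * polyVal c (t - x i) = c 0 := by
  rw [sum_lpWeight_mul]
  have : (fun l : Fin (p + 1) => ∑ i ∈ I, k i * polyVal c (t - x i) * (t - x i) ^ (l : ℕ))
      = (gram p x I t k).mulVec c := by
    ext l; rw [gram_mulVec]
  rw [this, Matrix.mulVec_mulVec, Matrix.nonsing_inv_mul _ (isUnit_iff_ne_zero.2 hdet),
    Matrix.one_mulVec]

lemma sum_lpWeight {k : ℕ → ℝ} (hdet : (gram p x I t k).det ≠ 0) :
    ∑ i ∈ I, lpWeight p x I t k i = 1 := by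
  have := sum_lpWeight_polyVal hdet (Pi.single 0 1)
  simpa [polyVal, Pi.single_apply, Finset.sum_ite_eq'] using this

/-- The sum of squares of the weights is controlled by a Christoffel function bound. -/
lemma sum_sq_lpWeight_le {k : ℕ → ℝ} {M Λ : ℝ} (hk : ∀ i, 0 ≤ k i) (hM : ∀ i, k i ≤ M)
    (hΛ : ∀ c : Fin (p + 1) → ℝ, c 0 ^ 2 ≤ Λ * ∑ i ∈ I, k i * polyVal c (t - x i) ^ 2) :
    ∑ i ∈ I, lpWeight p x I t k i ^ 2 ≤ M * Λ := by
  have hM0 : 0 ≤ M := (hk 0).trans (hM 0)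
  -- A negative `Λ` would contradict the hypothesis at the constant polynomial `1`.
  have hΛ1 : 0 ≤ Λ := by
    by_contra hneg
    have h1 := hΛ (Pi.single 0 1)
    have h2 : 0 ≤ ∑ i ∈ I, k i * polyVal (Pi.single 0 1 : Fin (p + 1) → ℝ) (t - x i) ^ 2 :=
      Finset.sum_nonneg fun i _ => mul_nonneg (hk _) (sq_nonneg _)
    simp only [Pi.single_eq_same] at h1
    nlinarith
  by_cases hdet : (gram p x I t k).det = 0
  · simp only [lpWeight_eq_zero_of_det hdet]
    simpa using mul_nonneg hM0 hΛ1
  -- The first row `σ` of the inverse makes each weight equal to `k i` times the value of the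
  -- polynomial `σ`. Reproducing `σ` itself turns its weighted sum of squares into `σ 0`, and the
  -- hypothesis becomes `σ 0 ^ 2 ≤ Λ * σ 0`.
  set σ : Fin (p + 1) → ℝ := fun l => (gram p x I t k)⁻¹ 0 l with hσ
  have hw : ∀ i, lpWeight p x I t k i = k i * polyVal σ (t - x i) := fun i => rfl
  have h1 : ∑ i ∈ I, k i * polyVal σ (t - x i) ^ 2 = σ 0 := by
    rw [← sum_lpWeight_polyVal hdet σ]
    exact Finset.sum_congr rfl fun i _ => by rw [hw]; ring
  have h2 := hΛ σ
  rw [h1] at h2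
  have h3 : 0 ≤ σ 0 := by
    rw [← h1]; exact Finset.sum_nonneg fun i _ => mul_nonneg (hk _) (sq_nonneg _)
  have h4 : σ 0 ≤ Λ := by
    by_contra! hlt
    nlinarith
  calc ∑ i ∈ I, lpWeight p x I t k i ^ 2
      ≤ ∑ i ∈ I, M * (k i * polyVal σ (t - x i) ^ 2) := by
        refine Finset.sum_le_sum fun i _ => ?_
        rw [hw, mul_pow, pow_two (k i), mul_assoc]
        exact mul_le_mul_of_nonneg_right (hM i) (mul_nonneg (hk i) (sq_nonneg _))
    _ = M * σ 0 := by rw [← Finset.mul_sum, h1]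
    _ ≤ M * Λ := mul_le_mul_of_nonneg_left h4 hM0

/-- The solution of the normal equations. -/
lemma isLocalFit_iff_of_det (hK : ∀ u, 0 ≤ K u)
    (hdet : (gram p x I t fun i => K ((t - x i) / h)).det ≠ 0) (a : Fin (p + 1) → ℝ) :
    IsLocalFit p K h x I z t a ↔ a = (gram p x I t fun i => K ((t - x i) / h))⁻¹.mulVec
      fun l => ∑ i ∈ I, K ((t - x i) / h) * z i * (t - x i) ^ (l : ℕ) := by
  set k : ℕ → ℝ := fun i => K ((t - x i) / h) with hk
  set G := gram p x I t k with hG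
  set β : Fin (p + 1) → ℝ := fun l => ∑ i ∈ I, k i * z i * (t - x i) ^ (l : ℕ) with hβ
  have hunit : IsUnit G.det := isUnit_iff_ne_zero.2 hdet
  have e1 : a = G⁻¹.mulVec β ↔ G.mulVec a = β := by
    constructor
    · rintro rfl
      rw [Matrix.mulVec_mulVec, Matrix.mul_nonsing_inv _ hunit, Matrix.one_mulVec]
    · intro H
      rw [← H, Matrix.mulVec_mulVec, Matrix.nonsing_inv_mul _ hunit, Matrix.one_mulVec]
  have e2 : ∀ b : Fin (p + 1) → ℝ,
      ∑ i ∈ I, k i * (z i - polyVal a (t - x i)) * polyVal b (t - x i)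
        = ∑ l, b l * (β l - G.mulVec a l) := by
    intro b
    have h1 : ∑ l, b l * β l = ∑ i ∈ I, k i * z i * polyVal b (t - x i) := by
      simp only [hβ, Finset.mul_sum]
      rw [Finset.sum_comm]
      refine Finset.sum_congr rfl fun i _ => ?_
      rw [polyVal, Finset.mul_sum]
      exact Finset.sum_congr rfl fun l _ => by ring
    simp only [mul_sub, Finset.sum_sub_distrib]
    rw [h1, hG, gram_quadratic, ← Finset.sum_sub_distrib]
    exact Finset.sum_congr rfl fun l _ => by ring
  rw [e1]
  constructor
  · intro H
    ext l
    have h1 := H.normal a (Pi.single l 1)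
    have h2 := e2 (Pi.single l 1)
    rw [h1] at h2
    simp [Pi.single_apply] at h2
    linarith
  · intro H
    refine isLocalFit_of_normal hK a fun b => ?_
    have h2 := e2 b
    rw [H] at h2
    simpa using h2

/-- A null vector of the Gram matrix can be added to a minimizer without changing the loss; without
one the normal equations have exactly one solution. The criterion does not involve `z`, which is why
uniqueness holds for all data at once. -/
theorem existsUnique_isLocalFit_iff (hK : ∀ u, 0 ≤ K u) :
    (∃! a : Fin (p + 1) → ℝ, IsLocalFit p K h x I z t a)
      ↔ (gram p x I t fun i => K ((t - x i) / h)).det ≠ 0 := by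
  constructor
  · rintro ⟨a, ha, huniq⟩ hdet
    obtain ⟨c, hc0, hc⟩ := Matrix.exists_mulVec_eq_zero_iff.2 hdet
    have hz := weight_mul_polyVal_eq_zero (fun i => hK _) c hc
    have h1 : localLoss p K h x I z t (a + c) = localLoss p K h x I z t a := by
      rw [localLoss_add]
      have s1 : ∑ i ∈ I, K ((t - x i) / h) * (z i - polyVal a (t - x i)) * polyVal c (t - x i)
          = 0 := Finset.sum_eq_zero fun i hi => by
        rw [mul_right_comm, hz i hi, zero_mul]
      have s2 : ∑ i ∈ I, K ((t - x i) / h) * polyVal c (t - x i) ^ 2 = 0 :=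
        Finset.sum_eq_zero fun i hi => by
          rw [pow_two, ← mul_assoc, hz i hi, zero_mul]
      rw [s1, s2]; ring
    have h2 : a + c = a := huniq (a + c) fun b => by rw [h1]; exact ha b
    exact hc0 (by simpa using h2)
  · intro hdet
    exact ⟨_, (isLocalFit_iff_of_det hK hdet _).2 rfl,
      fun b hb => (isLocalFit_iff_of_det hK hdet _).1 hb⟩

/-- The local polynomial estimator is linear in the data. -/
theorem localPoly_eq_sum (hK : ∀ u, 0 ≤ K u) :
    localPoly p K h x I z t
      = ∑ i ∈ I, lpWeight p x I t (fun i => K ((t - x i) / h)) i * z i := by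
  rw [localPoly]
  split_ifs with H
  · have hdet := (existsUnique_isLocalFit_iff hK).1 H
    rw [sum_lpWeight_mul]
    exact congrFun ((isLocalFit_iff_of_det hK hdet _).1 H.choose_spec.1) 0
  · have hdet : (gram p x I t fun i => K ((t - x i) / h)).det = 0 := by
      by_contra hne
      exact H ((existsUnique_isLocalFit_iff hK).2 hne)
    simp [lpWeight_eq_zero_of_det hdet]

end Fit

/-! ### Hölder classes: Taylor expansion, modulus of continuity and oscillating members. -/

lemma strictFloor_lt {γ : ℝ} (hγ : 0 < γ) : (strictFloor γ : ℝ) < γ := by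
  have h1 : 0 < ⌈γ⌉₊ := Nat.ceil_pos.2 hγ
  have h2 := Nat.ceil_lt_add_one hγ.le
  rw [strictFloor, Nat.cast_sub h1]
  push_cast; linarith

lemma le_strictFloor_add_one (γ : ℝ) : γ ≤ strictFloor γ + 1 := by
  have h2 := Nat.le_ceil γ
  have : ⌈γ⌉₊ ≤ strictFloor γ + 1 := by rw [strictFloor]; omega
  calc γ ≤ (⌈γ⌉₊ : ℝ) := h2
    _ ≤ ((strictFloor γ + 1 : ℕ) : ℝ) := by exact_mod_cast this
    _ = _ := by push_cast; ring

/-- Taylor expansion with a Hölder remainder. -/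
lemma exists_taylor_of_holder (m : ℕ) {θ C : ℝ} (hθ : 0 < θ) (hC : 0 ≤ C) (f : ℝ → ℝ)
    (hf : ContDiffOn ℝ m f (Ioo 0 1)) {t : ℝ} (ht : t ∈ Ioo (0 : ℝ) 1)
    (H : ∀ y ∈ Ioo (0 : ℝ) 1,
      |iteratedDerivWithin m f (Ioo 0 1) y - iteratedDerivWithin m f (Ioo 0 1) t|
        ≤ C * |y - t| ^ θ) :
    ∃ c : ℕ → ℝ, c 0 = f t ∧ ∀ y ∈ Ioo (0 : ℝ) 1,
      |f y - ∑ k ∈ Finset.range (m + 1), c k * (y - t) ^ k| ≤ C * |y - t| ^ (m + θ) := by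
  induction m generalizing f with
  | zero =>
    refine ⟨fun _ => f t, rfl, fun y hy => ?_⟩
    simpa using H y hy
  | succ m ih =>
    have hder : ContDiffOn ℝ m (derivWithin f (Ioo 0 1)) (Ioo 0 1) :=
      hf.derivWithin (uniqueDiffOn_Ioo 0 1) (by norm_cast)
    have hdiff : DifferentiableOn ℝ f (Ioo 0 1) :=
      hf.differentiableOn (by simp)
    obtain ⟨c, hc0, hc⟩ := ih (derivWithin f (Ioo 0 1)) hder (fun y hy => by
      have := H y hy
      rwa [iteratedDerivWithin_succ'] at this)
    -- The Taylor polynomial is the primitive of the one for the derivative, with constant term `f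
    -- t`. The mean value inequality applied to the remainder gains one power of `|y - t|`.
    refine ⟨fun k => if k = 0 then f t else c (k - 1) / k, by simp, fun y hy => ?_⟩
    set R : ℝ → ℝ := fun u => f u - ∑ k ∈ Finset.range (m + 2),
      (if k = 0 then f t else c (k - 1) / k) * (u - t) ^ k with hR
    have hRt : R t = 0 := by
      simp only [hR, sub_self]
      rw [Finset.sum_range_succ']
      simp
    have hRd : ∀ u ∈ Ioo (0 : ℝ) 1, HasDerivWithinAt R
        (derivWithin f (Ioo 0 1) u - ∑ k ∈ Finset.range (m + 1), c k * (u - t) ^ k)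
        (Ioo 0 1) u := by
      intro u hu
      have h1 : HasDerivWithinAt f (derivWithin f (Ioo 0 1) u) (Ioo 0 1) u :=
        (hdiff u hu).hasDerivWithinAt
      refine h1.sub ?_
      have h2 : HasDerivAt (fun u : ℝ => ∑ k ∈ Finset.range (m + 2),
          (if k = 0 then f t else c (k - 1) / k) * (u - t) ^ k)
          (∑ k ∈ Finset.range (m + 2),
          (if k = 0 then f t else c (k - 1) / k) * (k * (u - t) ^ (k - 1) * 1)) u := by
        refine HasDerivAt.fun_sum fun k _ => ?_
        exact (((hasDerivAt_id u).sub_const t).pow k).const_mul _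
      have h3 : ∑ k ∈ Finset.range (m + 2),
          (if k = 0 then f t else c (k - 1) / k) * (k * (u - t) ^ (k - 1) * 1)
          = ∑ k ∈ Finset.range (m + 1), c k * (u - t) ^ k := by
        rw [Finset.sum_range_succ']
        simp only [Nat.add_eq_zero_iff, one_ne_zero, and_false, if_false, Nat.add_sub_cancel,
          CharP.cast_eq_zero, zero_mul, mul_zero, add_zero, mul_one]
        refine Finset.sum_congr rfl fun k _ => ?_
        have : ((k + 1 : ℕ) : ℝ) ≠ 0 := by positivity
        field_simp
      rw [h3] at h2
      exact h2.hasDerivWithinAt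
    have hsub : uIcc t y ⊆ Ioo (0 : ℝ) 1 := ordConnected_Ioo.uIcc_subset ht hy
    have hbound : ∀ u ∈ uIcc t y,
        ‖derivWithin f (Ioo 0 1) u - ∑ k ∈ Finset.range (m + 1), c k * (u - t) ^ k‖
          ≤ C * |y - t| ^ (m + θ) := by
      intro u hu
      refine (hc u (hsub hu)).trans ?_
      have : |u - t| ≤ |y - t| := abs_sub_left_of_mem_uIcc hu
      gcongr
    have := (convex_uIcc t y).norm_image_sub_le_of_norm_hasDerivWithin_le
      (fun u hu => (hRd u (hsub hu)).mono hsub) hbound left_mem_uIcc right_mem_uIcc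
    rw [hRt, sub_zero, Real.norm_eq_abs, Real.norm_eq_abs] at this
    refine this.trans (le_of_eq ?_)
    rw [mul_assoc]
    congr 1
    by_cases h0 : |y - t| = 0
    · rw [h0, mul_zero, Real.zero_rpow]; positivity
    · rw [← Real.rpow_add_one h0]
      congr 1; push_cast; ring

/-- The fit uses powers of `t - y` rather than `y - t`, hence the signs in the coefficients;
coefficients above the order of differentiability are zero. Continuity extends the bound from the
open interval to the end points. -/
lemma HolderClass.taylor {γ C₁ C₂ : ℝ} {f : ℝ → ℝ} (hγ : 0 < γ) (hC₁ : 0 ≤ C₁)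
    (hf : HolderClass γ C₁ C₂ f) {p : ℕ} (hp : strictFloor γ ≤ p) {t : ℝ}
    (ht : t ∈ Ioo (0 : ℝ) 1) :
    ∃ c : Fin (p + 1) → ℝ, c 0 = f t ∧ ∀ y ∈ Icc (0 : ℝ) 1,
      |f y - polyVal c (t - y)| ≤ C₁ * |t - y| ^ γ := by
  have hm := strictFloor_lt hγ
  obtain ⟨c, hc0, hc⟩ := exists_taylor_of_holder (strictFloor γ) (sub_pos.2 hm) hC₁ f
    hf.contDiffOn ht (fun y hy => hf.holder y hy t ht)
  refine ⟨fun k => if (k : ℕ) ≤ strictFloor γ then (-1) ^ (k : ℕ) * c k else 0, by simp [hc0], ?_⟩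
  have hpoly : ∀ y, polyVal (fun k : Fin (p + 1) => if (k : ℕ) ≤ strictFloor γ
      then (-1) ^ (k : ℕ) * c k else 0) (t - y)
      = ∑ k ∈ Finset.range (strictFloor γ + 1), c k * (y - t) ^ k := by
    intro y
    rw [polyVal, Fin.sum_univ_eq_sum_range (fun k => (if k ≤ strictFloor γ
      then (-1) ^ k * c k else 0) * (t - y) ^ k)]
    have : Finset.range (strictFloor γ + 1) ⊆ Finset.range (p + 1) := by
      simpa using hp
    rw [← Finset.sum_subset this]
    · refine Finset.sum_congr rfl fun k hk => ?_
      rw [if_pos (by simpa [Nat.lt_succ_iff] using hk), mul_right_comm, ← mul_pow, mul_comm]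
      congr 2; ring
    · intro k _ hk
      rw [if_neg (by simpa [Nat.lt_succ_iff] using hk), zero_mul]
  intro y hy
  simp only [hpoly]
  have hy' : y ∈ closure (Ioo (0 : ℝ) 1) := by rwa [closure_Ioo (by norm_num)]
  refine le_on_closure (f := fun y => |f y - ∑ k ∈ Finset.range (strictFloor γ + 1),
    c k * (y - t) ^ k|) (g := fun y => C₁ * |t - y| ^ γ) ?_ ?_ ?_ hy'
  · intro y hy
    have := hc y hy
    rwa [add_sub_cancel, abs_sub_comm y t] at this
  · rw [closure_Ioo (by norm_num)]
    refine (hf.continuousOn.sub (Continuous.continuousOn ?_)).abs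
    fun_prop
  · refine Continuous.continuousOn ?_
    exact continuous_const.mul ((by fun_prop : Continuous fun y => |t - y|).rpow_const
      fun _ => Or.inr hγ.le)

/-- The functions of a Hölder class have a common modulus of continuity. -/
lemma HolderClass.modulus {γ C₁ C₂ : ℝ} {f : ℝ → ℝ} (hγ : 0 < γ) (hC₁ : 0 ≤ C₁) (hC₂ : 0 ≤ C₂)
    (hf : HolderClass γ C₁ C₂ f) {y z : ℝ} (hy : y ∈ Icc (0 : ℝ) 1) (hz : z ∈ Icc (0 : ℝ) 1) :
    |f y - f z| ≤ (C₁ + 6 * C₂) * |y - z| ^ min γ 1 := by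
  have hθ : 0 < min γ 1 := by positivity
  have main : ∀ y ∈ Ioo (0 : ℝ) 1, ∀ z ∈ Ioo (0 : ℝ) 1,
      |f y - f z| ≤ (C₁ + 6 * C₂) * |y - z| ^ min γ 1 := by
    rcases Nat.eq_zero_or_pos (strictFloor γ) with h0 | hpos
    · intro y hy z hz
      have h1 := hf.holder y hy z hz
      have h2 := le_strictFloor_add_one γ
      rw [h0] at h1 h2
      simp only [iteratedDerivWithin_zero, CharP.cast_eq_zero, sub_zero, zero_add] at h1 h2
      rw [min_eq_left h2]
      refine h1.trans ?_
      gcongr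
      linarith
    · have h1γ : 1 ≤ γ := by
        have h1 := strictFloor_lt hγ
        have : (1 : ℝ) ≤ strictFloor γ := by exact_mod_cast hpos
        linarith
      have hdiff : DifferentiableOn ℝ f (Ioo 0 1) :=
        hf.contDiffOn.differentiableOn (by exact_mod_cast hpos.ne')
      have hD : ∀ u ∈ Ioo (0 : ℝ) 1, |derivWithin f (Ioo 0 1) u| ≤ C₁ + 6 * C₂ := by
        intro u hu
        rcases Nat.lt_or_ge 1 (strictFloor γ) with h2 | h2
        · have := hf.bound 1 h2 u hu
          rw [iteratedDerivWithin_one] at this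
          linarith
        -- In this case the class does not bound the first derivative. The mean value theorem
        -- between `1/3` and `2/3` gives a point where it is at most `6 * C₂`, and its Hölder
        -- condition carries the bound to the whole interval at the cost of `C₁`.
        · have h1 : strictFloor γ = 1 := le_antisymm h2 hpos
          have hcont : ContinuousOn f (Icc (1/3) (2/3)) :=
            hf.continuousOn.mono (Icc_subset_Icc (by norm_num) (by norm_num))
          have hdm : ∀ v ∈ Ioo (1/3 : ℝ) (2/3), HasDerivAt f (derivWithin f (Ioo 0 1) v) v := by
            intro v hv
            have hv' : v ∈ Ioo (0 : ℝ) 1 := ⟨by linarith [hv.1], by linarith [hv.2]⟩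
            exact (hdiff v hv').hasDerivWithinAt.hasDerivAt (Ioo_mem_nhds hv'.1 hv'.2)
          obtain ⟨v, hv, hv2⟩ := exists_hasDerivAt_eq_slope f _ (by norm_num) hcont hdm
          have hv' : v ∈ Ioo (0 : ℝ) 1 := ⟨by linarith [hv.1], by linarith [hv.2]⟩
          have b1 := hf.bound 0 (by omega) (1/3) ⟨by norm_num, by norm_num⟩
          have b2 := hf.bound 0 (by omega) (2/3) ⟨by norm_num, by norm_num⟩
          rw [iteratedDerivWithin_zero] at b1 b2
          have hval : |derivWithin f (Ioo 0 1) v| ≤ 6 * C₂ := by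
            rw [hv2]
            have : (2/3 - 1/3 : ℝ) = 1/3 := by norm_num
            rw [this, div_div_eq_mul_div, div_one, abs_mul, abs_of_pos (by norm_num : (0:ℝ) < 3)]
            have := abs_sub (f (2/3)) (f (1/3))
            linarith
          have hh := hf.holder u hu v hv'
          rw [h1, iteratedDerivWithin_one] at hh
          have hle : |u - v| ^ (γ - ((1 : ℕ) : ℝ)) ≤ 1 := by
            refine Real.rpow_le_one (abs_nonneg _) ?_ (by push_cast; linarith)
            rw [abs_le]; constructor <;> linarith [hu.1, hu.2, hv'.1, hv'.2]
          have hh2 : |derivWithin f (Ioo 0 1) u - derivWithin f (Ioo 0 1) v| ≤ C₁ :=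
            hh.trans (by nlinarith)
          have := abs_sub_abs_le_abs_sub (derivWithin f (Ioo 0 1) u) (derivWithin f (Ioo 0 1) v)
          linarith
      intro y hy z hz
      rw [min_eq_right h1γ, Real.rpow_one]
      have := (convex_Ioo (0:ℝ) 1).norm_image_sub_le_of_norm_derivWithin_le hdiff hD hz hy
      simpa using this
  -- The end points are reached by continuity, one variable at a time.
  have step : ∀ y ∈ Ioo (0 : ℝ) 1, ∀ z ∈ Icc (0 : ℝ) 1,
      |f y - f z| ≤ (C₁ + 6 * C₂) * |y - z| ^ min γ 1 := by
    intro y hy z hz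
    have hz' : z ∈ closure (Ioo (0 : ℝ) 1) := by rwa [closure_Ioo (by norm_num)]
    refine le_on_closure (f := fun z => |f y - f z|)
      (g := fun z => (C₁ + 6 * C₂) * |y - z| ^ min γ 1) (main y hy) ?_ ?_ hz'
    · rw [closure_Ioo (by norm_num)]
      exact (continuousOn_const.sub hf.continuousOn).abs
    · refine Continuous.continuousOn ?_
      exact continuous_const.mul ((by fun_prop : Continuous fun z => |y - z|).rpow_const
        fun _ => Or.inr hθ.le)
  have hy' : y ∈ closure (Ioo (0 : ℝ) 1) := by rwa [closure_Ioo (by norm_num)]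
  refine le_on_closure (f := fun y => |f y - f z|)
    (g := fun y => (C₁ + 6 * C₂) * |y - z| ^ min γ 1) (fun y hy => step y hy z hz) ?_ ?_ hy'
  · rw [closure_Ioo (by norm_num)]
    exact (hf.continuousOn.sub continuousOn_const).abs
  · refine Continuous.continuousOn ?_
    exact continuous_const.mul ((by fun_prop : Continuous fun y => |y - z|).rpow_const
      fun _ => Or.inr hθ.le)

lemma iteratedDerivWithin_Ioo_eq (f : ℝ → ℝ) (k : ℕ) {y : ℝ} (hy : y ∈ Ioo (0 : ℝ) 1) :
    iteratedDerivWithin k f (Ioo 0 1) y = iteratedDeriv k f y :=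
  iteratedDerivWithin_of_isOpen isOpen_Ioo hy

lemma holderClass_const {γ C₁ C₂ c : ℝ} (hC₁ : 0 ≤ C₁) (hc : |c| ≤ C₂) :
    HolderClass γ C₁ C₂ fun _ => c where
  continuousOn := continuousOn_const
  contDiffOn := contDiffOn_const
  holder := by
    intro y hy z hz
    rw [iteratedDerivWithin_Ioo_eq _ _ hy, iteratedDerivWithin_Ioo_eq _ _ hz]
    simp only [iteratedDeriv_const]
    rw [sub_self, abs_zero]
    positivity
  bound := by
    intro k _ y hy
    rw [iteratedDerivWithin_Ioo_eq _ _ hy, iteratedDeriv_const]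
    split_ifs
    · exact hc
    · simpa using (abs_nonneg c).trans hc

lemma varianceClass_const {γ C₁ C₂ : ℝ} (hC₁ : 0 ≤ C₁) (hC₂ : 0 ≤ C₂) :
    VarianceClass γ C₁ C₂ fun _ => C₂ where
  holderClass := holderClass_const hC₁ (abs_of_nonneg hC₂).le
  nonneg _ _ := hC₂
  le _ _ := le_rfl

lemma iteratedDeriv_cos_affine (k : ℕ) (ξ s : ℝ) :
    iteratedDeriv k (fun y => Real.cos (ξ * y + s))
      = fun y => ξ ^ k * Real.cos (ξ * y + (s + k * (Real.pi / 2))) := by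
  induction k with
  | zero => simp
  | succ k ih =>
    rw [iteratedDeriv_succ, ih]
    ext y
    have h1 : HasDerivAt (fun y => ξ ^ k * Real.cos (ξ * y + (s + k * (Real.pi / 2))))
        (ξ ^ k * (-Real.sin (ξ * y + (s + k * (Real.pi / 2))) * (ξ * 1))) y := by
      refine HasDerivAt.const_mul _ (HasDerivAt.cos ?_)
      exact ((hasDerivAt_id y).const_mul ξ).add_const _
    rw [h1.deriv]
    have : ξ * y + (s + ((k + 1 : ℕ) : ℝ) * (Real.pi / 2))
        = ξ * y + (s + k * (Real.pi / 2)) + Real.pi / 2 := by push_cast; ring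
    rw [this, Real.cos_add_pi_div_two]
    ring

/-- An oscillating variance function of frequency `ξ` and amplitude of order `ξ ^ (-γ)`. -/
def oscillation (γ C₁ C₂ ξ s : ℝ) (y : ℝ) : ℝ :=
  C₂ / 2 + min (C₁ / 2) (C₂ / 2) * ξ ^ (-γ) * Real.cos (ξ * y + s)

/-- The derivative of order m has size of order ξ^(m-γ) and varies on the scale 1/ξ, so its Hölder
seminorm of exponent γ-m is bounded independently of ξ. The prefactor `min (C₁ / 2) (C₂ / 2)` and
the offset `C₂ / 2` keep the constants and the range within the class. -/
lemma varianceClass_oscillation {γ C₁ C₂ ξ : ℝ} (s : ℝ) (hγ : 0 < γ) (hC₁ : 0 < C₁)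
    (hC₂ : 0 < C₂) (hξ : 1 ≤ ξ) : VarianceClass γ C₁ C₂ (oscillation γ C₁ C₂ ξ s) := by
  have hξ0 : 0 < ξ := by linarith
  set A := min (C₁ / 2) (C₂ / 2) with hA
  have hA0 : 0 ≤ A := by positivity
  have hA1 : A ≤ C₁ / 2 := min_le_left _ _
  have hA2 : A ≤ C₂ / 2 := min_le_right _ _
  have hξγ : ξ ^ (-γ) ≤ 1 := Real.rpow_le_one_of_one_le_of_nonpos hξ (by linarith)
  have hξγ0 : 0 < ξ ^ (-γ) := Real.rpow_pos_of_pos hξ0 _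
  have hAx : A * ξ ^ (-γ) ≤ C₂ / 2 := by nlinarith
  have hcd : ContDiff ℝ ⊤ (oscillation γ C₁ C₂ ξ s) := by
    unfold oscillation
    fun_prop
  have hval : ∀ y, |A * ξ ^ (-γ) * Real.cos (ξ * y + s)| ≤ C₂ / 2 := by
    intro y
    rw [abs_mul, abs_of_nonneg (by positivity)]
    exact (mul_le_of_le_one_right (by positivity) (Real.abs_cos_le_one _)).trans hAx
  have hderiv : ∀ k y, iteratedDeriv k (oscillation γ C₁ C₂ ξ s) y
      = (if k = 0 then C₂ / 2 else 0)
        + A * ξ ^ (-γ) * (ξ ^ k * Real.cos (ξ * y + (s + k * (Real.pi / 2)))) := by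
    intro k y
    unfold oscillation
    have h1 : ContDiffAt ℝ k (fun _ : ℝ => C₂ / 2) y := contDiffAt_const
    have h2 : ContDiffAt ℝ k (fun y : ℝ => A * ξ ^ (-γ) * Real.cos (ξ * y + s)) y := by
      fun_prop
    have h3 := iteratedDeriv_fun_add h1 h2
    rw [h3, iteratedDeriv_const, iteratedDeriv_const_mul_field, iteratedDeriv_cos_affine]
  have hpow : ∀ k ≤ strictFloor γ, A * ξ ^ (-γ) * ξ ^ k ≤ C₂ / 2 := by
    intro k hk
    have hk' : (k : ℝ) ≤ strictFloor γ := by exact_mod_cast hk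
    have := strictFloor_lt hγ
    rw [mul_assoc, ← Real.rpow_natCast, ← Real.rpow_add hξ0]
    have : ξ ^ (-γ + k) ≤ 1 := Real.rpow_le_one_of_one_le_of_nonpos hξ (by linarith)
    have := Real.rpow_pos_of_pos hξ0 (-γ + k)
    nlinarith
  refine ⟨⟨hcd.continuous.continuousOn, (hcd.of_le le_top).contDiffOn, ?_, ?_⟩, ?_, ?_⟩
  · intro y hy z hz
    rw [iteratedDerivWithin_Ioo_eq _ _ hy, iteratedDerivWithin_Ioo_eq _ _ hz, hderiv, hderiv]
    set m := strictFloor γ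
    set φ := s + m * (Real.pi / 2)
    have hθ : 0 < γ - m := sub_pos.2 (strictFloor_lt hγ)
    have hθ1 : γ - m ≤ 1 := by linarith [le_strictFloor_add_one γ]
    -- Interpolation between the trivial bound 2 and the Lipschitz bound, according to whether `ξ *
    -- |y - z|` is at least 1.
    have h1 : |Real.cos (ξ * y + φ) - Real.cos (ξ * z + φ)| ≤ 2 * (ξ * |y - z|) ^ (γ - m) := by
      have hle2 : |Real.cos (ξ * y + φ) - Real.cos (ξ * z + φ)| ≤ 2 := by
        have := abs_sub (Real.cos (ξ * y + φ)) (Real.cos (ξ * z + φ))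
        linarith [Real.abs_cos_le_one (ξ * y + φ), Real.abs_cos_le_one (ξ * z + φ)]
      rcases le_or_gt 1 (ξ * |y - z|) with h | h
      · have := Real.one_le_rpow h hθ.le
        linarith
      · have hl : |Real.cos (ξ * y + φ) - Real.cos (ξ * z + φ)| ≤ ξ * |y - z| := by
          have := Real.abs_cos_sub_cos_le (ξ * y + φ) (ξ * z + φ)
          rw [add_sub_add_right_eq_sub, ← mul_sub, abs_mul, abs_of_pos hξ0] at this
          exact this
        rcases (by positivity : 0 ≤ ξ * |y - z|).eq_or_lt with h0 | h0
        · rw [← h0] at hl ⊢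
          rw [Real.zero_rpow hθ.ne']; linarith
        · have := Real.rpow_le_rpow_of_exponent_ge h0 h.le hθ1
          rw [Real.rpow_one] at this
          linarith
    rw [add_sub_add_left_eq_sub, ← mul_sub, ← mul_sub, ← mul_assoc, abs_mul,
      abs_of_nonneg (by positivity : 0 ≤ A * ξ ^ (-γ) * ξ ^ m)]
    have h2 : A * ξ ^ (-γ) * ξ ^ m * (2 * (ξ * |y - z|) ^ (γ - m))
        = 2 * A * |y - z| ^ (γ - m) := by
      rw [Real.mul_rpow hξ0.le (abs_nonneg _)]
      have : ξ ^ (-γ) * ξ ^ m * ξ ^ (γ - m) = 1 := by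
        rw [← Real.rpow_natCast, ← Real.rpow_add hξ0, ← Real.rpow_add hξ0]
        have : -γ + (m : ℝ) + (γ - m) = 0 := by ring
        rw [this, Real.rpow_zero]
      calc _ = 2 * A * (ξ ^ (-γ) * ξ ^ m * ξ ^ (γ - m)) * |y - z| ^ (γ - m) := by ring
        _ = _ := by rw [this, mul_one]
    calc _ ≤ A * ξ ^ (-γ) * ξ ^ m * (2 * (ξ * |y - z|) ^ (γ - m)) := by gcongr
      _ = 2 * A * |y - z| ^ (γ - m) := h2
      _ ≤ C₁ * |y - z| ^ (γ - m) := by gcongr; linarith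
  · intro k hk y hy
    rw [iteratedDerivWithin_Ioo_eq _ _ hy, hderiv]
    have h1 : |A * ξ ^ (-γ) * (ξ ^ k * Real.cos (ξ * y + (s + k * (Real.pi / 2))))| ≤ C₂ / 2 := by
      rw [← mul_assoc, abs_mul, abs_of_nonneg (by positivity)]
      exact (mul_le_of_le_one_right (by positivity) (Real.abs_cos_le_one _)).trans (hpow k hk.le)
    refine (abs_add_le _ _).trans ?_
    have h2 : |if k = 0 then C₂ / 2 else 0| ≤ C₂ / 2 := by
      split_ifs
      · rw [abs_of_pos (by positivity)]
      · rw [abs_zero]; positivity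
    linarith
  · intro y _
    have := (abs_le.1 (hval y)).1
    unfold oscillation
    linarith
  · intro y _
    have := (abs_le.1 (hval y)).2
    unfold oscillation
    linarith

/-! ### Design points: counting and sampling inequalities for polynomials. -/

/-- Points `0 = y 0 ≤ y 1 ≤ … ≤ y (n + 1) = 1` with gaps at most `δ`. -/
structure HasMesh (y : ℕ → ℝ) (n : ℕ) (δ : ℝ) : Prop where
  left : y 0 = 0
  right : y (n + 1) = 1
  mono : ∀ i ≤ n, y i ≤ y (i + 1)
  gap : ∀ i ≤ n, y (i + 1) - y i ≤ δ

namespace HasMesh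

variable {y : ℕ → ℝ} {n : ℕ} {δ : ℝ}

lemma le_of_le (H : HasMesh y n δ) {i j : ℕ} (hij : i ≤ j) (hj : j ≤ n + 1) : y i ≤ y j := by
  induction j, hij using Nat.le_induction with
  | base => exact le_rfl
  | succ j _ ih => exact (ih (by omega)).trans (H.mono j (by omega))

lemma sub_le (H : HasMesh y n δ) {i j : ℕ} (hij : i ≤ j) (hj : j ≤ n + 1) :
    y j - y i ≤ ((j : ℝ) - i) * δ := by
  induction j, hij using Nat.le_induction with
  | base => simp
  | succ j _ ih =>
    have h1 := ih (by omega)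
    have h2 := H.gap j (by omega)
    push_cast
    linarith

lemma mem_Icc (H : HasMesh y n δ) {i : ℕ} (hi : i ≤ n + 1) : y i ∈ Icc (0 : ℝ) 1 :=
  ⟨H.left ▸ H.le_of_le (Nat.zero_le i) hi, H.right ▸ H.le_of_le hi le_rfl⟩

lemma nonneg (H : HasMesh y n δ) : 0 ≤ δ := by
  linarith [H.mono 0 (Nat.zero_le _), H.gap 0 (Nat.zero_le _)]

lemma abs_sub_le (H : HasMesh y n δ) {i j : ℕ} {r : ℝ} (hi : i ≤ n + 1) (hj : j ≤ n + 1)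
    (hij : (i : ℝ) - j ≤ r) (hji : (j : ℝ) - i ≤ r) : |y i - y j| ≤ r * δ := by
  have hδ := H.nonneg
  rcases le_total i j with h | h
  · have h1 := H.sub_le h hj
    rw [abs_sub_comm, abs_of_nonneg (sub_nonneg.2 (H.le_of_le h hj))]
    exact h1.trans (mul_le_mul_of_nonneg_right hji hδ)
  · have h1 := H.sub_le h hi
    rw [abs_of_nonneg (sub_nonneg.2 (H.le_of_le h hi))]
    exact h1.trans (mul_le_mul_of_nonneg_right hij hδ)

lemma exists_le_le (H : HasMesh y n δ) {u : ℝ} (hu : u ∈ Icc (0 : ℝ) 1) :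
    ∃ i ≤ n, y i ≤ u ∧ u ≤ y (i + 1) := by
  have hex : ∃ j, j ≤ n + 1 ∧ u ≤ y j := ⟨n + 1, le_rfl, H.right ▸ hu.2⟩
  classical
  obtain ⟨hj1, hj2⟩ := Nat.find_spec hex
  rcases Nat.eq_zero_or_pos (Nat.find hex) with h0 | hpos
  · rw [h0] at hj2
    refine ⟨0, Nat.zero_le _, H.left ▸ hu.1, hj2.trans (H.mono 0 (Nat.zero_le _))⟩
  · have hlt := Nat.find_min hex (Nat.sub_lt hpos one_pos)
    refine ⟨Nat.find hex - 1, by omega, ?_, ?_⟩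
    · by_contra! hcon
      exact hlt ⟨by omega, hcon.le⟩
    · rwa [Nat.sub_add_cancel hpos]

/-- A point of `[α + δ, β]` lies in a gap whose left end is in `[α, β]`. Hence intervals of length
`δ` attached to the counted points cover `[α + δ, β]`, and lengths can be compared. -/
lemma length_le_card_range (H : HasMesh y n δ) {α β : ℝ} (hα : 0 ≤ α) (hβ : β ≤ 1) :
    β - α ≤ δ * (((Finset.range (n + 1)).filter fun i => y i ∈ Icc α β).card + 1) := by
  have hδ := H.nonneg
  set S := (Finset.range (n + 1)).filter fun i => y i ∈ Icc α β with hS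
  have hcover : Icc (α + δ) β ⊆ ⋃ i ∈ S, Icc (y i) (y i + δ) := by
    intro u hu
    obtain ⟨i, hi, h1, h2⟩ := H.exists_le_le (u := u) ⟨by linarith [hu.1], hu.2.trans hβ⟩
    have h3 := H.gap i hi
    simp only [mem_iUnion]
    refine ⟨i, ?_, h1, by linarith⟩
    rw [hS, Finset.mem_filter]
    exact ⟨by simpa [Nat.lt_succ_iff] using hi, by linarith [hu.1], h1.trans hu.2⟩
  have h1 := (measure_mono (μ := volume) hcover).trans (measure_biUnion_finset_le S _)
  simp only [Real.volume_Icc, add_sub_cancel_left, Finset.sum_const, nsmul_eq_mul] at h1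
  rw [← ENNReal.ofReal_natCast, ← ENNReal.ofReal_mul (by positivity),
    ENNReal.ofReal_le_ofReal_iff (by positivity)] at h1
  linarith

/-- Exactly `r + 1` of the indices `0, …, n` carry no pseudoresidual, which turns the `1` of the
previous bound into `r + 2`. -/
lemma length_le_card (H : HasMesh y n δ) {r : ℕ} (hr : r ≤ n) {α β : ℝ} (hα : 0 ≤ α)
    (hβ : β ≤ 1) :
    β - α ≤ δ * (((residualIndices r n).filter fun i => y i ∈ Icc α β).card + (r + 2)) := by
  refine (H.length_le_card_range hα hβ).trans (mul_le_mul_of_nonneg_left ?_ H.nonneg)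
  have hsub : (Finset.range (n + 1)).filter (fun i => y i ∈ Icc α β)
      ⊆ (residualIndices r n).filter (fun i => y i ∈ Icc α β)
        ∪ (Finset.range (n + 1) \ residualIndices r n) := by
    intro i hi
    simp only [Finset.mem_union, Finset.mem_filter, Finset.mem_sdiff] at hi ⊢
    tauto
  have hI : residualIndices r n ⊆ Finset.range (n + 1) := by
    intro i hi
    simp only [residualIndices, Finset.mem_Icc, Finset.mem_range] at hi ⊢
    omega
  have h1 := (Finset.card_le_card hsub).trans (Finset.card_union_le _ _)
  have h2 : (Finset.range (n + 1) \ residualIndices r n).card = r + 1 := by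
    rw [Finset.card_sdiff_of_subset hI, Finset.card_range, residualIndices, Nat.card_Icc]
    omega
  rw [h2] at h1
  have : (((Finset.range (n + 1)).filter fun i => y i ∈ Icc α β).card : ℝ)
      ≤ ((residualIndices r n).filter fun i => y i ∈ Icc α β).card + (r + 1) := by
    exact_mod_cast h1
  linarith

end HasMesh

lemma IsDesign.exists_hasMesh {x : ℕ → ℕ → ℝ} (hx : IsDesign x) :
    ∃ D : ℝ, 0 < D ∧ ∀ n : ℕ, 1 ≤ n → HasMesh (x n) n (D / n) := by
  obtain ⟨C, hC⟩ := hx.gap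
  refine ⟨max C 1, by positivity, fun n hn => ⟨hx.left n, hx.right n, hx.mono n, ?_⟩⟩
  intro i hi
  refine (hC n hn i hi).trans ?_
  gcongr
  exact le_max_left _ _

/-- A polynomial is controlled by its values at well separated points. -/
lemma abs_polyVal_le_of_separated {p : ℕ} (c : Fin (p + 1) → ℝ) (v : Fin (p + 1) → ℝ)
    {ρ w u : ℝ} (hw : 0 < w) (hv : ∀ l, |v l| ≤ ρ) (hsep : ∀ l j, l ≠ j → w ≤ |v l - v j|)
    (hu : |u| ≤ ρ) : |polyVal c u| ≤ (2 * ρ / w) ^ p * ∑ l, |polyVal c (v l)| := by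
  set P : Polynomial ℝ := ∑ k : Fin (p + 1), Polynomial.C (c k) * Polynomial.X ^ (k : ℕ) with hP
  have hev : ∀ s, P.eval s = polyVal c s := by
    intro s; simp [hP, polyVal, Polynomial.eval_finsetSum]
  have hinj : Set.InjOn v (Finset.univ : Finset (Fin (p + 1))) := by
    intro a _ b _ hab
    by_contra hne
    have := hsep a b hne
    rw [hab, sub_self, abs_zero] at this
    linarith
  have hdeg : P.degree < (Finset.univ : Finset (Fin (p + 1))).card := by
    refine (Polynomial.degree_sum_le _ _).trans_lt ?_
    rw [Finset.sup_lt_iff (by simp)]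
    intro k _
    refine (Polynomial.degree_C_mul_X_pow_le _ _).trans_lt ?_
    simp only [Finset.card_univ, Fintype.card_fin]
    exact_mod_cast k.2
  -- Lagrange interpolation at the nodes `v`: each of the `p` factors of a basis polynomial is at
  -- most `2 * ρ / w` at `u`.
  have h1 := congrArg (Polynomial.eval u) (Lagrange.eq_interpolate hinj hdeg)
  rw [hev, Lagrange.interpolate_apply, Polynomial.eval_finsetSum] at h1
  simp only [Polynomial.eval_mul, Polynomial.eval_C, hev] at h1
  rw [h1, Finset.mul_sum]
  refine (Finset.abs_sum_le_sum_abs _ _).trans (Finset.sum_le_sum fun l _ => ?_)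
  rw [abs_mul, mul_comm]
  refine mul_le_mul_of_nonneg_right ?_ (abs_nonneg _)
  rw [Lagrange.basis, Polynomial.eval_prod, Finset.abs_prod]
  have hcard : (Finset.univ.erase l : Finset (Fin (p + 1))).card = p := by
    rw [Finset.card_erase_of_mem (Finset.mem_univ _)]; simp
  conv_rhs => rw [← hcard, ← Finset.prod_const]
  refine Finset.prod_le_prod (fun _ _ => abs_nonneg _) fun j hj => ?_
  have hlj : l ≠ j := fun h => by simp [h] at hj
  have hs := hsep l j hlj
  rw [Lagrange.basisDivisor, Polynomial.eval_mul, Polynomial.eval_C, Polynomial.eval_sub,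
    Polynomial.eval_X, Polynomial.eval_C, abs_mul, abs_inv, mul_comm, ← div_eq_mul_inv]
  have h2 : |u - v j| ≤ 2 * ρ := by
    have := abs_sub u (v j)
    linarith [hv j]
  have : 0 ≤ ρ := (abs_nonneg u).trans hu
  gcongr

lemma eq_zero_of_polyVal_eq_zero {p : ℕ} (c : Fin (p + 1) → ℝ) {ρ : ℝ} (hρ : 0 < ρ)
    (h : ∀ u, |u| ≤ ρ → polyVal c u = 0) : c = 0 := by
  set P : Polynomial ℝ := ∑ k : Fin (p + 1), Polynomial.C (c k) * Polynomial.X ^ (k : ℕ) with hP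
  have hev : ∀ s, P.eval s = polyVal c s := by
    intro s; simp [hP, polyVal, Polynomial.eval_finsetSum]
  have hP0 : P = 0 := by
    refine Polynomial.eq_zero_of_infinite_isRoot P ((Icc_infinite hρ).mono fun u hu => ?_)
    rw [mem_ofPred_eq, Polynomial.IsRoot, hev]
    exact h u (by rw [abs_of_nonneg hu.1]; exact hu.2)
  ext k
  have := congrArg (fun Q => Q.coeff (k : ℕ)) hP0
  simp only [hP, Polynomial.finsetSum_coeff, Polynomial.coeff_C_mul, Polynomial.coeff_X_pow,
    Polynomial.coeff_zero, mul_ite, mul_one, mul_zero] at this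
  rw [Finset.sum_eq_single k] at this
  · simpa using this
  · intro b _ hb
    rw [if_neg]
    exact fun h => hb (Fin.ext h.symm)
  · simp

/-- Split a one-sided window into blocks of length `w` and keep `p + 1` of them, separated by gaps
of length `w`. Each kept block contains at least `w / (2 * δ)` points; the point of smallest squared
value contributes at most an average of the sum. Interpolation through these `p + 1` separated
points controls the polynomial on the whole window. -/
lemma HasMesh.polyVal_sq_le {y : ℕ → ℝ} {n : ℕ} {δ : ℝ} (H : HasMesh y n δ) {r : ℕ}
    (hr : r ≤ n) {p : ℕ} {t ρ : ℝ} (ht : t ∈ Icc (0 : ℝ) 1) (hρ0 : 0 < ρ) (hρ : ρ ≤ 1 / 2)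
    (hδ : 4 * (p + 1) * (r + 2) * δ ≤ ρ) (c : Fin (p + 1) → ℝ) {u : ℝ} (hu : |u| ≤ ρ) :
    polyVal c u ^ 2 ≤ (4 * (p + 1)) ^ (2 * p + 3) * (δ / ρ) *
      ∑ i ∈ (residualIndices r n).filter (fun i => |t - y i| ≤ ρ), polyVal c (t - y i) ^ 2 := by
  set w : ℝ := ρ / (2 * (p + 1)) with hw
  have hw0 : 0 < w := by positivity
  have hwρ : w * (2 * (p + 1)) = ρ := by rw [hw]; field_simp
  have hδ0 := H.nonneg
  have hδw : 2 * (r + 2) * δ ≤ w := by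
    rw [hw, le_div_iff₀ (by positivity)]; linarith
  set S := ∑ i ∈ (residualIndices r n).filter (fun i => |t - y i| ≤ ρ), polyVal c (t - y i) ^ 2
    with hS
  have hS0 : 0 ≤ S := Finset.sum_nonneg fun i _ => sq_nonneg _
  -- The sign `s` selects a side on which a window of length `ρ ≤ 1 / 2` stays inside `[0, 1]`, so
  -- points near the boundary need no separate treatment.
  obtain ⟨s, hs, hst⟩ : ∃ s : ℝ, (s = 1 ∨ s = -1) ∧
      ∀ a ∈ Icc (0 : ℝ) ρ, t + s * a ∈ Icc (0 : ℝ) 1 := by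
    rcases le_total t (1 / 2) with h | h
    · refine ⟨1, Or.inl rfl, fun a ha => ⟨?_, ?_⟩⟩ <;> linarith [ha.1, ha.2, ht.1, ht.2]
    · refine ⟨-1, Or.inr rfl, fun a ha => ⟨?_, ?_⟩⟩ <;> linarith [ha.1, ha.2, ht.1, ht.2]
  have hs2 : s * s = 1 := by rcases hs with rfl | rfl <;> norm_num
  have hbl : ∀ l : Fin (p + 1), (2 * (l : ℝ) + 1) * w ≤ ρ := by
    intro l
    have : ((l : ℕ) : ℝ) ≤ p := by exact_mod_cast Nat.lt_succ_iff.1 l.2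
    nlinarith
  have hblock : ∀ l : Fin (p + 1), ∃ v : ℝ, s * v ∈ Icc (-((2 * (l : ℝ) + 1) * w)) (-(2 * l * w)) ∧
      polyVal c v ^ 2 ≤ 2 * δ / w * S := by
    intro l
    set B := (residualIndices r n).filter fun i =>
      s * (t - y i) ∈ Icc (-((2 * (l : ℝ) + 1) * w)) (-(2 * l * w)) with hB
    have hcard : w ≤ δ * (B.card + (r + 2)) := by
      have hl0 : (0 : ℝ) ≤ 2 * l * w := by positivity
      have ha := hst (2 * l * w) ⟨hl0, by linarith [hbl l]⟩
      have hb := hst ((2 * l + 1) * w) ⟨by positivity, hbl l⟩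
      rcases hs with rfl | rfl
      · have := H.length_le_card hr (α := t + 1 * (2 * l * w)) (β := t + 1 * ((2 * l + 1) * w))
          ha.1 hb.2
        have hBe : B = (residualIndices r n).filter fun i =>
            y i ∈ Icc (t + 1 * (2 * l * w)) (t + 1 * ((2 * l + 1) * w)) := by
          rw [hB]
          refine Finset.filter_congr fun i _ => ?_
          simp only [Set.mem_Icc]
          constructor <;> rintro ⟨h1, h2⟩ <;> constructor <;> linarith
        rw [hBe]
        linarith
      · have := H.length_le_card hr (α := t + (-1) * ((2 * l + 1) * w))
          (β := t + (-1) * (2 * l * w)) hb.1 ha.2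
        have hBe : B = (residualIndices r n).filter fun i =>
            y i ∈ Icc (t + (-1) * ((2 * l + 1) * w)) (t + (-1) * (2 * l * w)) := by
          rw [hB]
          refine Finset.filter_congr fun i _ => ?_
          simp only [Set.mem_Icc]
          constructor <;> rintro ⟨h1, h2⟩ <;> constructor <;> linarith
        rw [hBe]
        linarith
    -- The mesh condition gives `(r + 2) * δ ≤ w / 2`, so the missing indices cost at most half of
    -- the block.
    have hcard2 : w ≤ 2 * δ * B.card := by nlinarith
    have hBne : B.Nonempty := by
      rw [Finset.nonempty_iff_ne_empty]
      intro h0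
      rw [h0] at hcard2
      simp at hcard2
      linarith
    obtain ⟨i, hi, hmin⟩ := B.exists_min_image (fun i => polyVal c (t - y i) ^ 2) hBne
    refine ⟨t - y i, (Finset.mem_filter.1 hi).2, ?_⟩
    have h1 : (B.card : ℝ) * polyVal c (t - y i) ^ 2 ≤ S := by
      have h2 := Finset.card_nsmul_le_sum B _ _ hmin
      rw [nsmul_eq_mul] at h2
      refine h2.trans (Finset.sum_le_sum_of_subset_of_nonneg ?_ fun _ _ _ => sq_nonneg _)
      intro j hj
      rw [hB, Finset.mem_filter] at hj
      rw [Finset.mem_filter]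
      refine ⟨hj.1, ?_⟩
      have h3 : |t - y j| = |s * (t - y j)| := by
        rw [abs_mul]; rcases hs with rfl | rfl <;> simp
      have hl0 : (0 : ℝ) ≤ 2 * l * w := by positivity
      rw [h3, abs_le]
      constructor <;> linarith [hj.2.1, hj.2.2, hbl l]
    rw [div_mul_eq_mul_div, le_div_iff₀ hw0]
    calc polyVal c (t - y i) ^ 2 * w ≤ polyVal c (t - y i) ^ 2 * (2 * δ * B.card) := by gcongr
      _ = 2 * δ * (B.card * polyVal c (t - y i) ^ 2) := by ring
      _ ≤ 2 * δ * S := by gcongr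
  choose v hv hvS using hblock
  have habs : ∀ a : ℝ, |a| = |s * a| := by
    intro a
    rw [abs_mul]; rcases hs with rfl | rfl <;> simp
  have hvρ : ∀ l, |v l| ≤ ρ := by
    intro l
    have hl0 : (0 : ℝ) ≤ 2 * l * w := by positivity
    rw [habs, abs_le]
    constructor <;> linarith [(hv l).1, (hv l).2, hbl l]
  have hlt : ∀ l j : Fin (p + 1), l < j → w ≤ s * v l - s * v j := by
    intro l j hlj
    have h1 : ((l : ℕ) : ℝ) + 1 ≤ j := by exact_mod_cast hlj
    have h2 := (hv l).1
    have h3 := (hv j).2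
    nlinarith
  have hsep : ∀ l j, l ≠ j → w ≤ |v l - v j| := by
    intro l j hne
    rw [habs, mul_sub]
    rcases lt_or_gt_of_ne hne with h | h
    · exact (hlt l j h).trans (le_abs_self _)
    · rw [abs_sub_comm]
      exact (hlt j l h).trans (le_abs_self _)
  have hmain := abs_polyVal_le_of_separated c v hw0 hvρ hsep hu
  have hratio : 2 * ρ / w = 4 * (p + 1) := by rw [← hwρ]; field_simp; ring
  rw [hratio] at hmain
  have h2 : 2 * δ / w = 4 * (p + 1) * (δ / ρ) := by rw [← hwρ]; field_simp; ring
  have hsum : (∑ l, |polyVal c (v l)|) ^ 2 ≤ (p + 1) * ((p + 1) * (2 * δ / w * S)) := by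
    have h3 := sq_sum_le_card_mul_sum_sq (s := (Finset.univ : Finset (Fin (p + 1))))
      (f := fun l => |polyVal c (v l)|)
    simp only [sq_abs, Finset.card_univ, Fintype.card_fin] at h3
    have h4 : ∑ l, polyVal c (v l) ^ 2 ≤ (p + 1) * (2 * δ / w * S) := by
      have := Finset.sum_le_sum fun l (_ : l ∈ Finset.univ) => hvS l
      simpa using this
    push_cast at h3
    refine h3.trans ?_
    gcongr
  have hp1 : (1 : ℝ) ≤ p + 1 := by have : (0 : ℝ) ≤ p := by positivity
                                   linarith
  calc polyVal c u ^ 2 = |polyVal c u| ^ 2 := (sq_abs _).symm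
    _ ≤ ((4 * (p + 1)) ^ p * ∑ l, |polyVal c (v l)|) ^ 2 := by gcongr
    _ = (4 * (p + 1)) ^ (2 * p) * (∑ l, |polyVal c (v l)|) ^ 2 := by ring
    _ ≤ (4 * (p + 1)) ^ (2 * p) * ((p + 1) * ((p + 1) * (2 * δ / w * S))) := by gcongr
    _ = (4 * (p + 1)) ^ (2 * p) * ((p + 1) * ((p + 1) * (4 * (p + 1)))) * (δ / ρ) * S := by
        rw [h2]; ring
    _ ≤ (4 * (p + 1)) ^ (2 * p) * ((4 * (p + 1)) * ((4 * (p + 1)) * (4 * (p + 1))))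
          * (δ / ρ) * S := by gcongr <;> linarith
    _ = _ := by ring

/-- The constants describing a weight function. -/
structure WeightBounds (K : ℝ → ℝ) (M c τ : ℝ) : Prop where
  nonneg : ∀ u, 0 ≤ K u
  le : ∀ u, K u ≤ M
  support : ∀ u, 1 < |u| → K u = 0
  c_pos : 0 < c
  τ_pos : 0 < τ
  τ_le : τ ≤ 1 / 2
  ge : ∀ u, |u| ≤ τ → c ≤ K u

lemma IsWeight.exists_bounds {K : ℝ → ℝ} (hK : IsWeight K) :
    ∃ M c τ : ℝ, WeightBounds K M c τ := by
  obtain ⟨M, hM⟩ := hK.bounded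
  obtain ⟨c, hc, τ, hτ, h⟩ := hK.pos_near_zero
  exact ⟨M, c, min τ (1 / 2), hK.nonneg, hM, hK.support, hc, by positivity, min_le_right _ _,
    fun u hu => h u (hu.trans (min_le_left _ _))⟩

/-- The constant in the bound for the sum of squared weights. -/
def christoffelConst (p : ℕ) (M c τ : ℝ) : ℝ := M * ((4 * (p + 1)) ^ (2 * p + 3) / (c * τ))

/-- Whenever the local window contains enough design points, the local fit is unique and the sum
of squared weights is of the order of the mesh divided by the bandwidth. -/
lemma HasMesh.localFit_bounds {y : ℕ → ℝ} {n : ℕ} {δ : ℝ} (H : HasMesh y n δ) {r : ℕ}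
    (hr : r ≤ n) {p : ℕ} {K : ℝ → ℝ} {M c τ : ℝ} (hK : WeightBounds K M c τ) {h : ℝ} (hh : 0 < h)
    (hδ : 4 * (p + 1) * (r + 2) * δ ≤ τ * min h 1) {t : ℝ} (ht : t ∈ Icc (0 : ℝ) 1) :
    (gram p y (residualIndices r n) t fun i => K ((t - y i) / h)).det ≠ 0 ∧
    ∑ i ∈ residualIndices r n,
      lpWeight p y (residualIndices r n) t (fun i => K ((t - y i) / h)) i ^ 2
        ≤ christoffelConst p M c τ * (δ / min h 1) := by
  have hτ := hK.τ_pos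
  have hc := hK.c_pos
  have hm : 0 < min h 1 := by positivity
  -- Within distance `ρ` the kernel is at least `c`. Taking `min h 1` allows bandwidths beyond the
  -- length of the design interval, and `τ ≤ 1 / 2` gives `ρ ≤ 1 / 2`.
  set ρ := τ * min h 1 with hρ
  have hρ0 : 0 < ρ := by positivity
  have hρ1 : ρ ≤ 1 / 2 := by
    have : min h 1 ≤ 1 := min_le_right _ _
    nlinarith [hK.τ_le]
  have hδ0 := H.nonneg
  have hk : ∀ i, 0 ≤ K ((t - y i) / h) := fun i => hK.nonneg _
  have hkc : ∀ i, |t - y i| ≤ ρ → c ≤ K ((t - y i) / h) := by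
    intro i hi
    refine hK.ge _ ?_
    rw [abs_div, abs_of_pos hh, div_le_iff₀ hh]
    exact hi.trans (mul_le_mul_of_nonneg_left (min_le_left _ _) hτ.le)
  constructor
  · refine gram_det_ne_zero hk fun b hb => ?_
    refine eq_zero_of_polyVal_eq_zero b hρ0 fun u hu => ?_
    have h1 := H.polyVal_sq_le hr ht hρ0 hρ1 hδ b hu
    rw [Finset.sum_eq_zero, mul_zero] at h1
    · exact pow_eq_zero_iff two_ne_zero |>.1 (le_antisymm h1 (sq_nonneg _))
    · intro i hi
      rw [Finset.mem_filter] at hi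
      have h2 := hb i hi.1
      have h3 : K ((t - y i) / h) ≠ 0 := (hc.trans_le (hkc i hi.2)).ne'
      rw [(mul_eq_zero.1 h2).resolve_left h3]; ring
  · have hΛ : ∀ b : Fin (p + 1) → ℝ, b 0 ^ 2 ≤ ((4 * (p + 1)) ^ (2 * p + 3) / c * (δ / ρ))
        * ∑ i ∈ residualIndices r n, K ((t - y i) / h) * polyVal b (t - y i) ^ 2 := by
      intro b
      have h1 := H.polyVal_sq_le hr ht hρ0 hρ1 hδ b (u := 0) (by simpa using hρ0.le)
      rw [polyVal_zero_right] at h1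
      have h2 : c * ∑ i ∈ (residualIndices r n).filter (fun i => |t - y i| ≤ ρ),
          polyVal b (t - y i) ^ 2
          ≤ ∑ i ∈ residualIndices r n, K ((t - y i) / h) * polyVal b (t - y i) ^ 2 := by
        rw [Finset.mul_sum]
        refine (Finset.sum_le_sum fun i hi => ?_).trans
          (Finset.sum_le_sum_of_subset_of_nonneg (Finset.filter_subset _ _)
            fun i _ _ => mul_nonneg (hk i) (sq_nonneg _))
        exact mul_le_mul_of_nonneg_right (hkc i (Finset.mem_filter.1 hi).2) (sq_nonneg _)
      refine h1.trans ?_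
      calc _ = ((4 * (p + 1)) ^ (2 * p + 3) / c * (δ / ρ)) *
            (c * ∑ i ∈ (residualIndices r n).filter (fun i => |t - y i| ≤ ρ),
              polyVal b (t - y i) ^ 2) := by field_simp
        _ ≤ _ := by gcongr
    have h3 := sum_sq_lpWeight_le (M := M) hk (fun i => hK.le _) hΛ
    refine h3.trans (le_of_eq ?_)
    rw [christoffelConst, hρ]
    field_simp

/-! ### Inequalities for square-integrable random variables. -/

lemma holderTriple_four_four_two : ENNReal.HolderTriple 4 4 2 where
  inv_add_inv_eq_inv := by
    have h4 : (4 : ℝ≥0∞) = 2 * 2 := by norm_num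
    rw [h4, ENNReal.mul_inv (by simp) (by simp), ← mul_add, ENNReal.inv_two_add_inv_two, mul_one]

section L2

set_option linter.unusedSectionVars false

variable {Ω : Type*} [MeasurableSpace Ω] {μ : Measure Ω} [IsProbabilityMeasure μ]

/-- Bessel's inequality for a finite orthonormal family of random variables. -/
lemma sum_sq_integral_mul_le {I : Finset ℕ} {X : Ω → ℝ} {ψ : ℕ → Ω → ℝ} (hX : MemLp X 2 μ)
    (hψ : ∀ i ∈ I, MemLp (ψ i) 2 μ)
    (horth : ∀ i ∈ I, ∀ k ∈ I, ∫ ω, ψ i ω * ψ k ω ∂μ = if i = k then 1 else 0) :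
    ∑ i ∈ I, (∫ ω, X ω * ψ i ω ∂μ) ^ 2 ≤ ∫ ω, X ω ^ 2 ∂μ := by
  set l : ℕ → ℝ := fun i => ∫ ω, X ω * ψ i ω ∂μ with hl
  have i1 : ∀ i ∈ I, Integrable (fun ω => X ω * ψ i ω) μ := fun i hi => hX.integrable_mul (hψ i hi)
  have i2 : ∀ i ∈ I, ∀ k ∈ I, Integrable (fun ω => ψ i ω * ψ k ω) μ :=
    fun i hi k hk => (hψ i hi).integrable_mul (hψ k hk)
  have hexp : ∀ ω, (X ω - ∑ i ∈ I, l i * ψ i ω) ^ 2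
      = X ω ^ 2 - 2 * ∑ i ∈ I, l i * (X ω * ψ i ω)
        + ∑ i ∈ I, ∑ k ∈ I, l i * l k * (ψ i ω * ψ k ω) := by
    intro ω
    have e1 : ∑ i ∈ I, l i * (X ω * ψ i ω) = X ω * ∑ i ∈ I, l i * ψ i ω := by
      rw [Finset.mul_sum]; exact Finset.sum_congr rfl fun i _ => by ring
    have e2 : ∑ i ∈ I, ∑ k ∈ I, l i * l k * (ψ i ω * ψ k ω)
        = (∑ i ∈ I, l i * ψ i ω) * ∑ i ∈ I, l i * ψ i ω := by
      rw [Finset.sum_mul_sum]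
      exact Finset.sum_congr rfl fun i _ => Finset.sum_congr rfl fun k _ => by ring
    rw [e1, e2]; ring
  have h0 : 0 ≤ ∫ ω, (X ω - ∑ i ∈ I, l i * ψ i ω) ^ 2 ∂μ := integral_nonneg fun ω => sq_nonneg _
  simp only [hexp] at h0
  have j1 : Integrable (fun ω => ∑ i ∈ I, l i * (X ω * ψ i ω)) μ :=
    integrable_finsetSum _ fun i hi => (i1 i hi).const_mul _
  have j2 : Integrable (fun ω => ∑ i ∈ I, ∑ k ∈ I, l i * l k * (ψ i ω * ψ k ω)) μ :=
    integrable_finsetSum _ fun i hi => integrable_finsetSum _ fun k hk => (i2 i hi k hk).const_mul _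
  have k1 : Integrable (fun ω => X ω ^ 2 - 2 * ∑ i ∈ I, l i * (X ω * ψ i ω)) μ :=
    hX.integrable_sq.sub (j1.const_mul 2)
  rw [integral_add k1 j2, integral_sub hX.integrable_sq (j1.const_mul 2), integral_const_mul,
    integral_finsetSum _ fun i hi => (i1 i hi).const_mul _,
    integral_finsetSum _ fun i hi => integrable_finsetSum _ fun k hk =>
      (i2 i hi k hk).const_mul _] at h0
  have e3 : ∑ i ∈ I, ∫ ω, l i * (X ω * ψ i ω) ∂μ = ∑ i ∈ I, l i ^ 2 :=
    Finset.sum_congr rfl fun i _ => by rw [integral_const_mul]; simp only [hl]; ring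
  have e4 : ∑ i ∈ I, ∫ ω, ∑ k ∈ I, l i * l k * (ψ i ω * ψ k ω) ∂μ = ∑ i ∈ I, l i ^ 2 := by
    refine Finset.sum_congr rfl fun i hi => ?_
    rw [integral_finsetSum _ fun k hk => (i2 i hi k hk).const_mul _]
    have : ∀ k ∈ I, ∫ ω, l i * l k * (ψ i ω * ψ k ω) ∂μ = if i = k then l i ^ 2 else 0 := by
      intro k hk
      rw [integral_const_mul, horth i hi k hk]
      split_ifs with h
      · rw [h]; ring
      · simp
    rw [Finset.sum_congr rfl this, Finset.sum_ite_eq, if_pos hi]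
  rw [e3, e4] at h0
  linarith

lemma sq_integral_le {X : Ω → ℝ} (hX : MemLp X 2 μ) : (∫ ω, X ω ∂μ) ^ 2 ≤ ∫ ω, X ω ^ 2 ∂μ := by
  have := sum_sq_integral_mul_le (I := {0}) (ψ := fun _ _ => 1) hX
    (fun _ _ => memLp_const 1) (by simp)
  simpa using this

lemma abs_integral_mul_le {X Y : Ω → ℝ} (hX : MemLp X 2 μ) (hY : MemLp Y 2 μ) :
    |∫ ω, X ω * Y ω ∂μ| ≤ (∫ ω, X ω ^ 2 ∂μ + ∫ ω, Y ω ^ 2 ∂μ) / 2 := by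
  have h1 : ∫ ω, (X ω ^ 2 + Y ω ^ 2) / 2 ∂μ = (∫ ω, X ω ^ 2 ∂μ + ∫ ω, Y ω ^ 2 ∂μ) / 2 := by
    rw [integral_div, integral_add hX.integrable_sq hY.integrable_sq]
  rw [← h1]
  refine (abs_integral_le_integral_abs).trans (integral_mono (hX.integrable_mul hY).abs
    ((hX.integrable_sq.add hY.integrable_sq).div_const 2) fun ω => ?_)
  show |X ω * Y ω| ≤ (X ω ^ 2 + Y ω ^ 2) / 2
  rw [abs_le]
  constructor <;> nlinarith [sq_nonneg (X ω + Y ω), sq_nonneg (X ω - Y ω)]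

/-- Second moment of a weighted sum of `r`-dependent random variables. -/
lemma integral_sq_sum_le {I : Finset ℕ} {Y : ℕ → Ω → ℝ} {r : ℕ} {Q : ℝ} (w : ℕ → ℝ)
    (hY : ∀ i ∈ I, MemLp (Y i) 2 μ) (hQ : ∀ i ∈ I, ∫ ω, Y i ω ^ 2 ∂μ ≤ Q)
    (hdep : ∀ i ∈ I, ∀ k ∈ I, (i + r < k ∨ k + r < i) → ∫ ω, Y i ω * Y k ω ∂μ = 0) :
    ∫ ω, (∑ i ∈ I, w i * Y i ω) ^ 2 ∂μ ≤ (2 * r + 1) * Q * ∑ i ∈ I, w i ^ 2 := by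
  rcases I.eq_empty_or_nonempty with rfl | ⟨i0, hi0⟩
  · simp
  have hQ0 : 0 ≤ Q := (integral_nonneg fun ω => sq_nonneg (Y i0 ω)).trans (hQ i0 hi0)
  have hint : ∀ i ∈ I, ∀ k ∈ I, Integrable (fun ω => w i * w k * (Y i ω * Y k ω)) μ :=
    fun i hi k hk => ((hY i hi).integrable_mul (hY k hk)).const_mul _
  have hexp : ∀ ω, (∑ i ∈ I, w i * Y i ω) ^ 2
      = ∑ i ∈ I, ∑ k ∈ I, w i * w k * (Y i ω * Y k ω) := by
    intro ω
    rw [pow_two, Finset.sum_mul_sum]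
    exact Finset.sum_congr rfl fun i _ => Finset.sum_congr rfl fun k _ => by ring
  simp only [hexp]
  rw [integral_finsetSum _ fun i hi => integrable_finsetSum _ fun k hk => hint i hi k hk]
  -- The matrix `N` marks the pairs within distance `r`. Its rows have at most `2 * r + 1` ones;
  -- since `w i * w k` is at most half the sum of the squares, symmetry and the row sums give the
  -- bound.
  set N : ℕ → ℕ → ℝ := fun i k => if i + r < k ∨ k + r < i then 0 else 1 with hN
  have hterm : ∀ i ∈ I, ∀ k ∈ I, ∫ ω, w i * w k * (Y i ω * Y k ω) ∂μ
      ≤ N i k * (Q * (w i ^ 2 / 2)) + N i k * (Q * (w k ^ 2 / 2)) := by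
    intro i hi k hk
    rw [integral_const_mul]
    simp only [hN]
    split_ifs with h
    · rw [hdep i hi k hk h]; simp
    · have h1 := abs_integral_mul_le (hY i hi) (hY k hk)
      have h2 : |∫ ω, Y i ω * Y k ω ∂μ| ≤ Q := by linarith [hQ i hi, hQ k hk]
      have h3 : w i * w k * ∫ ω, Y i ω * Y k ω ∂μ ≤ |w i * w k| * Q := by
        refine (le_abs_self _).trans ?_
        rw [abs_mul]
        gcongr
      have h4 : |w i * w k| ≤ w i ^ 2 / 2 + w k ^ 2 / 2 := by
        rw [abs_le]
        constructor <;> nlinarith [sq_nonneg (w i + w k), sq_nonneg (w i - w k)]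
      nlinarith
  have hcount : ∀ i, ∑ k ∈ I, N i k ≤ 2 * r + 1 := by
    intro i
    simp only [hN]
    have h0 : ∀ k, (if i + r < k ∨ k + r < i then (0 : ℝ) else 1)
        = if ¬ (i + r < k ∨ k + r < i) then 1 else 0 := by
      intro k; split_ifs <;> rfl
    simp only [h0]
    rw [Finset.sum_boole]
    have hsub : I.filter (fun k => ¬ (i + r < k ∨ k + r < i)) ⊆ Finset.Icc (i - r) (i + r) := by
      intro k hk
      rw [Finset.mem_filter] at hk
      rw [Finset.mem_Icc]
      omega
    have := Finset.card_le_card hsub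
    rw [Nat.card_Icc] at this
    have h5 : (I.filter (fun k => ¬ (i + r < k ∨ k + r < i))).card ≤ 2 * r + 1 := by omega
    exact_mod_cast h5
  have hsymm : ∀ i k, N i k = N k i := by
    intro i k; simp only [hN]; simp only [or_comm]
  refine (Finset.sum_le_sum fun i hi => ?_).trans (b := ∑ i ∈ I, ∑ k ∈ I,
    (N i k * (Q * (w i ^ 2 / 2)) + N i k * (Q * (w k ^ 2 / 2)))) ?_
  · rw [integral_finsetSum _ fun k hk => hint i hi k hk]
    exact Finset.sum_le_sum fun k hk => hterm i hi k hk
  · simp only [Finset.sum_add_distrib]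
    have hB : ∑ i ∈ I, ∑ k ∈ I, N i k * (Q * (w k ^ 2 / 2))
        = ∑ i ∈ I, ∑ k ∈ I, N i k * (Q * (w i ^ 2 / 2)) := by
      rw [Finset.sum_comm]
      exact Finset.sum_congr rfl fun i _ => Finset.sum_congr rfl fun k _ => by rw [hsymm]
    rw [hB, ← two_mul]
    have hA : ∑ i ∈ I, ∑ k ∈ I, N i k * (Q * (w i ^ 2 / 2))
        ≤ ∑ i ∈ I, (2 * r + 1) * (Q * (w i ^ 2 / 2)) := by
      refine Finset.sum_le_sum fun i _ => ?_
      rw [← Finset.sum_mul]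
      exact mul_le_mul_of_nonneg_right (hcount i) (by positivity)
    calc _ ≤ 2 * ∑ i ∈ I, (2 * r + 1) * (Q * (w i ^ 2 / 2)) := by gcongr
      _ = _ := by
        rw [Finset.mul_sum, Finset.mul_sum]
        exact Finset.sum_congr rfl fun i _ => by ring

end L2

/-! ### Mixed moments of the errors. -/

namespace IsErrorSequence

set_option linter.unusedSectionVars false

variable {Ω : Type*} [MeasurableSpace Ω] {μ : Measure Ω} [IsProbabilityMeasure μ]
  {ε : ℕ → Ω → ℝ}

lemma memLp_four (hε : IsErrorSequence μ ε) (a : ℕ) : MemLp (ε a) 4 μ :=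
  (hε.identDistrib a).memLp_iff.2 hε.memLp

lemma memLp_mul (hε : IsErrorSequence μ ε) (a b : ℕ) : MemLp (fun ω => ε a ω * ε b ω) 2 μ := by
  have := holderTriple_four_four_two
  exact (hε.memLp_four b).mul (hε.memLp_four a)

lemma memLp_two (hε : IsErrorSequence μ ε) (a : ℕ) : MemLp (ε a) 2 μ :=
  (hε.memLp_four a).mono_exponent (by norm_num)

lemma integral_eq (hε : IsErrorSequence μ ε) (a : ℕ) : ∫ ω, ε a ω ∂μ = 0 :=
  (hε.identDistrib a).integral_eq.trans hε.mean

lemma integral_sq (hε : IsErrorSequence μ ε) (a : ℕ) : ∫ ω, ε a ω ^ 2 ∂μ = 1 :=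
  ((hε.identDistrib a).comp (u := fun z : ℝ => z ^ 2) (by fun_prop)).integral_eq.trans hε.variance

lemma integral_pow_four (hε : IsErrorSequence μ ε) (a : ℕ) :
    ∫ ω, ε a ω ^ 4 ∂μ = ∫ ω, ε 0 ω ^ 4 ∂μ :=
  ((hε.identDistrib a).comp (u := fun z : ℝ => z ^ 4) (by fun_prop)).integral_eq

lemma integrable_pow_four (hε : IsErrorSequence μ ε) (a : ℕ) :
    Integrable (fun ω => ε a ω ^ 4) μ := by
  have h := (hε.memLp_mul a a).integrable_sq
  refine h.congr (ae_of_all _ fun ω => ?_)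
  show (ε a ω * ε a ω) ^ 2 = ε a ω ^ 4
  ring

/-- The error with index outside `S` splits off by independence and has mean zero. Every vanishing
mixed moment below is an instance of this. -/
lemma integral_mul_eq_zero (hε : IsErrorSequence μ ε) {S : Finset ℕ} {b : ℕ} (hb : b ∉ S)
    {F : (S → ℝ) → ℝ} (hF : Measurable F) :
    ∫ ω, F (fun i : S => ε i ω) * ε b ω ∂μ = 0 := by
  have h1 := hε.indep.indepFun_finset S {b} (Finset.disjoint_singleton_right.2 hb) hε.measurable
  have h2 : IndepFun (fun ω => F (fun i : S => ε i ω)) (fun ω => ε b ω) μ :=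
    h1.comp (φ := F) (ψ := fun e : (({b} : Finset ℕ) → ℝ) => e ⟨b, by simp⟩) hF (by fun_prop)
  have hm : Measurable fun ω => F (fun i : S => ε i ω) :=
    hF.comp (measurable_pi_lambda _ fun i => hε.measurable i)
  rw [h2.integral_fun_mul_eq_mul_integral hm.aestronglyMeasurable
    (hε.measurable b).aestronglyMeasurable, hε.integral_eq, mul_zero]

lemma integral_mul (hε : IsErrorSequence μ ε) (a b : ℕ) :
    ∫ ω, ε a ω * ε b ω ∂μ = if a = b then 1 else 0 := by
  split_ifs with h
  · rw [← h, ← hε.integral_sq a]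
    exact integral_congr_ae (ae_of_all _ fun ω => (pow_two _).symm)
  · exact hε.integral_mul_eq_zero (S := {a}) (b := b) (by simpa using Ne.symm h)
      (F := fun e => e ⟨a, by simp⟩) (by fun_prop)

lemma integral_mul_three (hε : IsErrorSequence μ ε) (l : ℕ) {a b : ℕ} (hab : a ≠ b) :
    ∫ ω, ε l ω * (ε a ω * ε b ω) ∂μ = 0 := by
  by_cases hb : b = l
  · have := hε.integral_mul_eq_zero (S := {l}) (b := a) (by rw [← hb]; simpa using hab)
      (F := fun e => e ⟨l, by simp⟩ * e ⟨l, by simp⟩) (by fun_prop)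
    rw [← this]
    exact integral_congr_ae (ae_of_all _ fun ω => by simp only [hb]; ring)
  · have := hε.integral_mul_eq_zero (S := {l, a}) (b := b) (by simp [hb, Ne.symm hab])
      (F := fun e => e ⟨l, by simp⟩ * e ⟨a, by simp⟩) (by fun_prop)
    rw [← this]
    exact integral_congr_ae (ae_of_all _ fun ω => by simp only []; ring)

/-- Unless `(l, k)` is a permutation of `(a, b)`, one of `a`, `b` occurs exactly once and the moment
vanishes. As `a ≠ b`, the value involves only second moments, and at most one of the two summands is
nonzero. -/
lemma integral_mul_four (hε : IsErrorSequence μ ε) (l k : ℕ) {a b : ℕ} (hab : a ≠ b) :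
    ∫ ω, (ε l ω * ε k ω) * (ε a ω * ε b ω) ∂μ
      = (if l = a then 1 else 0) * (if k = b then 1 else 0)
        + (if l = b then 1 else 0) * (if k = a then 1 else 0) := by
  have hsq : ∫ ω, (ε a ω * ε b ω) * (ε a ω * ε b ω) ∂μ = 1 := by
    have h1 : IndepFun (fun ω => ε a ω ^ 2) (fun ω => ε b ω ^ 2) μ :=
      (hε.indep.indepFun hab).comp (φ := fun z : ℝ => z ^ 2) (ψ := fun z : ℝ => z ^ 2)
        (by fun_prop) (by fun_prop)
    have h2 := h1.integral_fun_mul_eq_mul_integral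
      ((hε.measurable a).pow_const 2).aestronglyMeasurable
      ((hε.measurable b).pow_const 2).aestronglyMeasurable
    rw [hε.integral_sq, hε.integral_sq, mul_one] at h2
    rw [← h2]
    exact integral_congr_ae (ae_of_all _ fun ω => by simp only []; ring)
  have hzero_b : b ≠ l → b ≠ k → ∫ ω, (ε l ω * ε k ω) * (ε a ω * ε b ω) ∂μ = 0 := by
    intro h1 h2
    have := hε.integral_mul_eq_zero (S := {l, k, a}) (b := b) (by simp [h1, h2, hab.symm])
      (F := fun e => e ⟨l, by simp⟩ * e ⟨k, by simp⟩ * e ⟨a, by simp⟩) (by fun_prop)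
    rw [← this]
    exact integral_congr_ae (ae_of_all _ fun ω => by simp only []; ring)
  have hzero_a : a ≠ l → a ≠ k → ∫ ω, (ε l ω * ε k ω) * (ε a ω * ε b ω) ∂μ = 0 := by
    intro h1 h2
    have := hε.integral_mul_eq_zero (S := {l, k, b}) (b := a) (by simp [h1, h2, hab])
      (F := fun e => e ⟨l, by simp⟩ * e ⟨k, by simp⟩ * e ⟨b, by simp⟩) (by fun_prop)
    rw [← this]
    exact integral_congr_ae (ae_of_all _ fun ω => by simp only []; ring)
  by_cases hla : l = a
  · have hlb : l ≠ b := hla ▸ hab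
    by_cases hkb : k = b
    · subst hla hkb
      rw [hsq]
      simp [hab]
    · rw [hzero_b (Ne.symm hlb) (Ne.symm hkb)]
      simp [hkb, hlb]
  · by_cases hka : k = a
    · by_cases hlb : l = b
      · subst hka hlb
        have : ∫ ω, (ε l ω * ε k ω) * (ε k ω * ε l ω) ∂μ = 1 := by
          rw [← hsq]
          exact integral_congr_ae (ae_of_all _ fun ω => by simp only []; ring)
        rw [this]
        simp [hab, Ne.symm hab]
      · have hkb : k ≠ b := hka ▸ hab
        rw [hzero_b (Ne.symm hlb) (Ne.symm hkb)]
        simp [hla, hlb]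
    · rw [hzero_a (Ne.symm hla) (Ne.symm hka)]
      simp [hla, hka]

end IsErrorSequence

/-! ### Moments of affine forms in the errors. -/

/-- An affine function of finitely many errors. -/
def affineForm {Ω : Type*} (ε : ℕ → Ω → ℝ) {ι : Type*} [Fintype ι] (m : ℝ) (c : ι → ℝ)
    (f : ι → ℕ) (ω : Ω) : ℝ :=
  m + ∑ j, c j * ε (f j) ω

section AffineForm

set_option linter.unusedSectionVars false

variable {Ω : Type*} [MeasurableSpace Ω] {μ : Measure Ω} [IsProbabilityMeasure μ]
  {ε : ℕ → Ω → ℝ} {ι : Type*} [Fintype ι]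

lemma memLp_affineForm (hε : IsErrorSequence μ ε) (m : ℝ) (c : ι → ℝ) (f : ι → ℕ) :
    MemLp (affineForm ε m c f) 4 μ :=
  (memLp_const m).add (memLp_finsetSum _ fun j _ => (hε.memLp_four (f j)).const_mul (c j))

lemma memLp_affineForm_sq (hε : IsErrorSequence μ ε) (m : ℝ) (c : ι → ℝ) (f : ι → ℕ) :
    MemLp (fun ω => affineForm ε m c f ω ^ 2) 2 μ := by
  have := holderTriple_four_four_two
  have hmul : MemLp (affineForm ε m c f * affineForm ε m c f) 2 μ :=
    (memLp_affineForm hε m c f).mul (memLp_affineForm hε m c f)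
  refine hmul.ae_eq (ae_of_all _ fun ω => ?_)
  simp only [Pi.mul_apply]; ring

lemma measurable_affineForm (hε : IsErrorSequence μ ε) (m : ℝ) (c : ι → ℝ) (f : ι → ℕ) :
    Measurable (affineForm ε m c f) := by
  unfold affineForm
  exact measurable_const.add (Finset.measurable_fun_sum _ fun j _ =>
    (hε.measurable (f j)).const_mul (c j))

lemma affineForm_sq (m : ℝ) (c : ι → ℝ) (f : ι → ℕ) (ω : Ω) :
    affineForm ε m c f ω ^ 2 = m ^ 2 + 2 * m * ∑ j, c j * ε (f j) ω
      + ∑ j, ∑ k, c j * c k * (ε (f j) ω * ε (f k) ω) := by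
  have : ∑ j, ∑ k, c j * c k * (ε (f j) ω * ε (f k) ω)
      = (∑ j, c j * ε (f j) ω) * ∑ j, c j * ε (f j) ω := by
    rw [Finset.sum_mul_sum]
    exact Finset.sum_congr rfl fun j _ => Finset.sum_congr rfl fun k _ => by ring
  rw [this, affineForm]; ring

lemma integral_affineForm_sq (hε : IsErrorSequence μ ε) (m : ℝ) (c : ι → ℝ) {f : ι → ℕ}
    (hf : Function.Injective f) :
    ∫ ω, affineForm ε m c f ω ^ 2 ∂μ = m ^ 2 + ∑ j, c j ^ 2 := by
  classical
  simp only [affineForm_sq]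
  have i1 : ∀ j, Integrable (fun ω => c j * ε (f j) ω) μ := fun j =>
    ((hε.memLp_four (f j)).integrable (by norm_num)).const_mul _
  have i2 : ∀ j k, Integrable (fun ω => c j * c k * (ε (f j) ω * ε (f k) ω)) μ := fun j k =>
    ((hε.memLp_mul (f j) (f k)).integrable (by norm_num)).const_mul _
  have j1 : Integrable (fun ω => ∑ j, c j * ε (f j) ω) μ := integrable_finsetSum _ fun j _ => i1 j
  have j2 : Integrable (fun ω => ∑ j, ∑ k, c j * c k * (ε (f j) ω * ε (f k) ω)) μ :=
    integrable_finsetSum _ fun j _ => integrable_finsetSum _ fun k _ => i2 j k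
  have k1 : Integrable (fun ω => m ^ 2 + 2 * m * ∑ j, c j * ε (f j) ω) μ :=
    (integrable_const _).add (j1.const_mul _)
  rw [integral_add k1 j2, integral_add (integrable_const _) (j1.const_mul _), integral_const_mul,
    integral_finsetSum _ fun j _ => i1 j,
    integral_finsetSum _ fun j _ => integrable_finsetSum _ fun k _ => i2 j k]
  have e1 : ∑ j, ∫ ω, c j * ε (f j) ω ∂μ = 0 :=
    Finset.sum_eq_zero fun j _ => by rw [integral_const_mul, hε.integral_eq, mul_zero]
  have e2 : ∀ j, ∫ ω, ∑ k, c j * c k * (ε (f j) ω * ε (f k) ω) ∂μ = c j ^ 2 := by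
    intro j
    rw [integral_finsetSum _ fun k _ => i2 j k]
    have : ∀ k, ∫ ω, c j * c k * (ε (f j) ω * ε (f k) ω) ∂μ = if j = k then c j ^ 2 else 0 := by
      intro k
      rw [integral_const_mul, hε.integral_mul]
      by_cases h : j = k
      · simp [h]; ring
      · simp [h, hf.ne h]
    simp [this]
  rw [e1, Finset.sum_congr rfl fun j _ => e2 j]
  simp

/-- The coefficient of the error with index `a`. -/
def errorCoeff (c : ι → ℝ) (f : ι → ℕ) (a : ℕ) : ℝ := ∑ j, c j * if f j = a then 1 else 0

/-- A product of two distinct errors is orthogonal to constants, to single errors and to squares of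
errors. Of the square of an affine form it therefore detects only the cross term in these two
errors. -/
lemma integral_affineForm_sq_mul (hε : IsErrorSequence μ ε) (m : ℝ) (c : ι → ℝ) (f : ι → ℕ)
    {a b : ℕ} (hab : a ≠ b) :
    ∫ ω, affineForm ε m c f ω ^ 2 * (ε a ω * ε b ω) ∂μ
      = 2 * (errorCoeff c f a * errorCoeff c f b) := by
  have hexp : ∀ ω, affineForm ε m c f ω ^ 2 * (ε a ω * ε b ω)
      = m ^ 2 * (ε a ω * ε b ω) + 2 * m * ∑ j, c j * (ε (f j) ω * (ε a ω * ε b ω))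
      + ∑ j, ∑ k, c j * c k * ((ε (f j) ω * ε (f k) ω) * (ε a ω * ε b ω)) := by
    intro ω
    rw [affineForm_sq, add_mul, add_mul, mul_assoc (2 * m), Finset.sum_mul, Finset.sum_mul]
    congr 1
    · congr 2
      exact Finset.sum_congr rfl fun j _ => by ring
    · refine Finset.sum_congr rfl fun j _ => ?_
      rw [Finset.sum_mul]
      exact Finset.sum_congr rfl fun k _ => by ring
  simp only [hexp]
  have i0 : Integrable (fun ω => ε a ω * ε b ω) μ := (hε.memLp_mul a b).integrable (by norm_num)
  have i1 : ∀ j, Integrable (fun ω => c j * (ε (f j) ω * (ε a ω * ε b ω))) μ := fun j =>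
    ((hε.memLp_two (f j)).integrable_mul (hε.memLp_mul a b)).const_mul _
  have i2 : ∀ j k, Integrable
      (fun ω => c j * c k * ((ε (f j) ω * ε (f k) ω) * (ε a ω * ε b ω))) μ := fun j k =>
    ((hε.memLp_mul (f j) (f k)).integrable_mul (hε.memLp_mul a b)).const_mul _
  have j1 : Integrable (fun ω => ∑ j, c j * (ε (f j) ω * (ε a ω * ε b ω))) μ :=
    integrable_finsetSum _ fun j _ => i1 j
  have j2 : Integrable
      (fun ω => ∑ j, ∑ k, c j * c k * ((ε (f j) ω * ε (f k) ω) * (ε a ω * ε b ω))) μ :=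
    integrable_finsetSum _ fun j _ => integrable_finsetSum _ fun k _ => i2 j k
  have k1 : Integrable (fun ω => m ^ 2 * (ε a ω * ε b ω)
      + 2 * m * ∑ j, c j * (ε (f j) ω * (ε a ω * ε b ω))) μ :=
    (i0.const_mul _).add (j1.const_mul _)
  rw [integral_add k1 j2, integral_add (i0.const_mul _) (j1.const_mul _), integral_const_mul, integral_const_mul,
    integral_finsetSum _ fun j _ => i1 j,
    integral_finsetSum _ fun j _ => integrable_finsetSum _ fun k _ => i2 j k,
    hε.integral_mul, if_neg hab]
  have e1 : ∑ j, ∫ ω, c j * (ε (f j) ω * (ε a ω * ε b ω)) ∂μ = 0 :=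
    Finset.sum_eq_zero fun j _ => by
      rw [integral_const_mul, hε.integral_mul_three _ hab, mul_zero]
  have e2 : ∑ j, ∫ ω, ∑ k, c j * c k * ((ε (f j) ω * ε (f k) ω) * (ε a ω * ε b ω)) ∂μ
      = 2 * (errorCoeff c f a * errorCoeff c f b) := by
    have h1 : errorCoeff c f a * errorCoeff c f b = ∑ j, ∑ k, c j * c k *
        ((if f j = a then 1 else 0) * (if f k = b then 1 else 0)) := by
      rw [errorCoeff, errorCoeff, Finset.sum_mul_sum]
      exact Finset.sum_congr rfl fun j _ => Finset.sum_congr rfl fun k _ => by ring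
    have h2 : errorCoeff c f a * errorCoeff c f b = ∑ j, ∑ k, c j * c k *
        ((if f j = b then 1 else 0) * (if f k = a then 1 else 0)) := by
      rw [mul_comm, errorCoeff, errorCoeff, Finset.sum_mul_sum]
      exact Finset.sum_congr rfl fun j _ => Finset.sum_congr rfl fun k _ => by ring
    rw [two_mul]
    nth_rewrite 1 [h1]
    rw [h2, ← Finset.sum_add_distrib]
    refine Finset.sum_congr rfl fun j _ => ?_
    rw [integral_finsetSum _ fun k _ => i2 j k, ← Finset.sum_add_distrib]
    refine Finset.sum_congr rfl fun k _ => ?_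
    rw [integral_const_mul, hε.integral_mul_four _ _ hab]
    ring
  rw [e1, e2]
  ring

/-- The inequality (u + v)² ≤ 2u² + 2v² used twice produces the factor 8, and Cauchy–Schwarz used
twice on the linear part produces the cube of the number of terms. -/
lemma integral_affineForm_pow_four_le (hε : IsErrorSequence μ ε) (m : ℝ) (c : ι → ℝ)
    (f : ι → ℕ) :
    ∫ ω, (affineForm ε m c f ω ^ 2) ^ 2 ∂μ
      ≤ 8 * m ^ 4 + 8 * (Fintype.card ι) ^ 3 * ((∑ j, c j ^ 4) * ∫ ω, ε 0 ω ^ 4 ∂μ) := by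
  have hpt : ∀ ω, (affineForm ε m c f ω ^ 2) ^ 2
      ≤ 8 * m ^ 4 + 8 * (Fintype.card ι) ^ 3 * ∑ j, c j ^ 4 * ε (f j) ω ^ 4 := by
    intro ω
    set L := ∑ j, c j * ε (f j) ω
    have h1 : L ^ 2 ≤ Fintype.card ι * ∑ j, (c j * ε (f j) ω) ^ 2 := by
      have := sq_sum_le_card_mul_sum_sq (s := (Finset.univ : Finset ι))
        (f := fun j => c j * ε (f j) ω)
      simpa using this
    have h2 : (∑ j, (c j * ε (f j) ω) ^ 2) ^ 2
        ≤ Fintype.card ι * ∑ j, c j ^ 4 * ε (f j) ω ^ 4 := by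
      have := sq_sum_le_card_mul_sum_sq (s := (Finset.univ : Finset ι))
        (f := fun j => (c j * ε (f j) ω) ^ 2)
      rw [Finset.card_univ] at this
      refine this.trans (le_of_eq ?_)
      congr 1
      exact Finset.sum_congr rfl fun j _ => by ring
    have h3 : (L ^ 2) ^ 2 ≤ (Fintype.card ι) ^ 3 * ∑ j, c j ^ 4 * ε (f j) ω ^ 4 := by
      calc (L ^ 2) ^ 2 ≤ (Fintype.card ι * ∑ j, (c j * ε (f j) ω) ^ 2) ^ 2 := by gcongr
        _ = (Fintype.card ι) ^ 2 * (∑ j, (c j * ε (f j) ω) ^ 2) ^ 2 := by ring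
        _ ≤ (Fintype.card ι) ^ 2 * (Fintype.card ι * ∑ j, c j ^ 4 * ε (f j) ω ^ 4) := by gcongr
        _ = _ := by ring
    have h4 : affineForm ε m c f ω ^ 2 ≤ 2 * m ^ 2 + 2 * L ^ 2 := by
      show (m + L) ^ 2 ≤ _
      nlinarith [sq_nonneg (m - L)]
    have h5 : (affineForm ε m c f ω ^ 2) ^ 2 ≤ (2 * m ^ 2 + 2 * L ^ 2) ^ 2 := by gcongr
    nlinarith [sq_nonneg (m ^ 2 - L ^ 2)]
  have i1 : Integrable (fun ω => ∑ j, c j ^ 4 * ε (f j) ω ^ 4) μ :=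
    integrable_finsetSum _ fun j _ => (hε.integrable_pow_four (f j)).const_mul _
  have k1 : Integrable (fun ω => 8 * m ^ 4
      + 8 * (Fintype.card ι) ^ 3 * ∑ j, c j ^ 4 * ε (f j) ω ^ 4) μ :=
    (integrable_const _).add (i1.const_mul _)
  refine (integral_mono (memLp_affineForm_sq hε m c f).integrable_sq k1 hpt).trans (le_of_eq ?_)
  rw [integral_add (integrable_const _) (i1.const_mul _), integral_const, integral_const_mul,
    integral_finsetSum _ fun j _ => (hε.integrable_pow_four (f j)).const_mul _]
  simp only [integral_const_mul, hε.integral_pow_four, Finset.sum_mul]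
  simp

lemma indepFun_affineForm (hε : IsErrorSequence μ ε) (m m' : ℝ) (c c' : ι → ℝ) {f f' : ι → ℕ}
    (hff : ∀ j k, f j ≠ f' k) :
    IndepFun (affineForm ε m c f) (affineForm ε m' c' f') μ := by
  classical
  have hdisj : Disjoint (Finset.univ.image f) (Finset.univ.image f') := by
    rw [Finset.disjoint_left]
    intro a ha ha'
    simp only [Finset.mem_image, Finset.mem_univ, true_and] at ha ha'
    obtain ⟨j, rfl⟩ := ha
    obtain ⟨k, hk⟩ := ha'
    exact hff j k hk.symm
  have h1 := hε.indep.indepFun_finset _ _ hdisj hε.measurable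
  exact h1.comp
    (φ := fun e : ({a // a ∈ Finset.univ.image f} → ℝ) => m + ∑ j, c j * e ⟨f j, by simp⟩)
    (ψ := fun e : ({a // a ∈ Finset.univ.image f'} → ℝ) => m' + ∑ j, c' j * e ⟨f' j, by simp⟩)
    (by fun_prop) (by fun_prop)

end AffineForm

/-! ### Bias and variance of weighted sums of squared pseudoresiduals. -/

section MeanSquare

set_option linter.unusedSectionVars false

variable {Ω : Type*} [MeasurableSpace Ω] {μ : Measure Ω} [IsProbabilityMeasure μ]
  {ε : ℕ → Ω → ℝ} {r : ℕ}

/-- The index of the observation entering the `i`-th pseudoresidual with coefficient `d j`. -/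
def obsIndex (r i : ℕ) (j : Fin (r + 1)) : ℕ := (j : ℕ) + i - r / 2

/-- The bound `r / 2 ≤ i` keeps the natural-number subtraction from truncating. -/
lemma obsIndex_injective {i : ℕ} (hi : r / 2 ≤ i) : Function.Injective (obsIndex r i) := by
  intro j k h
  simp only [obsIndex] at h
  exact Fin.ext (by omega)

/-- The squared pseudoresiduals, weighted by `w`, minus a constant `v`. -/
def weightedError (ε : ℕ → Ω → ℝ) (I : Finset ℕ) (m : ℕ → ℝ) (c : ℕ → Fin (r + 1) → ℝ)
    (w : ℕ → ℝ) (v : ℝ) (ω : Ω) : ℝ :=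
  ∑ i ∈ I, w i * affineForm ε (m i) (c i) (obsIndex r i) ω ^ 2 - v

/-- The mean square of `weightedError`. -/
def mse (μ : Measure Ω) (ε : ℕ → Ω → ℝ) (I : Finset ℕ) (m : ℕ → ℝ) (c : ℕ → Fin (r + 1) → ℝ)
    (w : ℕ → ℝ) (v : ℝ) : ℝ :=
  ∫ ω, weightedError ε I m c w v ω ^ 2 ∂μ

variable {I : Finset ℕ} {m : ℕ → ℝ} {c : ℕ → Fin (r + 1) → ℝ}

lemma memLp_weightedError (hε : IsErrorSequence μ ε) (w : ℕ → ℝ) (v : ℝ) :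
    MemLp (weightedError ε I m c w v) 2 μ :=
  (memLp_finsetSum _ fun i _ => (memLp_affineForm_sq hε (m i) (c i) (obsIndex r i)).const_mul
    (w i)).sub (memLp_const v)

lemma lintegral_weightedError (hε : IsErrorSequence μ ε) (w : ℕ → ℝ) (v : ℝ) :
    ∫⁻ ω, ENNReal.ofReal (weightedError ε I m c w v ω ^ 2) ∂μ
      = ENNReal.ofReal (mse μ ε I m c w v) :=
  (ofReal_integral_eq_lintegral_ofReal (memLp_weightedError hε w v).integrable_sq
    (ae_of_all _ fun _ => sq_nonneg _)).symm

/-- As a polynomial in finitely many weights and in `v`, the mean square depends continuously on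
them. This supplies measurability in t and passage to the limit in the bandwidth. -/
lemma mse_eq_quadratic (hε : IsErrorSequence μ ε) (w : ℕ → ℝ) (v : ℝ) :
    mse μ ε I m c w v
      = ∑ i ∈ I, ∑ k ∈ I, w i * w k * ∫ ω, affineForm ε (m i) (c i) (obsIndex r i) ω ^ 2
          * affineForm ε (m k) (c k) (obsIndex r k) ω ^ 2 ∂μ
        - 2 * v * (∑ i ∈ I, w i * ∫ ω, affineForm ε (m i) (c i) (obsIndex r i) ω ^ 2 ∂μ)
        + v ^ 2 := by
  set Z : ℕ → Ω → ℝ := fun i ω => affineForm ε (m i) (c i) (obsIndex r i) ω ^ 2 with hZ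
  have hZ2 : ∀ i, MemLp (Z i) 2 μ := fun i => memLp_affineForm_sq hε _ _ _
  have hexp : ∀ ω, weightedError ε I m c w v ω ^ 2
      = ∑ i ∈ I, ∑ k ∈ I, w i * w k * (Z i ω * Z k ω) - 2 * v * (∑ i ∈ I, w i * Z i ω) + v ^ 2 := by
    intro ω
    have : ∑ i ∈ I, ∑ k ∈ I, w i * w k * (Z i ω * Z k ω)
        = (∑ i ∈ I, w i * Z i ω) * ∑ i ∈ I, w i * Z i ω := by
      rw [Finset.sum_mul_sum]
      exact Finset.sum_congr rfl fun j _ => Finset.sum_congr rfl fun k _ => by ring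
    rw [this]
    show (∑ i ∈ I, w i * Z i ω - v) ^ 2 = _
    ring
  have i1 : ∀ i, Integrable (fun ω => w i * Z i ω) μ := fun i =>
    ((hZ2 i).integrable (by norm_num)).const_mul _
  have i2 : ∀ i k, Integrable (fun ω => w i * w k * (Z i ω * Z k ω)) μ := fun i k =>
    ((hZ2 i).integrable_mul (hZ2 k)).const_mul _
  have j1 : Integrable (fun ω => ∑ i ∈ I, w i * Z i ω) μ := integrable_finsetSum _ fun i _ => i1 i
  have j2 : Integrable (fun ω => ∑ i ∈ I, ∑ k ∈ I, w i * w k * (Z i ω * Z k ω)) μ :=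
    integrable_finsetSum _ fun i _ => integrable_finsetSum _ fun k _ => i2 i k
  have k1 : Integrable (fun ω => ∑ i ∈ I, ∑ k ∈ I, w i * w k * (Z i ω * Z k ω)
      - 2 * v * (∑ i ∈ I, w i * Z i ω)) μ := j2.sub (j1.const_mul _)
  rw [mse]
  simp only [hexp]
  rw [integral_add k1 (integrable_const _), integral_sub j2 (j1.const_mul _), integral_const_mul,
    integral_finsetSum _ fun i _ => i1 i,
    integral_finsetSum _ fun i _ => integrable_finsetSum _ fun k _ => i2 i k, integral_const]
  simp only [integral_const_mul, smul_eq_mul, probReal_univ, one_mul]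
  congr 2
  refine Finset.sum_congr rfl fun i _ => ?_
  rw [integral_finsetSum _ fun k _ => i2 i k]
  simp only [integral_const_mul, hZ]

lemma continuous_mse (hε : IsErrorSequence μ ε) :
    Continuous fun q : (ℕ → ℝ) × ℝ => mse μ ε I m c q.1 q.2 := by
  simp only [mse_eq_quadratic hε]
  fun_prop

lemma mse_zero (w : ℕ → ℝ) (h0 : ∀ i ∈ I, w i = 0) (v : ℝ) :
    mse μ ε I m c w v = v ^ 2 := by
  have : ∀ ω, weightedError ε I m c w v ω = -v := by
    intro ω
    rw [weightedError, Finset.sum_eq_zero fun i hi => by rw [h0 i hi, zero_mul], zero_sub]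
  simp [mse, this]

/-- The expectation of the `i`-th squared pseudoresidual. -/
def meanSq (m : ℕ → ℝ) (c : ℕ → Fin (r + 1) → ℝ) (i : ℕ) : ℝ := m i ^ 2 + ∑ j, c i j ^ 2

lemma integral_sq_eq_meanSq (hε : IsErrorSequence μ ε) {i : ℕ} (hi : r / 2 ≤ i) :
    ∫ ω, affineForm ε (m i) (c i) (obsIndex r i) ω ^ 2 ∂μ = meanSq m c i :=
  integral_affineForm_sq hε _ _ (obsIndex_injective hi)

lemma integral_weightedError (hε : IsErrorSequence μ ε) (hI : ∀ i ∈ I, r / 2 ≤ i) (w : ℕ → ℝ)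
    (v : ℝ) :
    ∫ ω, weightedError ε I m c w v ω ∂μ = ∑ i ∈ I, w i * meanSq m c i - v := by
  have i1 : ∀ i, Integrable (fun ω => w i * affineForm ε (m i) (c i) (obsIndex r i) ω ^ 2) μ :=
    fun i => ((memLp_affineForm_sq hε (m i) (c i) (obsIndex r i)).integrable
      (by norm_num)).const_mul _
  simp only [weightedError]
  rw [integral_sub (integrable_finsetSum _ fun i _ => i1 i) (integrable_const _),
    integral_finsetSum _ fun i _ => i1 i, integral_const]
  simp only [integral_const_mul, smul_eq_mul, probReal_univ, one_mul]
  congr 1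
  exact Finset.sum_congr rfl fun i hi => by rw [integral_sq_eq_meanSq hε (hI i hi)]

/-- The squared bias is a lower bound for the mean square. -/
lemma sq_bias_le_mse (hε : IsErrorSequence μ ε) (hI : ∀ i ∈ I, r / 2 ≤ i) (w : ℕ → ℝ) (v : ℝ) :
    (∑ i ∈ I, w i * meanSq m c i - v) ^ 2 ≤ mse μ ε I m c w v := by
  rw [← integral_weightedError hε hI]
  exact sq_integral_le (memLp_weightedError hε w v)

/-- Bias-variance bound for the mean square. -/
lemma mse_le (hε : IsErrorSequence μ ε) (hI : ∀ i ∈ I, r / 2 ≤ i) (w : ℕ → ℝ) (v : ℝ) {Q : ℝ}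
    (hQ : ∀ i ∈ I, ∫ ω, (affineForm ε (m i) (c i) (obsIndex r i) ω ^ 2) ^ 2 ∂μ ≤ Q) :
    mse μ ε I m c w v ≤ (∑ i ∈ I, w i * meanSq m c i - v) ^ 2
      + (2 * r + 1) * Q * ∑ i ∈ I, w i ^ 2 := by
  set Z : ℕ → Ω → ℝ := fun i ω => affineForm ε (m i) (c i) (obsIndex r i) ω ^ 2 with hZ
  have hZ2 : ∀ i, MemLp (Z i) 2 μ := fun i => memLp_affineForm_sq hε _ _ _
  have hZ1 : ∀ i, Integrable (Z i) μ := fun i => (hZ2 i).integrable (by norm_num)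
  have hZm : ∀ i ∈ I, ∫ ω, Z i ω ∂μ = meanSq m c i := fun i hi =>
    integral_sq_eq_meanSq hε (hI i hi)
  set Y : ℕ → Ω → ℝ := fun i ω => Z i ω - meanSq m c i with hYdef
  have hY : ∀ i, MemLp (Y i) 2 μ := fun i => (hZ2 i).sub (memLp_const _)
  have hY0 : ∀ i ∈ I, ∫ ω, Y i ω ∂μ = 0 := by
    intro i hi
    simp only [hYdef]
    rw [integral_sub (hZ1 i) (integrable_const _), hZm i hi]
    simp
  have hYQ : ∀ i ∈ I, ∫ ω, Y i ω ^ 2 ∂μ ≤ Q := by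
    intro i hi
    refine le_trans ?_ (hQ i hi)
    have hexp : ∀ ω, Y i ω ^ 2 = Z i ω ^ 2 - (2 * meanSq m c i * Z i ω - meanSq m c i ^ 2) := by
      intro ω; simp only [hYdef]; ring
    simp only [hexp]
    have k1 : Integrable (fun ω => 2 * meanSq m c i * Z i ω - meanSq m c i ^ 2) μ :=
      ((hZ1 i).const_mul _).sub (integrable_const _)
    rw [integral_sub (hZ2 i).integrable_sq k1,
      integral_sub ((hZ1 i).const_mul _) (integrable_const _), integral_const_mul, hZm i hi]
    simp only [integral_const, smul_eq_mul, probReal_univ, one_mul]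
    nlinarith [sq_nonneg (meanSq m c i)]
  -- Pseudoresiduals whose indices differ by more than `r` share no observation.
  have hdep : ∀ i ∈ I, ∀ k ∈ I, (i + r < k ∨ k + r < i) → ∫ ω, Y i ω * Y k ω ∂μ = 0 := by
    intro i hi k hk hik
    have h1 := indepFun_affineForm hε (m i) (m k) (c i) (c k) (f := obsIndex r i)
      (f' := obsIndex r k) (by
        intro a b hab
        have ha := a.2
        have hb := b.2
        have hi' := hI i hi
        have hk' := hI k hk
        simp only [obsIndex] at hab
        omega)
    have h2 : IndepFun (Y i) (Y k) μ :=
      h1.comp (φ := fun z : ℝ => z ^ 2 - meanSq m c i) (ψ := fun z : ℝ => z ^ 2 - meanSq m c k)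
        (by fun_prop) (by fun_prop)
    rw [h2.integral_fun_mul_eq_mul_integral (hY i).aestronglyMeasurable
      (hY k).aestronglyMeasurable, hY0 i hi, zero_mul]
  have hmain := integral_sq_sum_le w (fun i _ => hY i) hYQ hdep
  set b := ∑ i ∈ I, w i * meanSq m c i - v with hb
  have hsplit : ∀ ω, weightedError ε I m c w v ω ^ 2
      = (∑ i ∈ I, w i * Y i ω) ^ 2 + 2 * b * (∑ i ∈ I, w i * Y i ω) + b ^ 2 := by
    intro ω
    have : weightedError ε I m c w v ω = (∑ i ∈ I, w i * Y i ω) + b := by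
      simp only [weightedError, hYdef, mul_sub, Finset.sum_sub_distrib, hb, hZ]
      ring
    rw [this]; ring
  have hS : MemLp (fun ω => ∑ i ∈ I, w i * Y i ω) 2 μ :=
    memLp_finsetSum _ fun i _ => (hY i).const_mul _
  have hS1 : Integrable (fun ω => ∑ i ∈ I, w i * Y i ω) μ := hS.integrable (by norm_num)
  have hS0 : ∫ ω, ∑ i ∈ I, w i * Y i ω ∂μ = 0 := by
    rw [integral_finsetSum _ fun i _ => ((hY i).integrable (by norm_num)).const_mul _]
    exact Finset.sum_eq_zero fun i hi => by rw [integral_const_mul, hY0 i hi, mul_zero]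
  have k1 : Integrable (fun ω => (∑ i ∈ I, w i * Y i ω) ^ 2
      + 2 * b * (∑ i ∈ I, w i * Y i ω)) μ := hS.integrable_sq.add (hS1.const_mul _)
  rw [mse]
  simp only [hsplit]
  rw [integral_add k1 (integrable_const _), integral_add hS.integrable_sq (hS1.const_mul _),
    integral_const_mul, hS0]
  simp only [integral_const, smul_eq_mul, probReal_univ, one_mul]
  linarith

/-- Lower bound for the variance: the products of the two extreme errors of each pseudoresidual
are orthonormal, and each is correlated with a single squared pseudoresidual. -/
lemma sum_sq_le_mse (hε : IsErrorSequence μ ε) (hI : ∀ i ∈ I, r / 2 ≤ i) (w : ℕ → ℝ) (v : ℝ)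
    {a b : Fin (r + 1)} (hab : a < b) (hsupp : ∀ i j, c i j ≠ 0 → a ≤ j ∧ j ≤ b) {s : ℝ}
    (hs : ∀ i ∈ I, s ≤ (c i a * c i b) ^ 2) :
    4 * s * ∑ i ∈ I, w i ^ 2 ≤ mse μ ε I m c w v := by
  have hab' : (a : ℕ) < b := hab
  set ψ : ℕ → Ω → ℝ := fun i ω => ε (obsIndex r i a) ω * ε (obsIndex r i b) ω with hψdef
  have hne : ∀ i ∈ I, obsIndex r i a ≠ obsIndex r i b := by
    intro i hi h
    exact hab.ne (obsIndex_injective (hI i hi) h)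
  have hψ : ∀ i ∈ I, MemLp (ψ i) 2 μ := fun i _ => hε.memLp_mul _ _
  -- The two errors of each pair lie at the fixed distance `b - a`, so different `i` give different
  -- pairs.
  have horth : ∀ i ∈ I, ∀ k ∈ I, ∫ ω, ψ i ω * ψ k ω ∂μ = if i = k then 1 else 0 := by
    intro i hi k hk
    simp only [hψdef]
    rw [hε.integral_mul_four _ _ (hne k hk)]
    have hi' := hI i hi
    have hk' := hI k hk
    by_cases h : i = k
    · subst h
      rw [if_pos rfl, if_pos rfl, if_pos rfl, if_neg (hne i hi)]
      ring
    · have h1 : obsIndex r i a ≠ obsIndex r k a := by simp only [obsIndex]; omega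
      rw [if_neg h, if_neg h1]
      by_cases h2 : obsIndex r i a = obsIndex r k b
      · have h3 : obsIndex r i b ≠ obsIndex r k a := by simp only [obsIndex] at h2 ⊢; omega
        rw [if_neg h3]; ring
      · rw [if_neg h2]; ring
  -- For `k < i` the support of the coefficients stops short of the upper error of the `i`-th pair,
  -- and for `k > i` it starts after the lower one. This is why the extreme nonzero coefficients are
  -- used.
  have hcoef : ∀ i ∈ I, ∀ k ∈ I,
      errorCoeff (c k) (obsIndex r k) (obsIndex r i a)
        * errorCoeff (c k) (obsIndex r k) (obsIndex r i b)
      = if k = i then c i a * c i b else 0 := by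
    intro i hi k hk
    have hi' := hI i hi
    have hk' := hI k hk
    have hself : ∀ l : Fin (r + 1), errorCoeff (c i) (obsIndex r i) (obsIndex r i l) = c i l := by
      intro l
      rw [errorCoeff, Finset.sum_eq_single l]
      · simp
      · intro j _ hj
        rw [if_neg, mul_zero]
        exact fun h => hj (obsIndex_injective hi' h)
      · simp
    by_cases h : k = i
    · subst h
      rw [if_pos rfl, hself, hself]
    · rw [if_neg h]
      rcases lt_or_gt_of_ne h with hlt | hlt
      · have : errorCoeff (c k) (obsIndex r k) (obsIndex r i b) = 0 := by
          refine Finset.sum_eq_zero fun j _ => ?_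
          by_cases hj : c k j = 0
          · rw [hj, zero_mul]
          · have hjb : (j : ℕ) ≤ b := (hsupp k j hj).2
            rw [if_neg, mul_zero]
            simp only [obsIndex]
            omega
        rw [this, mul_zero]
      · have : errorCoeff (c k) (obsIndex r k) (obsIndex r i a) = 0 := by
          refine Finset.sum_eq_zero fun j _ => ?_
          by_cases hj : c k j = 0
          · rw [hj, zero_mul]
          · have hja : (a : ℕ) ≤ j := (hsupp k j hj).1
            rw [if_neg, mul_zero]
            simp only [obsIndex]
            omega
        rw [this, zero_mul]
  have hcorr : ∀ i ∈ I, ∫ ω, weightedError ε I m c w v ω * ψ i ω ∂μ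
      = 2 * w i * (c i a * c i b) := by
    intro i hi
    have hexp : ∀ ω, weightedError ε I m c w v ω * ψ i ω
        = ∑ k ∈ I, w k * (affineForm ε (m k) (c k) (obsIndex r k) ω ^ 2 * ψ i ω) - v * ψ i ω := by
      intro ω
      rw [weightedError, sub_mul, Finset.sum_mul]
      congr 1
      exact Finset.sum_congr rfl fun k _ => by ring
    simp only [hexp]
    have i1 : ∀ k, Integrable
        (fun ω => w k * (affineForm ε (m k) (c k) (obsIndex r k) ω ^ 2 * ψ i ω)) μ := fun k =>
      ((memLp_affineForm_sq hε (m k) (c k) (obsIndex r k)).integrable_mul (hψ i hi)).const_mul _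
    have i2 : Integrable (fun ω => v * ψ i ω) μ :=
      ((hψ i hi).integrable (by norm_num)).const_mul _
    rw [integral_sub (integrable_finsetSum _ fun k _ => i1 k) i2,
      integral_finsetSum _ fun k _ => i1 k, integral_const_mul]
    have e1 : ∫ ω, ψ i ω ∂μ = 0 := by
      simp only [hψdef]
      rw [hε.integral_mul, if_neg (hne i hi)]
    have e2 : ∀ k ∈ I, ∫ ω, w k * (affineForm ε (m k) (c k) (obsIndex r k) ω ^ 2 * ψ i ω) ∂μ
        = if k = i then 2 * w i * (c i a * c i b) else 0 := by
      intro k hk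
      rw [integral_const_mul]
      simp only [hψdef]
      rw [integral_affineForm_sq_mul hε _ _ _ (hne i hi), hcoef i hi k hk]
      split_ifs with h
      · rw [h]; ring
      · simp
    rw [e1, Finset.sum_congr rfl e2, Finset.sum_ite_eq', if_pos hi]
    ring
  refine le_trans ?_ (sum_sq_integral_mul_le (memLp_weightedError hε w v) hψ horth)
  rw [Finset.mul_sum]
  refine Finset.sum_le_sum fun i hi => ?_
  rw [hcorr i hi]
  have := mul_le_mul_of_nonneg_right (hs i hi) (by positivity : 0 ≤ 4 * w i ^ 2)
  nlinarith

end MeanSquare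

/-- The unit sum of squares forces a nonzero coefficient; if there were only one, the coefficients
could not sum to zero. -/
lemma IsDifferenceSequence.exists_extreme {r : ℕ} {d : Fin (r + 1) → ℝ}
    (hd : IsDifferenceSequence d) :
    ∃ a b : Fin (r + 1), a < b ∧ d a ≠ 0 ∧ d b ≠ 0 ∧ ∀ j, d j ≠ 0 → a ≤ j ∧ j ≤ b := by
  set S := (Finset.univ : Finset (Fin (r + 1))).filter fun j => d j ≠ 0 with hS
  have hne : S.Nonempty := by
    rw [Finset.nonempty_iff_ne_empty]
    intro h0
    have h1 : ∀ j, d j = 0 := by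
      intro j
      by_contra hj
      have : j ∈ S := by simp [hS, hj]
      rw [h0] at this
      simp at this
    have := hd.sum_sq_eq_one
    simp [h1] at this
  have ha := (Finset.mem_filter.1 (S.min'_mem hne)).2
  have hb := (Finset.mem_filter.1 (S.max'_mem hne)).2
  have hmem : ∀ j, d j ≠ 0 → S.min' hne ≤ j ∧ j ≤ S.max' hne := by
    intro j hj
    have : j ∈ S := by simp [hS, hj]
    exact ⟨S.min'_le j this, S.le_max' j this⟩
  refine ⟨S.min' hne, S.max' hne, ?_, ha, hb, hmem⟩
  refine lt_of_le_of_ne (hmem _ ha).2 fun heq => ha ?_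
  have h0 := hd.sum_eq_zero
  rw [Finset.sum_eq_single (S.min' hne)] at h0
  · exact h0
  · intro j _ hj
    by_contra hdj
    have := hmem j hdj
    rw [← heq] at this
    exact hj (le_antisymm this.2 this.1)
  · simp

lemma IsDifferenceSequence.abs_le_one {r : ℕ} {d : Fin (r + 1) → ℝ}
    (hd : IsDifferenceSequence d) (j : Fin (r + 1)) : |d j| ≤ 1 := by
  rw [← sq_le_one_iff_abs_le_one, ← hd.sum_sq_eq_one]
  exact Finset.single_le_sum (f := fun j => d j ^ 2) (fun _ _ => sq_nonneg _) (Finset.mem_univ j)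

/-! ### Measurability, and the risk as an integral of pointwise mean squared errors. -/

section Risk

set_option linter.unusedSectionVars false

variable {Ω : Type*} [MeasurableSpace Ω] {μ : Measure Ω} {ε : ℕ → Ω → ℝ} {r : ℕ}

/-- The contribution of the mean function to the pseudoresidual. -/
def residualMean (d : Fin (r + 1) → ℝ) (y : ℕ → ℝ) (g : ℝ → ℝ) (i : ℕ) : ℝ :=
  ∑ j, d j * g (y (obsIndex r i j))

/-- The coefficients of the errors in the pseudoresidual. -/
def residualCoeff (d : Fin (r + 1) → ℝ) (y : ℕ → ℝ) (V : ℝ → ℝ) (i : ℕ) (j : Fin (r + 1)) : ℝ :=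
  d j * √(V (y (obsIndex r i j)))

lemma pseudoresidual_response (d : Fin (r + 1) → ℝ) (y : ℕ → ℝ) (g V : ℝ → ℝ) (i : ℕ) (ω : Ω) :
    pseudoresidual d (response y g V fun i => ε i ω) i
      = affineForm ε (residualMean d y g i) (residualCoeff d y V i) (obsIndex r i) ω := by
  simp only [pseudoresidual, response, affineForm, residualMean, residualCoeff, obsIndex]
  rw [← Finset.sum_add_distrib]
  exact Finset.sum_congr rfl fun j _ => by ring

/-- The effective kernel weights at the point `t`. -/
def kernelWeight (p : ℕ) (K : ℝ → ℝ) (h : ℝ) (y : ℕ → ℝ) (I : Finset ℕ) (t : ℝ) (i : ℕ) : ℝ :=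
  lpWeight p y I t (fun i => K ((t - y i) / h)) i

lemma varianceEstimator_sub (d : Fin (r + 1) → ℝ) {p : ℕ} {K : ℝ → ℝ} (hK : ∀ u, 0 ≤ K u)
    (h : ℝ) (n : ℕ) (y : ℕ → ℝ) (g V : ℝ → ℝ) (t : ℝ) (ω : Ω) :
    varianceEstimator d p K h n y (response y g V fun i => ε i ω) t - V t
      = weightedError ε (residualIndices r n) (residualMean d y g) (residualCoeff d y V)
        (kernelWeight p K h y (residualIndices r n) t) (V t) ω := by
  rw [varianceEstimator, localPoly_eq_sum hK, weightedError]
  simp only [pseudoresidual_response, kernelWeight]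

/-- The integral of a non-integrable function is `0` by convention, not `1`. This is also the source
of almost everywhere measurability of `K`. -/
lemma IsWeight.integrable {K : ℝ → ℝ} (hK : IsWeight K) : Integrable K := by
  by_contra h
  have := hK.integral_eq_one
  rw [integral_undef h] at this
  norm_num at this

/-- Since `K` is known only to be almost everywhere measurable, composing it with an affine map
requires that null sets pull back to null sets. -/
lemma quasiMeasurePreserving_sub_div (a : ℝ) {h : ℝ} (hh : h ≠ 0) :
    Measure.QuasiMeasurePreserving (fun t : ℝ => (t - a) / h) volume volume := by
  have h1 : Measure.QuasiMeasurePreserving (fun t : ℝ => t - a) volume volume :=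
    (measurePreserving_sub_right volume a).quasiMeasurePreserving
  have h2 : Measure.QuasiMeasurePreserving (fun t : ℝ => t * h⁻¹) volume volume := by
    refine ⟨by fun_prop, ?_⟩
    rw [Real.map_volume_mul_right (inv_ne_zero hh)]
    exact Measure.smul_absolutelyContinuous
  have := h2.comp h1
  refine this

/-- The inverse matrix is the adjugate times the inverse of the determinant, and real inversion is
measurable, including at `0`. -/
lemma measurable_lpWeight (p : ℕ) (y : ℕ → ℝ) (I : Finset ℕ) (i : ℕ) :
    Measurable fun q : ℝ × (ℕ → ℝ) => lpWeight p y I q.1 q.2 i := by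
  have hg : Continuous fun q : ℝ × (ℕ → ℝ) => gram p y I q.1 q.2 := by
    refine continuous_matrix fun a b => ?_
    simp only [gram, Matrix.of_apply]
    fun_prop
  have hdet : Measurable fun q : ℝ × (ℕ → ℝ) => (gram p y I q.1 q.2).det⁻¹ :=
    hg.matrix_det.measurable.inv
  have hadj : ∀ l, Measurable fun q : ℝ × (ℕ → ℝ) => (gram p y I q.1 q.2).adjugate 0 l :=
    fun l => (hg.matrix_adjugate.matrix_elem 0 l).measurable
  simp only [lpWeight, Matrix.inv_def, Ring.inverse_eq_inv', Matrix.smul_apply, smul_eq_mul]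
  have h1 : Measurable fun q : ℝ × (ℕ → ℝ) => q.2 i := by fun_prop
  refine h1.mul (Finset.measurable_fun_sum _ fun l _ => (hdet.mul (hadj l)).mul ?_)
  fun_prop

lemma aemeasurable_kernelWeight (p : ℕ) {K : ℝ → ℝ} (hK : AEMeasurable K volume) {h : ℝ}
    (hh : h ≠ 0) (y : ℕ → ℝ) (I : Finset ℕ) (i : ℕ) :
    AEMeasurable (fun t => kernelWeight p K h y I t i) volume := by
  have h1 : AEMeasurable (fun t : ℝ => (t, fun i => K ((t - y i) / h))) volume :=
    aemeasurable_id.prodMk (aemeasurable_pi_lambda _ fun i =>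
      hK.comp_quasiMeasurePreserving (quasiMeasurePreserving_sub_div (y i) hh))
  exact (measurable_lpWeight p y I i).comp_aemeasurable h1

/-- The mean squared error at a point. -/
def pointRisk (μ : Measure Ω) (ε : ℕ → Ω → ℝ) (d : Fin (r + 1) → ℝ) (p : ℕ) (K : ℝ → ℝ) (n : ℕ)
    (y : ℕ → ℝ) (g V : ℝ → ℝ) (h t : ℝ) : ℝ :=
  mse μ ε (residualIndices r n) (residualMean d y g) (residualCoeff d y V)
    (kernelWeight p K h y (residualIndices r n) t) (V t)

variable [IsProbabilityMeasure μ]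

lemma aemeasurable_pointRisk (hε : IsErrorSequence μ ε) (d : Fin (r + 1) → ℝ) (p : ℕ)
    {K : ℝ → ℝ} (hK : AEMeasurable K volume) (n : ℕ) (y : ℕ → ℝ) (g : ℝ → ℝ) {V : ℝ → ℝ}
    (hV : ContinuousOn V (Icc 0 1)) {h : ℝ} (hh : h ≠ 0) :
    AEMeasurable (fun t => pointRisk μ ε d p K n y g V h t) (volume.restrict (Icc 0 1)) := by
  have h0 : AEMeasurable (kernelWeight p K h y (residualIndices r n))
      (volume.restrict (Icc 0 1)) :=
    aemeasurable_pi_iff.2 fun i => (aemeasurable_kernelWeight p hK hh y _ i).restrict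
  have h1 := h0.prodMk (hV.aemeasurable (μ := volume) measurableSet_Icc)
  have h2 : Measurable fun q : (ℕ → ℝ) × ℝ => mse μ ε (residualIndices r n)
      (residualMean d y g) (residualCoeff d y V) q.1 q.2 := (continuous_mse hε).measurable
  exact (h2.comp_aemeasurable h1).congr (ae_of_all _ fun t => rfl)

/-- The global risk is the integral of the pointwise mean squared error. -/
theorem risk_eq_lintegral (hε : IsErrorSequence μ ε) (d : Fin (r + 1) → ℝ) (p : ℕ)
    {K : ℝ → ℝ} (hK : IsWeight K) (n : ℕ) (y : ℕ → ℝ) (g : ℝ → ℝ) {V : ℝ → ℝ}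
    (hV : ContinuousOn V (Icc 0 1)) {h : ℝ} (hh : h ≠ 0) :
    risk μ ε d p K n y g V h
      = ∫⁻ t in Icc (0 : ℝ) 1, ENNReal.ofReal (pointRisk μ ε d p K n y g V h t) := by
  have hKm : AEMeasurable K volume := hK.integrable.aestronglyMeasurable.aemeasurable
  have hmeas : AEMeasurable (fun q : Ω × ℝ => weightedError ε (residualIndices r n)
      (residualMean d y g) (residualCoeff d y V)
      (kernelWeight p K h y (residualIndices r n) q.2) (V q.2) q.1)
      (μ.prod (volume.restrict (Icc (0 : ℝ) 1))) := by
    simp only [weightedError]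
    refine AEMeasurable.sub (Finset.aemeasurable_fun_sum _ fun i _ => AEMeasurable.mul ?_ ?_) ?_
    · exact ((aemeasurable_kernelWeight p hKm hh y _ i).restrict).comp_snd
    · exact (((measurable_affineForm hε _ _ _).comp measurable_fst).pow_const 2).aemeasurable
    · exact (hV.aemeasurable measurableSet_Icc).comp_snd
  -- Tonelli's theorem moves the expectation inside the integral over t.
  have hswap := lintegral_lintegral_swap
    (f := fun ω t => ENNReal.ofReal (weightedError ε (residualIndices r n)
      (residualMean d y g) (residualCoeff d y V)
      (kernelWeight p K h y (residualIndices r n) t) (V t) ω ^ 2))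
    (hmeas.pow_const 2).ennreal_ofReal
  simp only [lintegral_weightedError hε] at hswap
  simp only [risk, varianceEstimator_sub d hK.nonneg]
  exact hswap

end Risk

lemma mem_residualIndices_bounds {r n i : ℕ} (hi : i ∈ residualIndices r n) :
    r / 2 ≤ i ∧ i ≤ n ∧ ∀ j : Fin (r + 1), obsIndex r i j ≤ n := by
  rw [residualIndices, Finset.mem_Icc] at hi
  refine ⟨by omega, by omega, fun j => ?_⟩
  have := j.2
  simp only [obsIndex]
  omega

lemma card_residualIndices_le (r n : ℕ) : (residualIndices r n).card ≤ n := by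
  rw [residualIndices, Nat.card_Icc]
  omega

/-! ### Window counts and effective weights. -/

/-- The number of design points in a window of radius `h` around `t`. -/
def windowCount (y : ℕ → ℝ) (I : Finset ℕ) (h t : ℝ) : ℝ :=
  ∑ i ∈ I, (Icc (y i - h) (y i + h)).indicator (fun _ => (1 : ℝ)) t

lemma windowCount_nonneg (y : ℕ → ℝ) (I : Finset ℕ) (h t : ℝ) : 0 ≤ windowCount y I h t :=
  Finset.sum_nonneg fun _ _ => indicator_nonneg (fun _ _ => zero_le_one) _

lemma measurable_windowCount (y : ℕ → ℝ) (I : Finset ℕ) (h : ℝ) :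
    Measurable (windowCount y I h) :=
  Finset.measurable_fun_sum _ fun _ _ => measurable_const.indicator measurableSet_Icc

/-- Each point contributes an interval of length `2 * h`. The bound holds however the design points
cluster, when no pointwise bound of this order is available. -/
lemma lintegral_windowCount_le (y : ℕ → ℝ) (I : Finset ℕ) {h : ℝ} (hh : 0 ≤ h) {N : ℕ}
    (hN : I.card ≤ N) :
    ∫⁻ t in Icc (0 : ℝ) 1, ENNReal.ofReal (windowCount y I h t) ≤ ENNReal.ofReal (2 * h * N) := by
  have h1 : ∀ t, ENNReal.ofReal (windowCount y I h t)
      = ∑ i ∈ I, (Icc (y i - h) (y i + h)).indicator (fun _ => (1 : ℝ≥0∞)) t := by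
    intro t
    rw [windowCount, ENNReal.ofReal_sum_of_nonneg fun _ _ =>
      indicator_nonneg (fun _ _ => zero_le_one) _]
    refine Finset.sum_congr rfl fun i _ => ?_
    by_cases ht : t ∈ Icc (y i - h) (y i + h)
    · simp only [indicator_of_mem ht, ENNReal.ofReal_one]
    · simp only [indicator_of_notMem ht, ENNReal.ofReal_zero]
  simp only [h1]
  refine (lintegral_mono' Measure.restrict_le_self le_rfl).trans ?_
  rw [lintegral_finsetSum _ fun _ _ => measurable_const.indicator measurableSet_Icc]
  have h2 : ∀ i ∈ I, ∫⁻ t, (Icc (y i - h) (y i + h)).indicator (fun _ => (1 : ℝ≥0∞)) t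
      = ENNReal.ofReal (2 * h) := by
    intro i _
    rw [lintegral_indicator measurableSet_Icc, setLIntegral_const, Real.volume_Icc, one_mul]
    congr 1; ring
  rw [Finset.sum_congr rfl h2, Finset.sum_const, nsmul_eq_mul, mul_comm,
    ← ENNReal.ofReal_natCast, ← ENNReal.ofReal_mul (by positivity)]
  exact ENNReal.ofReal_le_ofReal (by gcongr)

section KernelWeight

variable {p : ℕ} {K : ℝ → ℝ} {h : ℝ} {y : ℕ → ℝ} {I : Finset ℕ} {t : ℝ}

lemma kernelWeight_eq_zero (hK : ∀ u, 1 < |u| → K u = 0) (hh : 0 < h) {i : ℕ}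
    (hi : h < |t - y i|) : kernelWeight p K h y I t i = 0 := by
  refine lpWeight_eq_zero_of_weight (hK _ ?_)
  rwa [abs_div, abs_of_pos hh, one_lt_div hh]

/-- Cauchy–Schwarz against the indicator of the window, outside which the weights vanish. -/
lemma sq_sum_abs_kernelWeight_le (hK : ∀ u, 1 < |u| → K u = 0) (hh : 0 < h) :
    (∑ i ∈ I, |kernelWeight p K h y I t i|) ^ 2
      ≤ windowCount y I h t * ∑ i ∈ I, kernelWeight p K h y I t i ^ 2 := by
  set e : ℕ → ℝ := fun i => (Icc (y i - h) (y i + h)).indicator (fun _ => (1 : ℝ)) t with he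
  have h1 : ∀ i, |kernelWeight p K h y I t i| = e i * |kernelWeight p K h y I t i| := by
    intro i
    by_cases ht : t ∈ Icc (y i - h) (y i + h)
    · simp only [he, indicator_of_mem ht, one_mul]
    · have : h < |t - y i| := by
        by_contra! hle
        rw [abs_le] at hle
        exact ht ⟨by linarith, by linarith⟩
      rw [kernelWeight_eq_zero hK hh this]
      simp
  have h2 : ∀ i, e i ^ 2 = e i := by
    intro i
    by_cases ht : t ∈ Icc (y i - h) (y i + h)
    · simp [he, ht]
    · simp only [he, indicator_of_notMem ht]; norm_num
  have h3 := Finset.sum_mul_sq_le_sq_mul_sq I e fun i => |kernelWeight p K h y I t i|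
  rw [Finset.sum_congr rfl fun i _ => h1 i]
  simp only [sq_abs, h2] at h3
  exact h3

end KernelWeight

/-! ### Lower bound from the variance, valid for every bandwidth. -/

section LowerBound

variable {Ω : Type*} [MeasurableSpace Ω] {μ : Measure Ω} [IsProbabilityMeasure μ]
  {ε : ℕ → Ω → ℝ} {r : ℕ}

lemma sum_sq_kernelWeight_le_pointRisk (hε : IsErrorSequence μ ε) {d : Fin (r + 1) → ℝ}
    {a b : Fin (r + 1)} (hab : a < b) (hsupp : ∀ j, d j ≠ 0 → a ≤ j ∧ j ≤ b) (p : ℕ) (K : ℝ → ℝ)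
    {n : ℕ} {y : ℕ → ℝ} (hy : ∀ i ≤ n, y i ∈ Icc (0 : ℝ) 1) (g : ℝ → ℝ) {V : ℝ → ℝ} {δ : ℝ}
    (hδ : 0 < δ) (hV : ∀ t ∈ Icc (0 : ℝ) 1, δ ≤ V t) (h t : ℝ) :
    4 * ((d a * d b) ^ 2 * δ ^ 2)
        * ∑ i ∈ residualIndices r n, kernelWeight p K h y (residualIndices r n) t i ^ 2
      ≤ pointRisk μ ε d p K n y g V h t := by
  refine sum_sq_le_mse hε (fun i hi => (mem_residualIndices_bounds hi).1) _ _ hab ?_ ?_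
  · intro i j hj
    refine hsupp j fun h0 => hj ?_
    rw [residualCoeff, h0, zero_mul]
  · intro i hi
    obtain ⟨-, -, h3⟩ := mem_residualIndices_bounds hi
    have ha := hV _ (hy _ (h3 a))
    have hb := hV _ (hy _ (h3 b))
    simp only [residualCoeff]
    rw [mul_mul_mul_comm, mul_pow _ (_ * _), mul_pow (√_), Real.sq_sqrt (hδ.le.trans ha),
      Real.sq_sqrt (hδ.le.trans hb)]
    have : δ ^ 2 ≤ V (y (obsIndex r i a)) * V (y (obsIndex r i b)) := by nlinarith
    gcongr

/-- If the fit is unique the weights sum to one, and Cauchy–Schwarz bounds their sum of squares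
below by the reciprocal of the window count. If it is not, the estimate is `0` and the error is at
least `δ ^ 2`. The denominator `1 + windowCount` serves both cases and is never zero. -/
lemma div_le_pointRisk (hε : IsErrorSequence μ ε) {d : Fin (r + 1) → ℝ}
    {a b : Fin (r + 1)} (hab : a < b) (hsupp : ∀ j, d j ≠ 0 → a ≤ j ∧ j ≤ b) (p : ℕ) {K : ℝ → ℝ}
    (hK : IsWeight K)
    {n : ℕ} {y : ℕ → ℝ} (hy : ∀ i ≤ n, y i ∈ Icc (0 : ℝ) 1) (g : ℝ → ℝ) {V : ℝ → ℝ} {δ : ℝ}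
    (hδ : 0 < δ) (hV : ∀ t ∈ Icc (0 : ℝ) 1, δ ≤ V t) {h t : ℝ} (hh : 0 < h)
    (ht : t ∈ Icc (0 : ℝ) 1) :
    min (4 * ((d a * d b) ^ 2 * δ ^ 2)) (δ ^ 2) / (1 + windowCount y (residualIndices r n) h t)
      ≤ pointRisk μ ε d p K n y g V h t := by
  set I := residualIndices r n with hI
  have hN := windowCount_nonneg y I h t
  by_cases hdet : (gram p y I t fun i => K ((t - y i) / h)).det = 0
  · have h0 : pointRisk μ ε d p K n y g V h t = V t ^ 2 :=
      mse_zero _ (fun i _ => lpWeight_eq_zero_of_det hdet i) _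
    rw [h0]
    have h1 : δ ^ 2 ≤ V t ^ 2 := pow_le_pow_left₀ hδ.le (hV t ht) 2
    refine le_trans ?_ h1
    rw [div_le_iff₀ (by positivity)]
    have : min (4 * ((d a * d b) ^ 2 * δ ^ 2)) (δ ^ 2) ≤ δ ^ 2 := min_le_right _ _
    nlinarith [sq_nonneg δ]
  · refine le_trans ?_ (sum_sq_kernelWeight_le_pointRisk hε hab hsupp p K hy g hδ hV h t)
    have h1 : ∑ i ∈ I, kernelWeight p K h y I t i = 1 := sum_lpWeight hdet
    have h2 := sq_sum_abs_kernelWeight_le (p := p) (y := y) (I := I) (t := t) hK.support hh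
    have h3 : (1 : ℝ) ≤ (∑ i ∈ I, |kernelWeight p K h y I t i|) ^ 2 := by
      have := Finset.abs_sum_le_sum_abs (kernelWeight p K h y I t) I
      rw [h1, abs_one] at this
      nlinarith
    set S := ∑ i ∈ I, kernelWeight p K h y I t i ^ 2 with hS
    have hS0 : 0 ≤ S := Finset.sum_nonneg fun _ _ => sq_nonneg _
    rw [div_le_iff₀ (by positivity)]
    have h4 : 1 ≤ S * (1 + windowCount y I h t) := by nlinarith
    have h5 : min (4 * ((d a * d b) ^ 2 * δ ^ 2)) (δ ^ 2) ≤ 4 * ((d a * d b) ^ 2 * δ ^ 2) :=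
      min_le_left _ _
    have h6 : 0 ≤ 4 * ((d a * d b) ^ 2 * δ ^ 2) := by positivity
    calc _ ≤ 4 * ((d a * d b) ^ 2 * δ ^ 2) := h5
      _ ≤ 4 * ((d a * d b) ^ 2 * δ ^ 2) * (S * (1 + windowCount y I h t)) :=
        le_mul_of_one_le_right h6 h4
      _ = _ := by ring

/-- The variance contribution to the risk, for every bandwidth. -/
theorem div_le_risk (hε : IsErrorSequence μ ε) {d : Fin (r + 1) → ℝ}
    {a b : Fin (r + 1)} (hab : a < b) (hsupp : ∀ j, d j ≠ 0 → a ≤ j ∧ j ≤ b) (p : ℕ) {K : ℝ → ℝ}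
    (hK : IsWeight K)
    {n : ℕ} {y : ℕ → ℝ} (hy : ∀ i ≤ n, y i ∈ Icc (0 : ℝ) 1) (g : ℝ → ℝ) {V : ℝ → ℝ} {δ : ℝ}
    (hδ : 0 < δ) (hVc : ContinuousOn V (Icc 0 1)) (hV : ∀ t ∈ Icc (0 : ℝ) 1, δ ≤ V t) {h : ℝ}
    (hh : 0 < h) :
    ENNReal.ofReal (min (4 * ((d a * d b) ^ 2 * δ ^ 2)) (δ ^ 2) / (1 + 2 * h * n))
      ≤ risk μ ε d p K n y g V h := by
  rw [risk_eq_lintegral hε d p hK n y g hVc hh.ne']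
  set s := min (4 * ((d a * d b) ^ 2 * δ ^ 2)) (δ ^ 2) with hs
  have hs0 : 0 ≤ s := by positivity
  set S := 1 / (1 + 2 * h * n) with hSdef
  have hS0 : 0 < S := by positivity
  set N := windowCount y (residualIndices r n) h with hN
  have hN0 : ∀ t, 0 ≤ N t := windowCount_nonneg _ _ _
  have hcount := lintegral_windowCount_le y (residualIndices r n) hh.le
    (card_residualIndices_le r n)
  -- Jensen's inequality for 1/u through the tangent bound 2S ≤ 1/u + S² u, with S the reciprocal of
  -- the bound for the integral of u = 1 + N. The additive form avoids subtraction in `ℝ≥0∞`.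
  have hpt : ∀ t ∈ Icc (0 : ℝ) 1, ENNReal.ofReal (2 * (s * S))
      ≤ ENNReal.ofReal (pointRisk μ ε d p K n y g V h t)
        + (ENNReal.ofReal (s * S ^ 2) + ENNReal.ofReal (s * S ^ 2) * ENNReal.ofReal (N t)) := by
    intro t ht
    have h1 := div_le_pointRisk hε hab hsupp p hK hy g hδ hV hh ht
    have h2 := hN0 t
    have hp0 : 0 ≤ pointRisk μ ε d p K n y g V h t := (by positivity : 0 ≤ s / (1 + N t)).trans h1
    rw [← ENNReal.ofReal_mul (by positivity), ← ENNReal.ofReal_add (by positivity) (by positivity),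
      ← ENNReal.ofReal_add hp0 (by positivity)]
    refine ENNReal.ofReal_le_ofReal ?_
    refine le_trans ?_ (add_le_add_left h1 _)
    have h3 : 2 * S ≤ 1 / (1 + N t) + S ^ 2 * (1 + N t) := by
      have h4 : 1 / (1 + N t) + S ^ 2 * (1 + N t) - 2 * S
          = (1 - S * (1 + N t)) ^ 2 / (1 + N t) := by field_simp; ring
      have : 0 ≤ (1 - S * (1 + N t)) ^ 2 / (1 + N t) := by positivity
      linarith
    calc 2 * (s * S) = s * (2 * S) := by ring
      _ ≤ s * (1 / (1 + N t) + S ^ 2 * (1 + N t)) := by gcongr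
      _ = _ := by ring
  have hint := setLIntegral_mono' (μ := volume) measurableSet_Icc hpt
  have hNm : Measurable fun t => ENNReal.ofReal (N t) :=
    (measurable_windowCount y _ h).ennreal_ofReal
  have hm : Measurable fun t => ENNReal.ofReal (s * S ^ 2)
      + ENNReal.ofReal (s * S ^ 2) * ENNReal.ofReal (N t) :=
    measurable_const.add (hNm.const_mul _)
  rw [lintegral_add_right _ hm, lintegral_add_right _ (hNm.const_mul _),
    lintegral_const_mul _ hNm, setLIntegral_const, setLIntegral_const, Real.volume_Icc] at hint
  simp only [sub_zero, ENNReal.ofReal_one, mul_one] at hint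
  have hrest : ENNReal.ofReal (s * S ^ 2) + ENNReal.ofReal (s * S ^ 2)
      * ∫⁻ t in Icc (0 : ℝ) 1, ENNReal.ofReal (N t) ≤ ENNReal.ofReal (s * S) := by
    calc _ ≤ ENNReal.ofReal (s * S ^ 2)
          + ENNReal.ofReal (s * S ^ 2) * ENNReal.ofReal (2 * h * n) := by gcongr
      _ = ENNReal.ofReal (s * S ^ 2 + s * S ^ 2 * (2 * h * n)) := by
        rw [← ENNReal.ofReal_mul (by positivity), ← ENNReal.ofReal_add (by positivity)
          (by positivity)]
      _ = ENNReal.ofReal (s * S) := by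
        congr 1
        rw [hSdef]
        field_simp
  have htwo : ENNReal.ofReal (2 * (s * S)) = ENNReal.ofReal (s * S) + ENNReal.ofReal (s * S) := by
    rw [← ENNReal.ofReal_add (by positivity) (by positivity), two_mul]
  rw [htwo] at hint
  have h5 := hint.trans (add_le_add_right hrest _)
  have h6 : ENNReal.ofReal (s / (1 + 2 * h * n)) = ENNReal.ofReal (s * S) := by
    rw [hSdef, mul_one_div]
  rw [h6]
  exact (ENNReal.add_le_add_iff_right ENNReal.ofReal_ne_top).1 h5

end LowerBound

/-! ### Upper bound for the risk. -/

section UpperBound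

variable {Ω : Type*} [MeasurableSpace Ω] {μ : Measure Ω} [IsProbabilityMeasure μ]
  {ε : ℕ → Ω → ℝ} {r : ℕ}

lemma meanSq_residual {d : Fin (r + 1) → ℝ} {y : ℕ → ℝ} {n : ℕ}
    (hy : ∀ i ≤ n, y i ∈ Icc (0 : ℝ) 1) (g : ℝ → ℝ) {V : ℝ → ℝ}
    (hV : ∀ t ∈ Icc (0 : ℝ) 1, 0 ≤ V t) {i : ℕ} (hi : i ∈ residualIndices r n) :
    meanSq (residualMean d y g) (residualCoeff d y V) i
      = residualMean d y g i ^ 2 + ∑ j, d j ^ 2 * V (y (obsIndex r i j)) := by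
  rw [meanSq]
  congr 1
  refine Finset.sum_congr rfl fun j _ => ?_
  rw [residualCoeff, mul_pow, Real.sq_sqrt (hV _ (hy _ ((mem_residualIndices_bounds hi).2.2 j)))]

lemma HasMesh.abs_obs_sub_le {y : ℕ → ℝ} {n : ℕ} {δ : ℝ} (H : HasMesh y n δ) {i : ℕ}
    (hi : i ∈ residualIndices r n) (j : Fin (r + 1)) : |y (obsIndex r i j) - y i| ≤ r * δ := by
  obtain ⟨h1, h2, h3⟩ := mem_residualIndices_bounds hi
  have hj := j.2
  have hj3 := h3 j
  refine H.abs_sub_le (by omega) (by omega) ?_ ?_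
  · have : obsIndex r i j ≤ r + i := by simp only [obsIndex]; omega
    have h4 : ((obsIndex r i j : ℕ) : ℝ) ≤ r + i := by exact_mod_cast this
    linarith
  · have : i ≤ r + obsIndex r i j := by simp only [obsIndex]; omega
    have h4 : (i : ℝ) ≤ r + (obsIndex r i j : ℕ) := by exact_mod_cast this
    linarith

/-- Because the coefficients sum to zero, `g (y i)` can be subtracted from every term, leaving
increments of `g` over at most `r` gaps. -/
lemma HasMesh.abs_residualMean_le {y : ℕ → ℝ} {n : ℕ} {δ : ℝ} (H : HasMesh y n δ)
    {d : Fin (r + 1) → ℝ} (hd : IsDifferenceSequence d) {β C₁ C₂ : ℝ} (hβ : 0 < β) (hC₁ : 0 ≤ C₁)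
    (hC₂ : 0 ≤ C₂) {g : ℝ → ℝ} (hg : HolderClass β C₁ C₂ g) {i : ℕ}
    (hi : i ∈ residualIndices r n) :
    |residualMean d y g i| ≤ (r + 1) * ((C₁ + 6 * C₂) * (r * δ) ^ min β 1) := by
  have hb := mem_residualIndices_bounds hi
  have h1 : residualMean d y g i = ∑ j, d j * (g (y (obsIndex r i j)) - g (y i)) := by
    simp only [mul_sub, Finset.sum_sub_distrib]
    rw [← Finset.sum_mul, hd.sum_eq_zero, zero_mul, sub_zero, residualMean]
  rw [h1]
  refine (Finset.abs_sum_le_sum_abs _ _).trans ?_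
  have h2 : ∀ j ∈ (Finset.univ : Finset (Fin (r + 1))),
      |d j * (g (y (obsIndex r i j)) - g (y i))| ≤ (C₁ + 6 * C₂) * (r * δ) ^ min β 1 := by
    intro j _
    rw [abs_mul]
    have h3 := hg.modulus hβ hC₁ hC₂ (H.mem_Icc (by have := hb.2.2 j; omega : obsIndex r i j ≤ n + 1))
      (H.mem_Icc (by omega : i ≤ n + 1))
    have h4 := H.abs_obs_sub_le hi j
    calc _ ≤ 1 * ((C₁ + 6 * C₂) * |y (obsIndex r i j) - y i| ^ min β 1) := by
          gcongr
          exact hd.abs_le_one j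
      _ ≤ _ := by rw [one_mul]; gcongr
  have := Finset.sum_le_sum h2
  simpa using this

/-- Because the squared coefficients sum to one, the noise part is an average of `V` at points
within `r` gaps of `y i`; the contribution of `g` enters squared. -/
lemma HasMesh.abs_meanSq_sub_le {y : ℕ → ℝ} {n : ℕ} {δ : ℝ} (H : HasMesh y n δ)
    {d : Fin (r + 1) → ℝ} (hd : IsDifferenceSequence d) {γ C₁ C₂ : ℝ} (hγ : 0 < γ) (hC₁ : 0 ≤ C₁)
    (hC₂ : 0 ≤ C₂) {g V : ℝ → ℝ} (hV : VarianceClass γ C₁ C₂ V) {i : ℕ}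
    (hi : i ∈ residualIndices r n) :
    |meanSq (residualMean d y g) (residualCoeff d y V) i - V (y i)|
      ≤ residualMean d y g i ^ 2 + (C₁ + 6 * C₂) * (r * δ) ^ min γ 1 := by
  have hb := mem_residualIndices_bounds hi
  rw [meanSq_residual (fun i hi => H.mem_Icc (by omega)) g hV.nonneg hi, add_sub_assoc]
  refine (abs_add_le _ _).trans (add_le_add (abs_of_nonneg (sq_nonneg _)).le ?_)
  have h1 : ∑ j, d j ^ 2 * V (y (obsIndex r i j)) - V (y i)
      = ∑ j, d j ^ 2 * (V (y (obsIndex r i j)) - V (y i)) := by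
    simp only [mul_sub, Finset.sum_sub_distrib]
    rw [← Finset.sum_mul, hd.sum_sq_eq_one, one_mul]
  rw [h1]
  refine (Finset.abs_sum_le_sum_abs _ _).trans ?_
  have h2 : ∀ j ∈ (Finset.univ : Finset (Fin (r + 1))),
      |d j ^ 2 * (V (y (obsIndex r i j)) - V (y i))|
        ≤ d j ^ 2 * ((C₁ + 6 * C₂) * (r * δ) ^ min γ 1) := by
    intro j _
    rw [abs_mul, abs_of_nonneg (sq_nonneg (d j))]
    have h3 := hV.holderClass.modulus hγ hC₁ hC₂
      (H.mem_Icc (by have := hb.2.2 j; omega : obsIndex r i j ≤ n + 1))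
      (H.mem_Icc (by omega : i ≤ n + 1))
    have h4 := H.abs_obs_sub_le hi j
    have : (C₁ + 6 * C₂) * |y (obsIndex r i j) - y i| ^ min γ 1
        ≤ (C₁ + 6 * C₂) * (r * δ) ^ min γ 1 := by gcongr
    exact mul_le_mul_of_nonneg_left (h3.trans this) (sq_nonneg _)
  refine (Finset.sum_le_sum h2).trans (le_of_eq ?_)
  rw [← Finset.sum_mul, hd.sum_sq_eq_one, one_mul]

/-- A bound for the fourth moment of the pseudoresiduals. -/
def fourthMomentBound (μ : Measure Ω) (ε : ℕ → Ω → ℝ) (r : ℕ) (C₂ : ℝ) : ℝ :=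
  8 + 8 * (r + 1) ^ 3 * ((r + 1) * C₂ ^ 2 * ∫ ω, ε 0 ω ^ 4 ∂μ)

lemma fourthMoment_le (hε : IsErrorSequence μ ε) {d : Fin (r + 1) → ℝ}
    (hd : IsDifferenceSequence d) {n : ℕ} {y : ℕ → ℝ} (hy : ∀ i ≤ n, y i ∈ Icc (0 : ℝ) 1)
    {γ C₁ C₂ : ℝ} {g V : ℝ → ℝ} (hV : VarianceClass γ C₁ C₂ V) {i : ℕ}
    (hi : i ∈ residualIndices r n) (hm : |residualMean d y g i| ≤ 1) :
    ∫ ω, (affineForm ε (residualMean d y g i) (residualCoeff d y V i) (obsIndex r i) ω ^ 2) ^ 2 ∂μ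
      ≤ fourthMomentBound μ ε r C₂ := by
  refine (integral_affineForm_pow_four_le hε _ _ _).trans ?_
  have hκ : 0 ≤ ∫ ω, ε 0 ω ^ 4 ∂μ := integral_nonneg fun ω => by positivity
  have h1 : residualMean d y g i ^ 4 ≤ 1 := by
    have := pow_le_pow_left₀ (abs_nonneg _) hm 4
    rwa [one_pow, pow_abs, abs_of_nonneg (by positivity)] at this
  have h2 : ∀ j ∈ (Finset.univ : Finset (Fin (r + 1))), residualCoeff d y V i j ^ 4 ≤ C₂ ^ 2 := by
    intro j _
    have hyj := hy _ ((mem_residualIndices_bounds hi).2.2 j)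
    have h3 : residualCoeff d y V i j ^ 4 = d j ^ 4 * V (y (obsIndex r i j)) ^ 2 := by
      rw [residualCoeff, mul_pow]
      congr 1
      calc √(V (y (obsIndex r i j))) ^ 4 = (√(V (y (obsIndex r i j))) ^ 2) ^ 2 := by ring
        _ = _ := by rw [Real.sq_sqrt (hV.nonneg _ hyj)]
    have h4 : d j ^ 4 ≤ 1 := by
      have := pow_le_pow_left₀ (abs_nonneg _) (hd.abs_le_one j) 4
      rwa [one_pow, pow_abs, abs_of_nonneg (by positivity)] at this
    have h5 : V (y (obsIndex r i j)) ^ 2 ≤ C₂ ^ 2 :=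
      pow_le_pow_left₀ (hV.nonneg _ hyj) (hV.le _ hyj) 2
    rw [h3]
    calc _ ≤ 1 * C₂ ^ 2 := by gcongr
      _ = _ := one_mul _
  have h6 := Finset.sum_le_sum h2
  simp only [Finset.sum_const, Finset.card_univ, Fintype.card_fin, nsmul_eq_mul] at h6
  rw [fourthMomentBound, Fintype.card_fin]
  push_cast at h6 ⊢
  gcongr
  linarith

/-- Upper bound for the risk in terms of the bias of the pseudoresiduals. -/
theorem risk_le (hε : IsErrorSequence μ ε) {d : Fin (r + 1) → ℝ} (hd : IsDifferenceSequence d)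
    {K : ℝ → ℝ} (hKw : IsWeight K) {M c τ : ℝ} (hK : WeightBounds K M c τ) {y : ℕ → ℝ} {n : ℕ}
    {δ : ℝ} (H : HasMesh y n δ) (hr : r ≤ n) {γ C₁ C₂ : ℝ} (hγ : 0 < γ) (hC₁ : 0 ≤ C₁) {p : ℕ}
    (hp : strictFloor γ < p) {g V : ℝ → ℝ} (hV : VarianceClass γ C₁ C₂ V)
    (hm : ∀ i ∈ residualIndices r n, |residualMean d y g i| ≤ 1) {E : ℝ}
    (hE : ∀ i ∈ residualIndices r n,
      |meanSq (residualMean d y g) (residualCoeff d y V) i - V (y i)| ≤ E)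
    {h : ℝ} (hh : 0 < h) (hh1 : h ≤ 1) (hδ : 4 * (p + 1) * (r + 2) * δ ≤ τ * h) :
    risk μ ε d p K n y g V h ≤ ENNReal.ofReal
      ((E + C₁ * h ^ γ) ^ 2 * (christoffelConst p M c τ * (δ / h)) * (2 * h * n)
        + (2 * r + 1) * fourthMomentBound μ ε r C₂ * (christoffelConst p M c τ * (δ / h))) := by
  rw [risk_eq_lintegral hε d p hKw n y g hV.holderClass.continuousOn hh.ne']
  set I := residualIndices r n with hI
  set W := christoffelConst p M c τ * (δ / h) with hW
  set Q := fourthMomentBound μ ε r C₂ with hQ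
  have hy : ∀ i ≤ n, y i ∈ Icc (0 : ℝ) 1 := fun i hi => H.mem_Icc (by omega)
  have hQ0 : 0 ≤ Q := by
    have : 0 ≤ ∫ ω, ε 0 ω ^ 4 ∂μ := integral_nonneg fun ω => by positivity
    rw [hQ, fourthMomentBound]; positivity
  have hmin : min h 1 = h := min_eq_left hh1
  have hW0 : 0 ≤ W := by
    have hM : 0 ≤ M := (hK.nonneg 0).trans (hK.le 0)
    have := hK.c_pos
    have := hK.τ_pos
    have := H.nonneg
    rw [hW, christoffelConst]; positivity
  -- The Taylor expansion needs an interior centre; the two end points are negligible for the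
  -- integral.
  have hpt : ∀ t ∈ Ioo (0 : ℝ) 1, pointRisk μ ε d p K n y g V h t
      ≤ (E + C₁ * h ^ γ) ^ 2 * W * windowCount y I h t + (2 * r + 1) * Q * W := by
    intro t ht
    have ht' : t ∈ Icc (0 : ℝ) 1 := Ioo_subset_Icc_self ht
    obtain ⟨hdet, hsq⟩ := H.localFit_bounds hr hK hh (p := p) (by rwa [hmin]) ht'
    rw [hmin] at hsq
    change ∑ i ∈ I, kernelWeight p K h y I t i ^ 2 ≤ W at hsq
    have h1 := mse_le (μ := μ) (ε := ε) hε
      (fun i hi => (mem_residualIndices_bounds (n := n) hi).1)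
      (kernelWeight p K h y I t) (V t)
      (fun i hi => fourthMoment_le hε hd hy hV hi (hm i hi))
    obtain ⟨q, hq0, hq⟩ := hV.holderClass.taylor hγ hC₁ hp.le ht
    -- Reproduction replaces `V t` by the weighted sum of the values of the Taylor polynomial at the
    -- design points.
    have hbias : ∑ i ∈ I, kernelWeight p K h y I t i
          * meanSq (residualMean d y g) (residualCoeff d y V) i - V t
        = ∑ i ∈ I, kernelWeight p K h y I t i
          * (meanSq (residualMean d y g) (residualCoeff d y V) i - polyVal q (t - y i)) := by
      simp only [mul_sub, Finset.sum_sub_distrib]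
      rw [← hq0, ← sum_lpWeight_polyVal hdet q]
      rfl
    have habs : |∑ i ∈ I, kernelWeight p K h y I t i
          * meanSq (residualMean d y g) (residualCoeff d y V) i - V t|
        ≤ (E + C₁ * h ^ γ) * ∑ i ∈ I, |kernelWeight p K h y I t i| := by
      rw [hbias, Finset.mul_sum]
      refine (Finset.abs_sum_le_sum_abs _ _).trans (Finset.sum_le_sum fun i hi => ?_)
      rw [abs_mul, mul_comm]
      rcases lt_or_ge h |t - y i| with hlt | hge
      · rw [kernelWeight_eq_zero hK.support hh hlt]; simp
      · refine mul_le_mul_of_nonneg_right ?_ (abs_nonneg _)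
        have e1 := hq (y i) (hy i (mem_residualIndices_bounds hi).2.1)
        have e2 := hE i hi
        have e3 : C₁ * |t - y i| ^ γ ≤ C₁ * h ^ γ := by gcongr
        calc _ ≤ |meanSq (residualMean d y g) (residualCoeff d y V) i - V (y i)|
              + |V (y i) - polyVal q (t - y i)| := abs_sub_le _ _ _
          _ ≤ _ := by linarith
    have hsqb := sq_sum_abs_kernelWeight_le (p := p) (y := y) (I := I) (t := t) hK.support hh
    have hN := windowCount_nonneg y I h t
    have hh0 : 0 ≤ h ^ γ := by positivity
    have h2 : (∑ i ∈ I, kernelWeight p K h y I t i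
          * meanSq (residualMean d y g) (residualCoeff d y V) i - V t) ^ 2
        ≤ (E + C₁ * h ^ γ) ^ 2 * W * windowCount y I h t := by
      rw [← sq_abs]
      calc _ ≤ ((E + C₁ * h ^ γ) * ∑ i ∈ I, |kernelWeight p K h y I t i|) ^ 2 := by gcongr
        _ = (E + C₁ * h ^ γ) ^ 2 * (∑ i ∈ I, |kernelWeight p K h y I t i|) ^ 2 := by ring
        _ ≤ (E + C₁ * h ^ γ) ^ 2 * (windowCount y I h t * W) := by
          gcongr
          exact hsqb.trans (by gcongr)
        _ = _ := by ring
    have h3 : (2 * r + 1) * Q * ∑ i ∈ I, kernelWeight p K h y I t i ^ 2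
        ≤ (2 * r + 1) * Q * W := by gcongr
    exact h1.trans (add_le_add h2 h3)
  have hae : ∀ᵐ t ∂(volume.restrict (Icc (0 : ℝ) 1)),
      ENNReal.ofReal (pointRisk μ ε d p K n y g V h t)
        ≤ ENNReal.ofReal ((E + C₁ * h ^ γ) ^ 2 * W) * ENNReal.ofReal (windowCount y I h t)
          + ENNReal.ofReal ((2 * r + 1) * Q * W) := by
    rw [← Measure.restrict_congr_set (Ioo_ae_eq_Icc (a := (0 : ℝ)) (b := 1))]
    refine (ae_restrict_mem measurableSet_Ioo).mono fun t ht => ?_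
    have hN := windowCount_nonneg y I h t
    have hh0 : 0 ≤ h ^ γ := by positivity
    rw [← ENNReal.ofReal_mul (by positivity), ← ENNReal.ofReal_add (by positivity) (by positivity)]
    exact ENNReal.ofReal_le_ofReal (hpt t ht)
  refine (lintegral_mono_ae hae).trans ?_
  have hNm : Measurable fun t => ENNReal.ofReal (windowCount y I h t) :=
    (measurable_windowCount y _ h).ennreal_ofReal
  rw [lintegral_add_right _ measurable_const, lintegral_const_mul _ hNm, setLIntegral_const,
    Real.volume_Icc]
  simp only [sub_zero, ENNReal.ofReal_one, mul_one]
  have hcount := lintegral_windowCount_le y I hh.le (card_residualIndices_le r n)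
  have hh0 : 0 ≤ h ^ γ := by positivity
  rw [ENNReal.ofReal_add (by positivity) (by positivity),
    ENNReal.ofReal_mul (by positivity : 0 ≤ (E + C₁ * h ^ γ) ^ 2 * W)]
  gcongr

end UpperBound

/-! ### Lower bound from the bias: averaging over frequencies. -/

lemma integral_cos_two_pi_mul {z : ℤ} (hz : z ≠ 0) (a : ℝ) :
    ∫ t in (0 : ℝ)..1, Real.cos (2 * Real.pi * z * (a - t)) = 0 := by
  have hz' : (2 * Real.pi * z : ℝ) ≠ 0 :=
    mul_ne_zero (mul_ne_zero two_ne_zero Real.pi_ne_zero) (by exact_mod_cast hz)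
  have hderiv : ∀ t ∈ uIcc (0 : ℝ) 1, HasDerivAt
      (fun t => -(Real.sin (2 * Real.pi * z * (a - t)) / (2 * Real.pi * z)))
      (Real.cos (2 * Real.pi * z * (a - t))) t := by
    intro t _
    have h1 : HasDerivAt (fun t : ℝ => 2 * Real.pi * z * (a - t)) (2 * Real.pi * z * (-1)) t :=
      ((hasDerivAt_id t).const_sub a).const_mul _
    have h2 := (h1.sin.div_const (2 * Real.pi * z)).neg
    refine h2.congr_deriv ?_
    rw [mul_neg_one, mul_neg, neg_div, neg_neg, mul_div_assoc, div_self hz', mul_one]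
  rw [intervalIntegral.integral_eq_sub_of_hasDerivAt hderiv
    (by apply Continuous.intervalIntegrable; fun_prop)]
  have : 2 * Real.pi * z * (a - 1) = 2 * Real.pi * z * (a - 0) - z * (2 * Real.pi) := by ring
  rw [this, Real.sin_sub_int_mul_two_pi]
  ring

/-- The average of `cos (2 π k u)` over the frequencies `L < k ≤ 2 L`. -/
def avgCos (L : ℕ) (u : ℝ) : ℝ := (∑ k ∈ Finset.Ioc L (2 * L), Real.cos (2 * Real.pi * k * u)) / L

/-- The `L` cosines are orthogonal over a period with squared norm 1/2, so their average has squared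
norm `L / 2` divided by `L ^ 2`. -/
lemma integral_avgCos_sq {L : ℕ} (hL : 1 ≤ L) (a : ℝ) :
    ∫ t in (0 : ℝ)..1, avgCos L (a - t) ^ 2 = 1 / (2 * L) := by
  have hL0 : (L : ℝ) ≠ 0 := by positivity
  have hexp : ∀ t, avgCos L (a - t) ^ 2 = (∑ k ∈ Finset.Ioc L (2 * L), ∑ l ∈ Finset.Ioc L (2 * L),
      (Real.cos (2 * Real.pi * ((k : ℤ) - l : ℤ) * (a - t))
        + Real.cos (2 * Real.pi * ((k : ℤ) + l : ℤ) * (a - t))) / 2) / L ^ 2 := by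
    intro t
    rw [avgCos, div_pow, pow_two (∑ k ∈ _, _), Finset.sum_mul_sum]
    congr 1
    refine Finset.sum_congr rfl fun k _ => Finset.sum_congr rfl fun l _ => ?_
    have h1 : 2 * Real.pi * (((k : ℤ) - l : ℤ) : ℝ) * (a - t)
        = 2 * Real.pi * k * (a - t) - 2 * Real.pi * l * (a - t) := by push_cast; ring
    have h2 : 2 * Real.pi * (((k : ℤ) + l : ℤ) : ℝ) * (a - t)
        = 2 * Real.pi * k * (a - t) + 2 * Real.pi * l * (a - t) := by push_cast; ring
    rw [h1, h2, Real.cos_sub, Real.cos_add]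
    ring
  simp only [hexp]
  rw [intervalIntegral.integral_div, intervalIntegral.integral_finsetSum
    (fun k _ => by apply Continuous.intervalIntegrable; fun_prop)]
  have h1 : ∀ k ∈ Finset.Ioc L (2 * L), ∫ t in (0 : ℝ)..1, ∑ l ∈ Finset.Ioc L (2 * L),
      (Real.cos (2 * Real.pi * ((k : ℤ) - l : ℤ) * (a - t))
        + Real.cos (2 * Real.pi * ((k : ℤ) + l : ℤ) * (a - t))) / 2 = 1 / 2 := by
    intro k hk
    rw [intervalIntegral.integral_finsetSum
      (fun l _ => by apply Continuous.intervalIntegrable; fun_prop)]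
    have h2 : ∀ l ∈ Finset.Ioc L (2 * L), ∫ t in (0 : ℝ)..1,
        (Real.cos (2 * Real.pi * ((k : ℤ) - l : ℤ) * (a - t))
        + Real.cos (2 * Real.pi * ((k : ℤ) + l : ℤ) * (a - t))) / 2
        = if k = l then 1 / 2 else 0 := by
      intro l _
      rw [Finset.mem_Ioc] at hk
      rw [intervalIntegral.integral_div, intervalIntegral.integral_add
        (by apply Continuous.intervalIntegrable; fun_prop)
        (by apply Continuous.intervalIntegrable; fun_prop),
        integral_cos_two_pi_mul (by omega : (k : ℤ) + l ≠ 0)]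
      split_ifs with hkl
      · simp [hkl]
      · rw [integral_cos_two_pi_mul (by omega : (k : ℤ) - l ≠ 0)]
        simp
    rw [Finset.sum_congr rfl h2, Finset.sum_ite_eq, if_pos hk]
  rw [Finset.sum_congr rfl h1, Finset.sum_const, Nat.card_Ioc, nsmul_eq_mul]
  have : ((2 * L - L : ℕ) : ℝ) = L := by congr 1; omega
  rw [this]
  field_simp

lemma continuous_avgCos (L : ℕ) : Continuous (avgCos L) := by
  unfold avgCos
  fun_prop

lemma lintegral_avgCos_sq {L : ℕ} (hL : 1 ≤ L) (a : ℝ) :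
    ∫⁻ t in Icc (0 : ℝ) 1, ENNReal.ofReal (avgCos L (a - t) ^ 2)
      = ENNReal.ofReal (1 / (2 * L)) := by
  rw [← integral_avgCos_sq hL a, intervalIntegral.integral_of_le zero_le_one,
    ← integral_Icc_eq_integral_Ioc]
  refine (ofReal_integral_eq_lintegral_ofReal ?_ (ae_of_all _ fun _ => sq_nonneg _)).symm
  have := continuous_avgCos L
  exact (Continuous.integrableOn_Icc (by fun_prop))

/-- A convex combination of trigonometric functions with spread out weights cannot track the
trigonometric functions themselves at all frequencies. -/
lemma le_sum_sq_trig {ι : Type*} [Fintype ι] {I : Finset ℕ} {w : ℕ → ℝ} {q : ι → ℝ}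
    {z : ℕ → ι → ℝ} {t B : ℝ} {L : ℕ} (hL : 1 ≤ L) (hq : ∀ j, 0 ≤ q j) (hq1 : ∑ j, q j = 1)
    (hB : 0 < B) (hw : ∑ i ∈ I, w i ^ 2 ≤ B) :
    L * (3 / 4 - 4 * B * ∑ i ∈ I, ∑ j, q j * avgCos L (z i j - t) ^ 2)
      ≤ ∑ k ∈ Finset.Ioc L (2 * L),
        ((∑ i ∈ I, w i * ∑ j, q j * Real.cos (2 * Real.pi * k * z i j)
            - Real.cos (2 * Real.pi * k * t)) ^ 2
          + (∑ i ∈ I, w i * ∑ j, q j * Real.sin (2 * Real.pi * k * z i j)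
            - Real.sin (2 * Real.pi * k * t)) ^ 2) := by
  have hL0 : (0 : ℝ) < L := by positivity
  have h1 : ∀ k : ℕ, 1 - 2 * ∑ i ∈ I, w i * ∑ j, q j * Real.cos (2 * Real.pi * k * (z i j - t))
      ≤ (∑ i ∈ I, w i * ∑ j, q j * Real.cos (2 * Real.pi * k * z i j)
            - Real.cos (2 * Real.pi * k * t)) ^ 2
          + (∑ i ∈ I, w i * ∑ j, q j * Real.sin (2 * Real.pi * k * z i j)
            - Real.sin (2 * Real.pi * k * t)) ^ 2 := by
    intro k
    set P := ∑ i ∈ I, w i * ∑ j, q j * Real.cos (2 * Real.pi * k * z i j) with hP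
    set Q := ∑ i ∈ I, w i * ∑ j, q j * Real.sin (2 * Real.pi * k * z i j) with hQ
    have h2 : ∑ i ∈ I, w i * ∑ j, q j * Real.cos (2 * Real.pi * k * (z i j - t))
        = P * Real.cos (2 * Real.pi * k * t) + Q * Real.sin (2 * Real.pi * k * t) := by
      rw [hP, hQ, Finset.sum_mul, Finset.sum_mul, ← Finset.sum_add_distrib]
      refine Finset.sum_congr rfl fun i _ => ?_
      rw [mul_assoc (w i), mul_assoc (w i), ← mul_add, Finset.sum_mul, Finset.sum_mul,
        ← Finset.sum_add_distrib]
      congr 1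
      refine Finset.sum_congr rfl fun j _ => ?_
      rw [mul_sub (2 * Real.pi * k), Real.cos_sub]
      ring
    rw [h2]
    -- The two squares add up to `P ^ 2 + Q ^ 2 + 1` minus twice the cross term; the nonnegative `P
    -- ^ 2 + Q ^ 2` is dropped.
    nlinarith [Real.sin_sq_add_cos_sq (2 * Real.pi * k * t), sq_nonneg P, sq_nonneg Q]
  have h3 : ∑ k ∈ Finset.Ioc L (2 * L),
      (1 - 2 * ∑ i ∈ I, w i * ∑ j, q j * Real.cos (2 * Real.pi * k * (z i j - t)))
      = L * (1 - 2 * ∑ i ∈ I, w i * ∑ j, q j * avgCos L (z i j - t)) := by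
    have h4 : ∑ k ∈ Finset.Ioc L (2 * L),
        ∑ i ∈ I, w i * ∑ j, q j * Real.cos (2 * Real.pi * k * (z i j - t))
        = L * ∑ i ∈ I, w i * ∑ j, q j * avgCos L (z i j - t) := by
      rw [Finset.sum_comm, Finset.mul_sum]
      refine Finset.sum_congr rfl fun i _ => ?_
      rw [← Finset.mul_sum, Finset.sum_comm, mul_left_comm, Finset.mul_sum (a := (L : ℝ))]
      congr 1
      refine Finset.sum_congr rfl fun j _ => ?_
      rw [← Finset.mul_sum, avgCos]
      generalize ∑ k ∈ Finset.Ioc L (2 * L), Real.cos (2 * Real.pi * k * (z i j - t)) = T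
      field_simp
    rw [Finset.sum_sub_distrib, ← Finset.mul_sum, h4, Finset.sum_const, Nat.card_Ioc]
    have : 2 * L - L = L := by omega
    rw [this, nsmul_eq_mul]
    ring
  refine le_trans ?_ (Finset.sum_le_sum fun k _ => h1 k)
  rw [h3]
  refine mul_le_mul_of_nonneg_left ?_ hL0.le
  -- Young's inequality balanced so that the squared weights, of total at most `B`, cost only `1 /
  -- 4`; the factor `3 / 4` of the claim remains.
  have h5 : ∀ i ∈ I, 2 * (w i * ∑ j, q j * avgCos L (z i j - t))
      ≤ w i ^ 2 * (1 / (4 * B)) + 4 * B * ∑ j, q j * avgCos L (z i j - t) ^ 2 := by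
    intro i _
    have h6 : w i ^ 2 * (1 / (4 * B)) = ∑ j, q j * (w i ^ 2 * (1 / (4 * B))) := by
      rw [← Finset.sum_mul, hq1, one_mul]
    rw [h6, Finset.mul_sum, Finset.mul_sum, Finset.mul_sum, ← Finset.sum_add_distrib]
    refine Finset.sum_le_sum fun j _ => ?_
    set A := avgCos L (z i j - t)
    have h7 : 2 * (w i * A) ≤ w i ^ 2 * (1 / (4 * B)) + 4 * B * A ^ 2 := by
      have : w i ^ 2 * (1 / (4 * B)) + 4 * B * A ^ 2 - 2 * (w i * A)
          = (w i - 4 * B * A) ^ 2 / (4 * B) := by field_simp; ring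
      have h8 : 0 ≤ (w i - 4 * B * A) ^ 2 / (4 * B) := by positivity
      linarith
    have := mul_le_mul_of_nonneg_left h7 (hq j)
    nlinarith
  have h9 := Finset.sum_le_sum h5
  rw [← Finset.mul_sum, Finset.sum_add_distrib, ← Finset.sum_mul, ← Finset.mul_sum] at h9
  have h10 : (∑ i ∈ I, w i ^ 2) * (1 / (4 * B)) ≤ 1 / 4 := by
    calc _ ≤ B * (1 / (4 * B)) := by gcongr
      _ = 1 / 4 := by field_simp
  linarith

section Oscillation

variable {Ω : Type*} [MeasurableSpace Ω] {μ : Measure Ω} {ε : ℕ → Ω → ℝ} {r : ℕ}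

lemma risk_le_worstRisk (d : Fin (r + 1) → ℝ) (p : ℕ) (K : ℝ → ℝ) (n : ℕ) (y : ℕ → ℝ)
    {β γ C₁ C₂ : ℝ} {g V : ℝ → ℝ} (hg : HolderClass β C₁ C₂ g) (hV : VarianceClass γ C₁ C₂ V)
    (h : ℝ) : risk μ ε d p K n y g V h ≤ worstRisk μ ε d p K n y β γ C₁ C₂ h :=
  le_iSup_of_le g (le_iSup_of_le V (le_iSup_of_le hg (le_iSup_of_le hV le_rfl)))

variable [IsProbabilityMeasure μ]

/-- With zero mean function the expected squared pseudoresidual is exactly an average of `V`. As the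
weights sum to one, the constant `C₂ / 2` cancels and the bias is the amplitude times a tracking
error. -/
lemma sq_oscillation_le_pointRisk (hε : IsErrorSequence μ ε) {d : Fin (r + 1) → ℝ}
    (hd : IsDifferenceSequence d) (p : ℕ) (K : ℝ → ℝ) {n : ℕ} {y : ℕ → ℝ}
    (hy : ∀ i ≤ n, y i ∈ Icc (0 : ℝ) 1) {γ C₁ C₂ ξ s : ℝ} (hγ : 0 < γ) (hC₁ : 0 < C₁)
    (hC₂ : 0 < C₂) (hξ : 1 ≤ ξ) {h t : ℝ}
    (hdet : (gram p y (residualIndices r n) t fun i => K ((t - y i) / h)).det ≠ 0) :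
    (min (C₁ / 2) (C₂ / 2) * ξ ^ (-γ)) ^ 2
        * (∑ i ∈ residualIndices r n, kernelWeight p K h y (residualIndices r n) t i
            * ∑ j, d j ^ 2 * Real.cos (ξ * y (obsIndex r i j) + s) - Real.cos (ξ * t + s)) ^ 2
      ≤ pointRisk μ ε d p K n y (fun _ => 0) (oscillation γ C₁ C₂ ξ s) h t := by
  have hV := varianceClass_oscillation s hγ hC₁ hC₂ hξ
  refine le_trans (le_of_eq ?_)
    (sq_bias_le_mse hε (fun i hi => (mem_residualIndices_bounds hi).1) _ _)
  set I := residualIndices r n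
  set A := min (C₁ / 2) (C₂ / 2) * ξ ^ (-γ) with hA
  have h1 : ∀ i ∈ I, meanSq (residualMean d y fun _ => 0)
      (residualCoeff d y (oscillation γ C₁ C₂ ξ s)) i
      = C₂ / 2 + A * ∑ j, d j ^ 2 * Real.cos (ξ * y (obsIndex r i j) + s) := by
    intro i hi
    rw [meanSq_residual hy _ hV.nonneg hi]
    have h0 : residualMean d y (fun _ => (0 : ℝ)) i = 0 := by simp [residualMean]
    rw [h0]
    simp only [oscillation, mul_add, Finset.sum_add_distrib]
    rw [← Finset.sum_mul, hd.sum_sq_eq_one, Finset.mul_sum]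
    have h2 : ∀ j, d j ^ 2 * (min (C₁ / 2) (C₂ / 2) * ξ ^ (-γ)
        * Real.cos (ξ * y (obsIndex r i j) + s))
        = A * (d j ^ 2 * Real.cos (ξ * y (obsIndex r i j) + s)) := by
      intro j; rw [hA]; ring
    simp only [h2]
    ring
  have h3 : ∑ i ∈ I, kernelWeight p K h y I t i = 1 := sum_lpWeight hdet
  have h4 : ∑ i ∈ I, kernelWeight p K h y I t i * meanSq (residualMean d y fun _ => 0)
      (residualCoeff d y (oscillation γ C₁ C₂ ξ s)) i
      = C₂ / 2 + A * ∑ i ∈ I, kernelWeight p K h y I t i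
        * ∑ j, d j ^ 2 * Real.cos (ξ * y (obsIndex r i j) + s) := by
    rw [Finset.sum_congr rfl fun i hi => by rw [h1 i hi]]
    simp only [mul_add, Finset.sum_add_distrib]
    rw [← Finset.sum_mul, h3, one_mul, Finset.mul_sum]
    congr 1
    exact Finset.sum_congr rfl fun i _ => by ring
  rw [h4]
  simp only [oscillation]
  rw [← hA]
  ring

/-- The bias contribution to the worst-case risk. -/
theorem oscillation_le_worstRisk (hε : IsErrorSequence μ ε) {d : Fin (r + 1) → ℝ}
    (hd : IsDifferenceSequence d) {p : ℕ} {K : ℝ → ℝ} (hK : IsWeight K) {n : ℕ} {y : ℕ → ℝ}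
    (hy : ∀ i ≤ n, y i ∈ Icc (0 : ℝ) 1) {β γ C₁ C₂ : ℝ} (hγ : 0 < γ) (hC₁ : 0 < C₁)
    (hC₂ : 0 < C₂) {h B : ℝ} (hh : 0 < h) (hB : 0 < B)
    (hdet : ∀ t ∈ Icc (0 : ℝ) 1,
      (gram p y (residualIndices r n) t fun i => K ((t - y i) / h)).det ≠ 0)
    (hw : ∀ t ∈ Icc (0 : ℝ) 1, ∑ i ∈ residualIndices r n,
      kernelWeight p K h y (residualIndices r n) t i ^ 2 ≤ B)
    {L : ℕ} (hL : 1 ≤ L) (hLB : 8 * B * n ≤ L) :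
    ENNReal.ofReal ((min (C₁ / 2) (C₂ / 2) * (4 * Real.pi * L) ^ (-γ)) ^ 2 / 4)
      ≤ worstRisk μ ε d p K n y β γ C₁ C₂ h := by
  set I := residualIndices r n with hI
  set κ := (min (C₁ / 2) (C₂ / 2) * (4 * Real.pi * L) ^ (-γ)) ^ 2 with hκ
  have hL0 : (0 : ℝ) < L := by positivity
  have hπ := Real.pi_gt_three
  have hκ0 : 0 ≤ κ := sq_nonneg _
  -- The phases `0` and `-(π / 2)` give the cosine and the sine of each frequency.
  set R : ℕ → ℝ → ℝ → ℝ := fun k s t =>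
    pointRisk μ ε d p K n y (fun _ => 0) (oscillation γ C₁ C₂ (2 * Real.pi * k) s) h t with hR
  have hR0 : ∀ k s t, 0 ≤ R k s t := fun k s t => integral_nonneg fun _ => sq_nonneg _
  have hξ : ∀ k ∈ Finset.Ioc L (2 * L), (1 : ℝ) ≤ 2 * Real.pi * k := by
    intro k hk
    rw [Finset.mem_Ioc] at hk
    have : (1 : ℝ) ≤ k := by exact_mod_cast (by omega : 1 ≤ k)
    nlinarith
  have hamp : ∀ k ∈ Finset.Ioc L (2 * L),
      κ ≤ (min (C₁ / 2) (C₂ / 2) * (2 * Real.pi * k) ^ (-γ)) ^ 2 := by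
    intro k hk
    have h1 := hξ k hk
    rw [Finset.mem_Ioc] at hk
    have h2 : (k : ℝ) ≤ 2 * L := by exact_mod_cast hk.2
    have h3 : (4 * Real.pi * L) ^ (-γ) ≤ (2 * Real.pi * k : ℝ) ^ (-γ) := by
      refine Real.rpow_le_rpow_of_nonpos (by linarith) (by nlinarith) (by linarith)
    have h4 : (0 : ℝ) ≤ (4 * Real.pi * L) ^ (-γ) := by positivity
    rw [hκ]
    gcongr
  set S : ℝ → ℝ := fun t => ∑ i ∈ I, ∑ j, d j ^ 2 * avgCos L (y (obsIndex r i j) - t) ^ 2 with hS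
  have hS0 : ∀ t, 0 ≤ S t := fun t => Finset.sum_nonneg fun i _ => Finset.sum_nonneg fun j _ => by
    positivity
  have hcont := continuous_avgCos L
  have hSm : Measurable fun t => ENNReal.ofReal (S t) := by
    refine Measurable.ennreal_ofReal (Continuous.measurable ?_)
    simp only [hS]
    fun_prop
  -- There are at most `n` indices, the `d j ^ 2` sum to one, and each averaged cosine has squared
  -- norm `1 / (2 * L)`.
  have hSint : ∫⁻ t in Icc (0 : ℝ) 1, ENNReal.ofReal (S t) ≤ ENNReal.ofReal (n / (2 * L)) := by
    have h1 : ∀ t, ENNReal.ofReal (S t) = ∑ i ∈ I, ∑ j, ENNReal.ofReal (d j ^ 2)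
        * ENNReal.ofReal (avgCos L (y (obsIndex r i j) - t) ^ 2) := by
      intro t
      rw [hS, ENNReal.ofReal_sum_of_nonneg fun i _ => Finset.sum_nonneg fun j _ => by positivity]
      refine Finset.sum_congr rfl fun i _ => ?_
      rw [ENNReal.ofReal_sum_of_nonneg fun j _ => by positivity]
      exact Finset.sum_congr rfl fun j _ => ENNReal.ofReal_mul (sq_nonneg _)
    have hm : ∀ i j, Measurable fun t => ENNReal.ofReal (avgCos L (y (obsIndex r i j) - t) ^ 2) :=
      fun i j => Measurable.ennreal_ofReal (Continuous.measurable (by fun_prop))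
    simp only [h1]
    rw [lintegral_finsetSum _ fun i _ => Finset.measurable_fun_sum _ fun j _ =>
      (hm i j).const_mul _]
    have h2 : ∀ i ∈ I, ∫⁻ t in Icc (0 : ℝ) 1, ∑ j, ENNReal.ofReal (d j ^ 2)
        * ENNReal.ofReal (avgCos L (y (obsIndex r i j) - t) ^ 2)
        = ENNReal.ofReal (1 / (2 * L)) := by
      intro i _
      rw [lintegral_finsetSum _ fun j _ => (hm i j).const_mul _]
      have h3 : ∀ j, ∫⁻ t in Icc (0 : ℝ) 1, ENNReal.ofReal (d j ^ 2)
          * ENNReal.ofReal (avgCos L (y (obsIndex r i j) - t) ^ 2)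
          = ENNReal.ofReal (d j ^ 2) * ENNReal.ofReal (1 / (2 * L)) := by
        intro j
        rw [lintegral_const_mul _ (hm i j), lintegral_avgCos_sq hL]
      rw [Finset.sum_congr rfl fun j _ => h3 j, ← Finset.sum_mul,
        ← ENNReal.ofReal_sum_of_nonneg fun j _ => sq_nonneg _, hd.sum_sq_eq_one,
        ENNReal.ofReal_one, one_mul]
    rw [Finset.sum_congr rfl h2, Finset.sum_const, nsmul_eq_mul, ← ENNReal.ofReal_natCast,
      ← ENNReal.ofReal_mul (by positivity)]
    refine ENNReal.ofReal_le_ofReal ?_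
    have : (I.card : ℝ) ≤ n := by exact_mod_cast card_residualIndices_le r n
    rw [mul_one_div]
    gcongr
  have hpt : ∀ t ∈ Icc (0 : ℝ) 1, ENNReal.ofReal (κ * (L * (3 / 4)))
      ≤ ∑ k ∈ Finset.Ioc L (2 * L), (ENNReal.ofReal (R k 0 t)
          + ENNReal.ofReal (R k (-(Real.pi / 2)) t))
        + ENNReal.ofReal (κ * (L * (4 * B))) * ENNReal.ofReal (S t) := by
    intro t ht
    have h1 := le_sum_sq_trig (I := I) (w := kernelWeight p K h y I t) (q := fun j => d j ^ 2)
      (z := fun i j => y (obsIndex r i j)) (t := t) hL (fun j => sq_nonneg _) hd.sum_sq_eq_one hB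
      (hw t ht)
    have h2 : ∀ k ∈ Finset.Ioc L (2 * L), κ *
        ((∑ i ∈ I, kernelWeight p K h y I t i * ∑ j, d j ^ 2
              * Real.cos (2 * Real.pi * k * y (obsIndex r i j))
            - Real.cos (2 * Real.pi * k * t)) ^ 2
          + (∑ i ∈ I, kernelWeight p K h y I t i * ∑ j, d j ^ 2
              * Real.sin (2 * Real.pi * k * y (obsIndex r i j))
            - Real.sin (2 * Real.pi * k * t)) ^ 2)
        ≤ R k 0 t + R k (-(Real.pi / 2)) t := by
      intro k hk
      have e1 := sq_oscillation_le_pointRisk hε hd p K hy hγ hC₁ hC₂ (hξ k hk) (s := 0)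
        (hdet t ht)
      have e2 := sq_oscillation_le_pointRisk hε hd p K hy hγ hC₁ hC₂ (hξ k hk)
        (s := -(Real.pi / 2)) (hdet t ht)
      simp only [add_zero, ← sub_eq_add_neg, Real.cos_sub_pi_div_two] at e1 e2
      rw [mul_add]
      have e3 := hamp k hk
      exact add_le_add ((mul_le_mul_of_nonneg_right e3 (sq_nonneg _)).trans e1)
        ((mul_le_mul_of_nonneg_right e3 (sq_nonneg _)).trans e2)
    have h3 := (mul_le_mul_of_nonneg_left h1 hκ0).trans
      ((Finset.mul_sum _ _ _).le.trans (Finset.sum_le_sum h2))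
    have h4 : ∑ k ∈ Finset.Ioc L (2 * L), (ENNReal.ofReal (R k 0 t)
          + ENNReal.ofReal (R k (-(Real.pi / 2)) t))
        = ENNReal.ofReal (∑ k ∈ Finset.Ioc L (2 * L), (R k 0 t + R k (-(Real.pi / 2)) t)) := by
      rw [ENNReal.ofReal_sum_of_nonneg fun k _ => add_nonneg (hR0 _ _ _) (hR0 _ _ _)]
      exact Finset.sum_congr rfl fun k _ => (ENNReal.ofReal_add (hR0 _ _ _) (hR0 _ _ _)).symm
    have hS0t := hS0 t
    rw [h4, ← ENNReal.ofReal_mul (by positivity), ← ENNReal.ofReal_add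
      (Finset.sum_nonneg fun k _ => add_nonneg (hR0 _ _ _) (hR0 _ _ _)) (by positivity)]
    refine ENNReal.ofReal_le_ofReal ?_
    change κ * (L * (3 / 4 - 4 * B * S t)) ≤ _ at h3
    linarith
  have hint := setLIntegral_mono' (μ := volume) measurableSet_Icc hpt
  have hKm : AEMeasurable K volume := hK.integrable.aestronglyMeasurable.aemeasurable
  have hVk : ∀ k ∈ Finset.Ioc L (2 * L), ∀ s,
      VarianceClass γ C₁ C₂ (oscillation γ C₁ C₂ (2 * Real.pi * k) s) :=
    fun k hk s => varianceClass_oscillation s hγ hC₁ hC₂ (hξ k hk)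
  have hRm : ∀ k ∈ Finset.Ioc L (2 * L), ∀ s,
      AEMeasurable (fun t => ENNReal.ofReal (R k s t)) (volume.restrict (Icc 0 1)) :=
    fun k hk s => (aemeasurable_pointRisk hε d p hKm n y _
      (hVk k hk s).holderClass.continuousOn hh.ne').ennreal_ofReal
  set W := worstRisk μ ε d p K n y β γ C₁ C₂ h with hW
  have hRW : ∀ k ∈ Finset.Ioc L (2 * L), ∀ s,
      ∫⁻ t in Icc (0 : ℝ) 1, ENNReal.ofReal (R k s t) ≤ W := by
    intro k hk s
    have h1 := risk_le_worstRisk (μ := μ) (ε := ε) d p K n y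
      (holderClass_const (γ := β) (c := 0) hC₁.le (by simpa using hC₂.le)) (hVk k hk s) h
    rwa [risk_eq_lintegral hε d p hK n y _ (hVk k hk s).holderClass.continuousOn hh.ne'] at h1
  have hsumm : ∀ k ∈ Finset.Ioc L (2 * L), AEMeasurable
      (fun t => ENNReal.ofReal (R k 0 t) + ENNReal.ofReal (R k (-(Real.pi / 2)) t))
      (volume.restrict (Icc 0 1)) := fun k hk => (hRm k hk _).add (hRm k hk _)
  rw [lintegral_add_right _ (hSm.const_mul _), lintegral_const_mul _ hSm,
    lintegral_finsetSum' _ hsumm, setLIntegral_const,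
    Real.volume_Icc] at hint
  simp only [sub_zero, ENNReal.ofReal_one, mul_one] at hint
  have hsumW : ∑ k ∈ Finset.Ioc L (2 * L), ∫⁻ t in Icc (0 : ℝ) 1,
      (ENNReal.ofReal (R k 0 t) + ENNReal.ofReal (R k (-(Real.pi / 2)) t))
      ≤ ENNReal.ofReal (2 * L) * W := by
    have h1 : ∀ k ∈ Finset.Ioc L (2 * L), ∫⁻ t in Icc (0 : ℝ) 1,
        (ENNReal.ofReal (R k 0 t) + ENNReal.ofReal (R k (-(Real.pi / 2)) t)) ≤ 2 * W := by
      intro k hk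
      rw [lintegral_add_left' (hRm k hk _), two_mul]
      exact add_le_add (hRW k hk _) (hRW k hk _)
    refine (Finset.sum_le_sum h1).trans (le_of_eq ?_)
    rw [Finset.sum_const, Nat.card_Ioc, nsmul_eq_mul, (by omega : 2 * L - L = L), mul_comm 2 (L : ℝ),
      ENNReal.ofReal_mul hL0.le, ENNReal.ofReal_natCast, ENNReal.ofReal_ofNat, mul_assoc]
  -- The condition `8 * B * n ≤ L` limits this term to `κ * L / 4`. Of `3 * κ * L / 4` there remains
  -- `κ * L / 2`, shared by `2 * L` risks, which gives `κ / 4`.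
  have hrest : ENNReal.ofReal (κ * (L * (4 * B))) * ∫⁻ t in Icc (0 : ℝ) 1, ENNReal.ofReal (S t)
      ≤ ENNReal.ofReal (κ * (L / 4)) := by
    calc _ ≤ ENNReal.ofReal (κ * (L * (4 * B))) * ENNReal.ofReal (n / (2 * L)) := by gcongr
      _ = ENNReal.ofReal (κ * (2 * B * n)) := by
        rw [← ENNReal.ofReal_mul (by positivity)]
        congr 1
        field_simp
        ring
      _ ≤ _ := by
        refine ENNReal.ofReal_le_ofReal ?_
        gcongr
        linarith
  have h5 := hint.trans (add_le_add hsumW hrest)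
  have h6 : ENNReal.ofReal (κ * (L * (3 / 4)))
      = ENNReal.ofReal (2 * L) * ENNReal.ofReal (κ / 4) + ENNReal.ofReal (κ * (L / 4)) := by
    rw [← ENNReal.ofReal_mul (by positivity), ← ENNReal.ofReal_add (by positivity) (by positivity)]
    congr 1
    ring
  rw [h6, ENNReal.add_le_add_iff_right ENNReal.ofReal_ne_top,
    ENNReal.mul_le_mul_iff_right (by simpa using hL0.ne') ENNReal.ofReal_ne_top] at h5
  exact h5

end Oscillation

/-! ### Continuity of dilations and lower semicontinuity of the risk in the bandwidth. -/

section Dilation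

set_option linter.unusedSectionVars false

variable {E : Type*} [NormedAddCommGroup E] [NormedSpace ℝ E]

lemma tendsto_integral_dilation_of_continuous {g : ℝ → E} (hg : Continuous g)
    (hgc : HasCompactSupport g) {hs : ℕ → ℝ} {h₀ : ℝ} (h0 : 0 < h₀)
    (hlim : Tendsto hs atTop (nhds h₀)) :
    Tendsto (fun k => ∫ u, ‖g (u / hs k) - g (u / h₀)‖) atTop (nhds 0) := by
  obtain ⟨C, hC⟩ := hgc.exists_bound_of_continuous hg
  obtain ⟨R, hR, hgR⟩ := hgc.exists_pos_le_norm
  have hC0 : 0 ≤ C := (norm_nonneg _).trans (hC 0)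
  have hev : ∀ᶠ k in atTop, 0 < hs k ∧ hs k ≤ 2 * h₀ :=
    ((hlim.eventually (lt_mem_nhds h0)).and
      (hlim.eventually (gt_mem_nhds (by linarith : h₀ < 2 * h₀)))).mono fun k hk => ⟨hk.1, hk.2.le⟩
  have hzero : ∀ h : ℝ, 0 < h → h ≤ 2 * h₀ → ∀ u, 2 * h₀ * R < |u| → g (u / h) = 0 := by
    intro h hh hh2 u hu
    refine hgR _ ?_
    rw [Real.norm_eq_abs, abs_div, abs_of_pos hh, le_div_iff₀ hh]
    nlinarith
  have hmain := tendsto_integral_filter_of_dominated_convergence (μ := volume) (l := atTop)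
    (F := fun k u => ‖g (u / hs k) - g (u / h₀)‖) (f := fun _ => (0 : ℝ))
    ((Icc (-(2 * h₀ * R)) (2 * h₀ * R)).indicator fun _ => 2 * C)
    (Eventually.of_forall fun k => (Continuous.aestronglyMeasurable (by fun_prop)))
    (hev.mono fun k hk => ae_of_all _ fun u => ?_)
    ((integrable_indicator_iff measurableSet_Icc).2
      (integrableOn_const (by rw [Real.volume_Icc]; exact ENNReal.ofReal_ne_top)))
    (ae_of_all _ fun u => ?_)
  · simpa using hmain
  · rw [norm_norm]
    by_cases hu : u ∈ Icc (-(2 * h₀ * R)) (2 * h₀ * R)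
    · rw [indicator_of_mem hu]
      have := norm_sub_le (g (u / hs k)) (g (u / h₀))
      linarith [hC (u / hs k), hC (u / h₀)]
    · have hu' : 2 * h₀ * R < |u| := by
        by_contra! hle
        exact hu (abs_le.1 hle)
      rw [indicator_of_notMem hu, hzero _ hk.1 hk.2 u hu', hzero _ h0 (by linarith) u hu']
      simp
  · have h1 : Tendsto (fun k => u / hs k) atTop (nhds (u / h₀)) :=
      tendsto_const_nhds.div hlim h0.ne'
    have h2 := ((hg.tendsto _).comp h1).sub_const (g (u / h₀))
    simpa using h2.norm

/-- Dilations act continuously on integrable functions. -/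
lemma tendsto_integral_dilation {f : ℝ → E} (hf : Integrable f) {hs : ℕ → ℝ} {h₀ : ℝ}
    (h0 : 0 < h₀) (hpos : ∀ k, 0 < hs k) (hlim : Tendsto hs atTop (nhds h₀)) :
    Tendsto (fun k => ∫ u, ‖f (u / hs k) - f (u / h₀)‖) atTop (nhds 0) := by
  rw [Metric.tendsto_atTop]
  intro η hη
  -- Dilation by `h ≤ 2 * h₀` multiplies the L¹ norm by `h`, so this accuracy becomes `η / 4` after
  -- dilation.
  obtain ⟨g, hgc, hfg, hg, hgi⟩ := hf.exists_hasCompactSupport_integral_sub_le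
    (ε := η / (8 * h₀)) (by positivity)
  have hg0 := tendsto_integral_dilation_of_continuous hg hgc h0 hlim
  obtain ⟨N, hN⟩ := eventually_atTop.1 ((hg0.eventually (gt_mem_nhds (by positivity : 0 < η / 4))).and
    (hlim.eventually (gt_mem_nhds (by linarith : h₀ < 2 * h₀))))
  refine ⟨N, fun k hk => ?_⟩
  obtain ⟨h1, h2⟩ := hN k hk
  have hscale : ∀ h : ℝ, 0 < h → h ≤ 2 * h₀ → ∫ u, ‖f (u / h) - g (u / h)‖ ≤ η / 4 := by
    intro h hh hh2
    rw [Measure.integral_comp_div (fun u => ‖f u - g u‖) h, abs_of_pos hh, smul_eq_mul]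
    calc _ ≤ 2 * h₀ * (η / (8 * h₀)) :=
          mul_le_mul hh2 hfg (integral_nonneg fun _ => norm_nonneg _) (by positivity)
      _ = η / 4 := by field_simp; ring
  have i1 : ∀ h : ℝ, 0 < h → Integrable fun u => f (u / h) := fun h hh => hf.comp_div hh.ne'
  have i2 : ∀ h : ℝ, 0 < h → Integrable fun u => g (u / h) := fun h hh => hgi.comp_div hh.ne'
  have i3 : ∀ h : ℝ, 0 < h → Integrable fun u => ‖f (u / h) - g (u / h)‖ := fun h hh =>
    ((i1 h hh).sub (i2 h hh)).norm
  have i4 : Integrable fun u => ‖g (u / hs k) - g (u / h₀)‖ :=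
    ((i2 _ (hpos k)).sub (i2 _ h0)).norm
  have hle : ∫ u, ‖f (u / hs k) - f (u / h₀)‖ ≤ ∫ u, (‖f (u / hs k) - g (u / hs k)‖
      + ‖g (u / hs k) - g (u / h₀)‖ + ‖f (u / h₀) - g (u / h₀)‖) := by
    refine integral_mono ((i1 _ (hpos k)).sub (i1 _ h0)).norm
      (((i3 _ (hpos k)).add i4).add (i3 _ h0)) fun u => ?_
    have e1 : f (u / hs k) - f (u / h₀) = (f (u / hs k) - g (u / hs k))
      + (g (u / hs k) - g (u / h₀)) - (f (u / h₀) - g (u / h₀)) := by abel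
    show ‖f (u / hs k) - f (u / h₀)‖ ≤ _
    rw [e1]
    exact (norm_sub_le _ _).trans (add_le_add (norm_add_le _ _) le_rfl)
  have i5 : Integrable fun u => ‖f (u / hs k) - g (u / hs k)‖ + ‖g (u / hs k) - g (u / h₀)‖ :=
    (i3 _ (hpos k)).add i4
  rw [integral_add i5 (i3 _ h0), integral_add (i3 _ (hpos k)) i4] at hle
  have e2 := hscale _ (hpos k) h2.le
  have e3 := hscale _ h0 (by linarith)
  rw [Real.dist_eq, sub_zero, abs_of_nonneg (integral_nonneg fun _ => norm_nonneg _)]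
  linarith

/-- Along a subsequence, dilations converge almost everywhere. -/
lemma exists_seq_tendsto_ae_dilation {f : ℝ → E} (hf : Integrable f) {hs : ℕ → ℝ} {h₀ : ℝ}
    (h0 : 0 < h₀) (hpos : ∀ k, 0 < hs k) (hlim : Tendsto hs atTop (nhds h₀)) :
    ∃ ns : ℕ → ℕ, StrictMono ns ∧
      ∀ᵐ u, Tendsto (fun k => f (u / hs (ns k))) atTop (nhds (f (u / h₀))) := by
  have i1 : ∀ h : ℝ, 0 < h → Integrable fun u => f (u / h) := fun h hh => hf.comp_div hh.ne'
  refine TendstoInMeasure.exists_seq_tendsto_ae (f := fun k u => f (u / hs k))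
    (g := fun u => f (u / h₀)) ?_
  refine tendstoInMeasure_of_tendsto_eLpNorm (p := 1) one_ne_zero
    (fun k => (i1 _ (hpos k)).aestronglyMeasurable) (i1 _ h0).aestronglyMeasurable ?_
  have h1 : ∀ k, eLpNorm ((fun u => f (u / hs k)) - fun u => f (u / h₀)) 1 volume
      = ENNReal.ofReal (∫ u, ‖f (u / hs k) - f (u / h₀)‖) := by
    intro k
    rw [eLpNorm_one_eq_lintegral_enorm]
    exact (ofReal_integral_norm_eq_lintegral_enorm ((i1 _ (hpos k)).sub (i1 _ h0))).symm
  simp only [h1]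
  have := ENNReal.tendsto_ofReal (tendsto_integral_dilation hf h0 hpos hlim)
  rwa [ENNReal.ofReal_zero] at this

end Dilation

/-- The effective weights are continuous in the kernel values as long as the support does not
change. -/
lemma tendsto_lpWeight {p : ℕ} {y : ℕ → ℝ} {I : Finset ℕ} {t : ℝ} {ks : ℕ → ℕ → ℝ} {k : ℕ → ℝ}
    (hks : ∀ j i, 0 ≤ ks j i) (hk : ∀ i, 0 ≤ k i)
    (hlim : ∀ i, Tendsto (fun j => ks j i) atTop (nhds (k i)))
    (hsupp : ∀ i, ∀ᶠ j in atTop, (ks j i = 0 ↔ k i = 0)) (i : ℕ) :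
    Tendsto (fun j => lpWeight p y I t (ks j) i) atTop (nhds (lpWeight p y I t k i)) := by
  by_cases hdet : (gram p y I t k).det = 0
  -- A singular Gram matrix in the limit is singular along the sequence from some index on, because
  -- the supports agree; all weights are then zero. In the other case matrix inversion is
  -- continuous.
  · have hev : ∀ᶠ j in atTop, ∀ i ∈ I, (ks j i = 0 ↔ k i = 0) :=
      (Finset.eventually_all I).2 fun i _ => hsupp i
    refine tendsto_const_nhds.congr' (hev.mono fun j hj => ?_)
    show lpWeight p y I t k i = lpWeight p y I t (ks j) i
    rw [lpWeight_eq_zero_of_det hdet, lpWeight_eq_zero_of_det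
      ((gram_det_eq_zero_iff_of_support (hks j) hk hj).2 hdet)]
  · have hg : Continuous fun q : ℕ → ℝ => gram p y I t q := by
      refine continuous_matrix fun a b => ?_
      simp only [gram, Matrix.of_apply]
      fun_prop
    have hkt : Tendsto ks atTop (nhds k) := tendsto_pi_nhds.2 hlim
    have hinv : Tendsto (fun j => (gram p y I t (ks j)).det⁻¹) atTop
        (nhds (gram p y I t k).det⁻¹) :=
      ((hg.matrix_det.tendsto k).comp hkt).inv₀ hdet
    have hadj : ∀ l, Tendsto (fun j => (gram p y I t (ks j)).adjugate 0 l) atTop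
        (nhds ((gram p y I t k).adjugate 0 l)) :=
      fun l => ((hg.matrix_adjugate.matrix_elem 0 l).tendsto k).comp hkt
    simp only [lpWeight, Matrix.inv_def, Ring.inverse_eq_inv', Matrix.smul_apply, smul_eq_mul]
    exact (hlim i).mul (tendsto_finsetSum _ fun l _ => (hinv.mul (hadj l)).mul_const _)

/-- The dilation result is applied to `K` paired with the indicator of its nonzero set. Convergence
of a function with values `0` and `1` means eventual equality, so the supports stabilize even though
`K` need not be continuous. -/
lemma IsWeight.exists_seq_tendsto_ae {K : ℝ → ℝ} (hK : IsWeight K) {hs : ℕ → ℝ} {h₀ : ℝ}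
    (h0 : 0 < h₀) (hpos : ∀ k, 0 < hs k) (hlim : Tendsto hs atTop (nhds h₀)) :
    ∃ ns : ℕ → ℕ, StrictMono ns ∧
      ∀ᵐ u, Tendsto (fun k => K (u / hs (ns k))) atTop (nhds (K (u / h₀))) ∧
        ∀ᶠ k in atTop, (K (u / hs (ns k)) = 0 ↔ K (u / h₀) = 0) := by
  classical
  set φ : ℝ → ℝ := fun z => if z = 0 then 0 else 1 with hφ
  have hφm : Measurable φ := Measurable.ite (measurableSet_singleton 0) measurable_const
    measurable_const
  have hint : Integrable fun u => φ (K u) := by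
    have hdom : Integrable ((Icc (-1 : ℝ) 1).indicator fun _ => (1 : ℝ)) :=
      (integrable_indicator_iff measurableSet_Icc).2
        (integrableOn_const (by rw [Real.volume_Icc]; exact ENNReal.ofReal_ne_top))
    refine hdom.mono' (hφm.comp_aemeasurable
      hK.integrable.aestronglyMeasurable.aemeasurable).aestronglyMeasurable
      (ae_of_all _ fun u => ?_)
    by_cases hu : u ∈ Icc (-1 : ℝ) 1
    · rw [indicator_of_mem hu]
      simp only [hφ]
      split_ifs <;> simp
    · have : K u = 0 := hK.support u (by
        by_contra! hle
        exact hu (abs_le.1 hle))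
      rw [indicator_of_notMem hu, this]
      simp [hφ]
  obtain ⟨ns, hns, hae⟩ := exists_seq_tendsto_ae_dilation (hK.integrable.prodMk hint) h0 hpos hlim
  refine ⟨ns, hns, hae.mono fun u hu => ?_⟩
  have h1 := (continuous_fst.tendsto _).comp hu
  have h2 := (continuous_snd.tendsto _).comp hu
  refine ⟨h1, ?_⟩
  have h3 := (Metric.tendsto_nhds.1 h2) 1 one_pos
  refine h3.mono fun k hk => ?_
  simp only [Function.comp_apply, hφ, Real.dist_eq] at hk
  by_cases ha : K (u / hs (ns k)) = 0 <;> by_cases hb : K (u / h₀) = 0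
  · simp [ha, hb]
  · simp [ha, hb] at hk
  · simp [ha, hb] at hk
  · simp [ha, hb]

section Semicontinuity

variable {Ω : Type*} [MeasurableSpace Ω] {μ : Measure Ω} [IsProbabilityMeasure μ]
  {ε : ℕ → Ω → ℝ} {r : ℕ}

/-- The risk of a fixed pair is lower semicontinuous in the bandwidth. -/
theorem lowerSemicontinuousAt_risk (hε : IsErrorSequence μ ε) (d : Fin (r + 1) → ℝ) (p : ℕ)
    {K : ℝ → ℝ} (hK : IsWeight K) (n : ℕ) (y : ℕ → ℝ) (g : ℝ → ℝ) {V : ℝ → ℝ}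
    (hV : ContinuousOn V (Icc 0 1)) {h₀ : ℝ} (h0 : 0 < h₀) :
    LowerSemicontinuousAt (fun h => risk μ ε d p K n y g V h) h₀ := by
  intro c hc
  by_contra hcon
  -- A failure of semicontinuity gives bandwidths tending to `h₀` with risk at most `c`. Along a
  -- subsequence the pointwise risks converge for almost every t, and Fatou's lemma gives a
  -- contradiction.
  have hfreq : ∃ᶠ h in nhds h₀, 0 < h ∧ risk μ ε d p K n y g V h ≤ c := by
    refine ((not_eventually.1 hcon).and_eventually (lt_mem_nhds h0)).mono fun h hh => ?_
    exact ⟨hh.2, not_lt.1 hh.1⟩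
  obtain ⟨hs, hlim, hhs⟩ := exists_seq_forall_of_frequently hfreq
  obtain ⟨ns, hns, hae⟩ := hK.exists_seq_tendsto_ae h0 (fun k => (hhs k).1) hlim
  have hae2 : ∀ᵐ t : ℝ, ∀ i : ℕ,
      Tendsto (fun k => K ((t - y i) / hs (ns k))) atTop (nhds (K ((t - y i) / h₀))) ∧
        ∀ᶠ k in atTop, (K ((t - y i) / hs (ns k)) = 0 ↔ K ((t - y i) / h₀) = 0) :=
    ae_all_iff.2 fun i => (measurePreserving_sub_right volume (y i)).quasiMeasurePreserving.ae hae
  have hpt : ∀ᵐ t ∂(volume.restrict (Icc (0 : ℝ) 1)),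
      Tendsto (fun k => ENNReal.ofReal (pointRisk μ ε d p K n y g V (hs (ns k)) t)) atTop
        (nhds (ENNReal.ofReal (pointRisk μ ε d p K n y g V h₀ t))) := by
    refine ae_restrict_of_ae (hae2.mono fun t ht => ENNReal.tendsto_ofReal ?_)
    have hw : Tendsto (fun k => kernelWeight p K (hs (ns k)) y (residualIndices r n) t) atTop
        (nhds (kernelWeight p K h₀ y (residualIndices r n) t)) :=
      tendsto_pi_nhds.2 fun i => tendsto_lpWeight
        (ks := fun j i => K ((t - y i) / hs (ns j))) (fun j i => hK.nonneg _)
        (fun i => hK.nonneg _) (fun i => (ht i).1) (fun i => (ht i).2) i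
    have hm := ((continuous_mse (I := residualIndices r n) (m := residualMean d y g)
      (c := residualCoeff d y V) hε).tendsto
      (kernelWeight p K h₀ y (residualIndices r n) t, V t)).comp
      (hw.prodMk_nhds (tendsto_const_nhds (x := V t)))
    simp only [pointRisk]
    exact hm.congr fun k => rfl
  have hKm : AEMeasurable K volume := hK.integrable.aestronglyMeasurable.aemeasurable
  have hfatou := lintegral_liminf_le' (μ := volume.restrict (Icc (0 : ℝ) 1)) (u := atTop)
    (f := fun k t => ENNReal.ofReal (pointRisk μ ε d p K n y g V (hs (ns k)) t))
    (fun k => (aemeasurable_pointRisk hε d p hKm n y g hV (hhs (ns k)).1.ne').ennreal_ofReal)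
  have hlhs : ∫⁻ t in Icc (0 : ℝ) 1, liminf (fun k => ENNReal.ofReal
      (pointRisk μ ε d p K n y g V (hs (ns k)) t)) atTop = risk μ ε d p K n y g V h₀ := by
    rw [risk_eq_lintegral hε d p hK n y g hV h0.ne']
    exact lintegral_congr_ae (hpt.mono fun t ht => ht.liminf_eq)
  rw [hlhs] at hfatou
  simp only [← risk_eq_lintegral hε d p hK n y g hV (hhs _).1.ne'] at hfatou
  have hle : liminf (fun k => risk μ ε d p K n y g V (hs (ns k))) atTop ≤ c :=
    (liminf_le_liminf (Eventually.of_forall fun k => (hhs (ns k)).2)).trans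
      (liminf_const c).le
  exact absurd (hfatou.trans hle) (not_le.2 hc)

theorem lowerSemicontinuousAt_worstRisk (hε : IsErrorSequence μ ε) (d : Fin (r + 1) → ℝ) (p : ℕ)
    {K : ℝ → ℝ} (hK : IsWeight K) (n : ℕ) (y : ℕ → ℝ) (β γ C₁ C₂ : ℝ) {h₀ : ℝ} (h0 : 0 < h₀) :
    LowerSemicontinuousAt (fun h => worstRisk μ ε d p K n y β γ C₁ C₂ h) h₀ := by
  refine lowerSemicontinuousAt_iSup fun g => lowerSemicontinuousAt_iSup fun V =>
    lowerSemicontinuousAt_iSup fun _ => lowerSemicontinuousAt_iSup fun hV => ?_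
  exact lowerSemicontinuousAt_risk hε d p hK n y g hV.holderClass.continuousOn h0

end Semicontinuity

/-! ### Rates and assembly of the bounds. -/

lemma eventually_rpow_le {e e' : ℝ} (he : e' < e) (A : ℝ) {b : ℝ} (hb : 0 < b) :
    ∀ᶠ n : ℕ in atTop, A * (n : ℝ) ^ (-e) ≤ b * (n : ℝ) ^ (-e') := by
  have h1 : Tendsto (fun n : ℕ => A * (n : ℝ) ^ (-(e - e'))) atTop (nhds (A * 0)) :=
    ((tendsto_rpow_neg_atTop (sub_pos.2 he)).comp tendsto_natCast_atTop_atTop).const_mul A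
  rw [mul_zero] at h1
  filter_upwards [h1.eventually (gt_mem_nhds hb), eventually_ge_atTop 1] with n hn hn1
  have hn0 : (0 : ℝ) < n := by exact_mod_cast hn1
  have h2 : (n : ℝ) ^ (-e) = (n : ℝ) ^ (-(e - e')) * (n : ℝ) ^ (-e') := by
    rw [← Real.rpow_add hn0]; congr 1; ring
  rw [h2, ← mul_assoc]
  exact mul_le_mul_of_nonneg_right hn.le (by positivity)

/-- Any bandwidth at least of order n^(-s) with s < 1 exceeds the mesh by as large a factor as
desired; `min h 1` makes this uniform over arbitrarily large bandwidths. -/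
lemma eventually_div_le_min {s : ℝ} (hs1 : s < 1) (T : ℝ) {τ a : ℝ} (hτ : 0 < τ) (ha : 0 < a) :
    ∀ᶠ n : ℕ in atTop, ∀ h : ℝ, a * (n : ℝ) ^ (-s) ≤ h → T / n ≤ τ * min h 1 := by
  filter_upwards [eventually_rpow_le hs1 T (mul_pos hτ ha),
    eventually_rpow_le (one_pos : (0 : ℝ) < 1) T hτ, eventually_ge_atTop 1] with n h1 h2 hn1 h hh
  have hn0 : (0 : ℝ) < n := by exact_mod_cast hn1
  rw [Real.rpow_neg_one, ← div_eq_mul_inv] at h1 h2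
  rw [neg_zero, Real.rpow_zero] at h2
  rcases min_choice h 1 with hm | hm <;> rw [hm]
  · refine h1.trans ?_
    rw [mul_assoc]
    gcongr
  · exact h2

section Main

variable {Ω : Type*} [MeasurableSpace Ω] {μ : Measure Ω} [IsProbabilityMeasure μ]
  {ε : ℕ → Ω → ℝ} {r : ℕ} {d : Fin (r + 1) → ℝ} {K : ℝ → ℝ} {M c τ D : ℝ} {x : ℕ → ℕ → ℝ}
  {γ C₁ C₂ : ℝ} {p : ℕ}

lemma exponent_facts (hγ : 0 < γ) :
    0 < 1 / (2 * γ + 1) ∧ 1 / (2 * γ + 1) < 1 ∧ 0 < 2 * γ / (2 * γ + 1) ∧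
      1 - 1 / (2 * γ + 1) = 2 * γ / (2 * γ + 1) ∧
      1 / (2 * γ + 1) * (2 * γ) = 2 * γ / (2 * γ + 1) := by
  refine ⟨by positivity, ?_, by positivity, ?_, ?_⟩
  · rw [div_lt_one (by positivity)]; linarith
  · field_simp; ring
  · field_simp

lemma WeightBounds.christoffelConst_pos (hK : WeightBounds K M c τ) (p : ℕ) :
    0 < christoffelConst p M c τ := by
  have h1 := hK.c_pos
  have h2 := hK.τ_pos
  have h3 : 0 < M := h1.trans_le ((hK.ge 0 (by simpa using h2.le)).trans (hK.le 0))
  unfold christoffelConst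
  positivity

lemma exists_risk_le (hε : IsErrorSequence μ ε) (hd : IsDifferenceSequence d) (hKw : IsWeight K)
    (hK : WeightBounds K M c τ) (hD : 0 < D) (hx : ∀ n : ℕ, 1 ≤ n → HasMesh (x n) n (D / n))
    (hC₁ : 0 < C₁) (hC₂ : 0 < C₂) (hγ : 0 < γ) (hp : strictFloor γ < p) {a a' : ℝ} (ha : 0 < a)
    (haa : a ≤ a') :
    ∃ B : ℝ, 0 < B ∧ ∀ β : ℝ, γ / (4 * γ + 2) < β → ∀ᶠ n : ℕ in atTop, ∀ h : ℝ,
      a * (n : ℝ) ^ (-(1 / (2 * γ + 1))) ≤ h → h ≤ a' * (n : ℝ) ^ (-(1 / (2 * γ + 1))) →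
      ∀ g V : ℝ → ℝ, HolderClass β C₁ C₂ g → VarianceClass γ C₁ C₂ V →
        risk μ ε d p K n (x n) g V h
          ≤ ENNReal.ofReal (B * (n : ℝ) ^ (-(2 * γ / (2 * γ + 1)))) := by
  obtain ⟨hs0, hs1, he0, hse, hse2⟩ := exponent_facts hγ
  set s := 1 / (2 * γ + 1) with hs
  set e := 2 * γ / (2 * γ + 1) with he
  have hcc := hK.christoffelConst_pos p
  set cc := christoffelConst p M c τ with hccdef
  set Q := fourthMomentBound μ ε r C₂ with hQ
  have ha' : 0 < a' := ha.trans_le haa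
  have hQ0 : 0 < Q := by
    have : 0 ≤ ∫ ω, ε 0 ω ^ 4 ∂μ := integral_nonneg fun ω => by positivity
    rw [hQ, fourthMomentBound]; positivity
  refine ⟨2 * cc * D * (1 + C₁) ^ 2 * a' ^ (2 * γ) + (2 * r + 1) * Q * cc * D / a,
    by positivity, fun β hβ => ?_⟩
  have hβ0 : 0 < β := (by positivity : 0 < γ / (4 * γ + 2)).trans hβ
  set L := C₁ + 6 * C₂ with hL
  have hθ : 0 < min β 1 := by positivity
  -- This is where the threshold on β enters: the squared contribution of `g`, of order n^(-2
  -- min(β,1)), must be smaller than h^γ, of order n^(-γ/(2γ+1)).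
  have hexp1 : s * γ < min β 1 * 2 := by
    have e1 : s * γ = γ / (4 * γ + 2) * 2 := by rw [hs]; field_simp; ring
    have e2 : γ / (4 * γ + 2) < 1 := by rw [div_lt_one (by positivity)]; linarith
    rw [e1]
    have := lt_min hβ e2
    linarith
  have hexp2 : s * γ < min γ 1 := by
    refine lt_min ?_ ?_
    · nlinarith
    · have : s * γ * 2 = e := by rw [← hse2]; ring
      linarith
  -- The contributions of `g` and of the increments of `V` are each at most half of a lower bound
  -- for `h ^ γ`. Their constants are absorbed into how large `n` must be, so `B` does not depend on
  -- β.
  filter_upwards [eventually_div_le_min hs1 (4 * (p + 1) * (r + 2) * D) hK.τ_pos ha,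
    eventually_ge_atTop 1, eventually_ge_atTop r,
    eventually_rpow_le hs0 a' one_pos,
    eventually_rpow_le hθ ((r + 1) * (L * (r * D) ^ min β 1)) one_pos,
    eventually_rpow_le hexp1 (((r + 1) * (L * (r * D) ^ min β 1)) ^ 2)
      (by positivity : 0 < a ^ γ / 2),
    eventually_rpow_le hexp2 (L * (r * D) ^ min γ 1) (by positivity : 0 < a ^ γ / 2)]
    with n hmesh hn1 hnr hsmall hm1 hb1 hb2 h hlo hhi g V hg hV
  have hn0 : (0 : ℝ) < n := by exact_mod_cast hn1
  have H := hx n hn1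
  have hns : (0 : ℝ) < (n : ℝ) ^ (-s) := by positivity
  have hh : 0 < h := (by positivity : 0 < a * (n : ℝ) ^ (-s)).trans_le hlo
  have hh1 : h ≤ 1 := by
    rw [neg_zero, Real.rpow_zero, mul_one] at hsmall
    exact hhi.trans hsmall
  have hmin : min h 1 = h := min_eq_left hh1
  have hδ : 4 * (p + 1) * (r + 2) * (D / n) ≤ τ * h := by
    have := hmesh h hlo
    rw [hmin] at this
    rwa [← mul_div_assoc]
  have hpowdiv : ∀ θ : ℝ, (r * (D / n)) ^ θ = (r * D) ^ θ * (n : ℝ) ^ (-θ) := by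
    intro θ
    rw [← mul_div_assoc, Real.div_rpow (by positivity) hn0.le, Real.rpow_neg hn0.le,
      div_eq_mul_inv]
  have hmean : ∀ i ∈ residualIndices r n,
      |residualMean d (x n) g i| ≤ (r + 1) * (L * (r * D) ^ min β 1) * (n : ℝ) ^ (-min β 1) := by
    intro i hi
    refine (H.abs_residualMean_le hd hβ0 hC₁.le hC₂.le hg hi).trans (le_of_eq ?_)
    rw [hpowdiv]; ring
  have hhγ : a ^ γ * (n : ℝ) ^ (-(s * γ)) ≤ h ^ γ := by
    have e1 : a ^ γ * (n : ℝ) ^ (-(s * γ)) = (a * (n : ℝ) ^ (-s)) ^ γ := by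
      rw [Real.mul_rpow ha.le hns.le, ← Real.rpow_mul hn0.le, neg_mul]
    rw [e1]
    gcongr
  have hE : ∀ i ∈ residualIndices r n,
      |meanSq (residualMean d (x n) g) (residualCoeff d (x n) V) i - V (x n i)| ≤ h ^ γ := by
    intro i hi
    refine (H.abs_meanSq_sub_le hd hγ hC₁.le hC₂.le hV hi).trans ?_
    have e1 : residualMean d (x n) g i ^ 2
        ≤ ((r + 1) * (L * (r * D) ^ min β 1)) ^ 2 * (n : ℝ) ^ (-(min β 1 * 2)) := by
      rw [← sq_abs]
      have e2 : (n : ℝ) ^ (-(min β 1 * 2)) = ((n : ℝ) ^ (-min β 1)) ^ 2 := by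
        rw [← neg_mul, Real.rpow_mul hn0.le]
        norm_cast
      rw [e2, ← mul_pow]
      have := hmean i hi
      gcongr
    have e3 : (C₁ + 6 * C₂) * (r * (D / n)) ^ min γ 1
        = L * (r * D) ^ min γ 1 * (n : ℝ) ^ (-min γ 1) := by rw [hpowdiv]; ring
    rw [e3]
    linarith
  have hrisk := risk_le hε hd hKw hK H hnr hγ hC₁.le hp hV (fun i hi => (hmean i hi).trans (by
    rw [neg_zero, Real.rpow_zero, mul_one] at hm1; exact hm1)) hE hh hh1 hδ
  refine hrisk.trans (ENNReal.ofReal_le_ofReal ?_)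
  have t1 : (h ^ γ + C₁ * h ^ γ) ^ 2 * (cc * (D / n / h)) * (2 * h * n)
      = 2 * cc * D * (1 + C₁) ^ 2 * (h ^ γ) ^ 2 := by
    field_simp
  have t2 : (h ^ γ) ^ 2 ≤ a' ^ (2 * γ) * (n : ℝ) ^ (-e) := by
    have e1 : (h ^ γ) ^ 2 = h ^ (2 * γ) := by
      rw [mul_comm, Real.rpow_mul hh.le]; norm_cast
    have e2 : a' ^ (2 * γ) * (n : ℝ) ^ (-e) = (a' * (n : ℝ) ^ (-s)) ^ (2 * γ) := by
      rw [Real.mul_rpow ha'.le hns.le, ← Real.rpow_mul hn0.le, ← hse2, neg_mul]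
    rw [e1, e2]
    gcongr
  have t3 : D / n / h ≤ D / a * (n : ℝ) ^ (-e) := by
    have e1 : (n : ℝ) ^ (-e) * n = (n : ℝ) ^ s := by
      rw [← Real.rpow_add_one hn0.ne']; congr 1; linarith
    have e2 : (n : ℝ) ^ s * (n : ℝ) ^ (-s) = 1 := by
      rw [← Real.rpow_add hn0, add_neg_cancel, Real.rpow_zero]
    rw [div_div, div_le_iff₀ (by positivity)]
    calc D = D / a * ((n : ℝ) ^ (-e) * n) * (a * (n : ℝ) ^ (-s)) := by
          rw [e1, mul_mul_mul_comm, mul_comm ((n : ℝ) ^ s), mul_assoc, ← mul_assoc _ a]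
          rw [mul_comm ((n : ℝ) ^ (-s)), e2]
          field_simp
      _ ≤ D / a * ((n : ℝ) ^ (-e) * n) * h := by gcongr
      _ = _ := by ring
  have u1 : 2 * cc * D * (1 + C₁) ^ 2 * (h ^ γ) ^ 2
      ≤ 2 * cc * D * (1 + C₁) ^ 2 * (a' ^ (2 * γ) * (n : ℝ) ^ (-e)) := by gcongr
  have u2 : (2 * r + 1) * Q * (cc * (D / n / h))
      ≤ (2 * r + 1) * Q * (cc * (D / a * (n : ℝ) ^ (-e))) := by gcongr
  rw [t1]
  exact (add_le_add u1 u2).trans (le_of_eq (by ring))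

/-- The constant `S` precedes `b` in the quantifiers, since the lower end of the bandwidth range is
later chosen in terms of `S`. -/
lemma exists_le_risk (hε : IsErrorSequence μ ε) (hd : IsDifferenceSequence d) (hKw : IsWeight K)
    (hx : ∀ n : ℕ, 1 ≤ n → HasMesh (x n) n (D / n)) (hγ : 0 < γ) (p : ℕ) {δ : ℝ} (hδ : 0 < δ) :
    ∃ S : ℝ, 0 < S ∧ ∀ n : ℕ, 1 ≤ n → ∀ b h : ℝ, 0 < h →
      h ≤ b * (n : ℝ) ^ (-(1 / (2 * γ + 1))) → ∀ g V : ℝ → ℝ, ContinuousOn V (Icc 0 1) →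
      (∀ t ∈ Icc (0 : ℝ) 1, δ ≤ V t) →
      ENNReal.ofReal (S / (1 + 2 * b * (n : ℝ) ^ (2 * γ / (2 * γ + 1))))
        ≤ risk μ ε d p K n (x n) g V h := by
  obtain ⟨-, -, -, hse, -⟩ := exponent_facts hγ
  obtain ⟨i, j, hij, hi, hj, hsupp⟩ := hd.exists_extreme
  refine ⟨min (4 * ((d i * d j) ^ 2 * δ ^ 2)) (δ ^ 2), by positivity, ?_⟩
  intro n hn1 b h hh hhb g V hVc hV
  have hn0 : (0 : ℝ) < n := by exact_mod_cast hn1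
  refine le_trans (ENNReal.ofReal_le_ofReal ?_) (div_le_risk hε hij hsupp p hKw
    (fun k hk => (hx n hn1).mem_Icc (by omega)) g hδ hVc hV hh)
  have h1 : h * n ≤ b * (n : ℝ) ^ (2 * γ / (2 * γ + 1)) := by
    have e1 : (n : ℝ) ^ (2 * γ / (2 * γ + 1)) = (n : ℝ) ^ (-(1 / (2 * γ + 1))) * n := by
      rw [← Real.rpow_add_one hn0.ne']; congr 1; linarith
    rw [e1, ← mul_assoc]
    gcongr
  have h2 : 1 + 2 * h * n ≤ 1 + 2 * b * (n : ℝ) ^ (2 * γ / (2 * γ + 1)) := by linarith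
  gcongr

lemma exists_le_worstRisk (hε : IsErrorSequence μ ε) (hd : IsDifferenceSequence d)
    (hKw : IsWeight K) (hK : WeightBounds K M c τ) (hD : 0 < D)
    (hx : ∀ n : ℕ, 1 ≤ n → HasMesh (x n) n (D / n)) (hC₁ : 0 < C₁) (hC₂ : 0 < C₂) (hγ : 0 < γ)
    (p : ℕ) :
    ∃ S : ℝ, 0 < S ∧ ∀ β : ℝ, ∀ᶠ n : ℕ in atTop, ∀ h : ℝ,
      1 * (n : ℝ) ^ (-(1 / (2 * γ + 1))) ≤ h →
      ENNReal.ofReal (S * (min h 1) ^ (2 * γ)) ≤ worstRisk μ ε d p K n (x n) β γ C₁ C₂ h := by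
  obtain ⟨hs0, hs1, he0, hse, hse2⟩ := exponent_facts hγ
  have hcc := hK.christoffelConst_pos p
  set cc := christoffelConst p M c τ with hccdef
  set A := min (C₁ / 2) (C₂ / 2) with hA
  have hA0 : 0 < A := by positivity
  have hπ := Real.pi_pos
  refine ⟨A ^ 2 / 4 * (4 * Real.pi * (8 * cc * D + 1)) ^ (-(2 * γ)), by positivity, fun β => ?_⟩
  filter_upwards [eventually_div_le_min hs1 (4 * (p + 1) * (r + 2) * D) hK.τ_pos one_pos,
    eventually_ge_atTop 1, eventually_ge_atTop r] with n hmesh hn1 hnr h hlo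
  have hn0 : (0 : ℝ) < n := by exact_mod_cast hn1
  have H := hx n hn1
  have hh : 0 < h := (by positivity : 0 < 1 * (n : ℝ) ^ (-(1 / (2 * γ + 1)))).trans_le hlo
  set η := min h 1 with hη
  have hη0 : 0 < η := by positivity
  have hη1 : η ≤ 1 := min_le_right _ _
  have hδ : 4 * (p + 1) * (r + 2) * (D / n) ≤ τ * η := by
    have := hmesh h hlo
    rwa [← mul_div_assoc]
  -- With `B = cc * (D / n / η)` the requirement `8 * B * n ≤ L` reads `8 * cc * D / η ≤ L`, so the
  -- frequencies are of order `1 / η`.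
  set L := ⌈8 * cc * D / η⌉₊ with hL
  have hL1 : 1 ≤ L := Nat.one_le_ceil_iff.2 (by positivity)
  have hLpos : (0 : ℝ) < L := by exact_mod_cast hL1
  have hLle : (L : ℝ) ≤ (8 * cc * D + 1) / η := by
    have h1 := (Nat.ceil_lt_add_one (by positivity : 0 ≤ 8 * cc * D / η)).le
    refine h1.trans ?_
    rw [add_div]
    have : 1 ≤ 1 / η := by rw [le_div_iff₀ hη0]; linarith
    linarith
  have hfit := fun t ht => H.localFit_bounds hnr hK hh (p := p) hδ (t := t) ht
  refine le_trans (ENNReal.ofReal_le_ofReal ?_) (oscillation_le_worstRisk hε hd hKw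
    (fun i hi => H.mem_Icc (by omega)) hγ hC₁ hC₂ (B := cc * (D / n / η)) hh (by positivity)
    (fun t ht => (hfit t ht).1) (fun t ht => (hfit t ht).2) hL1 ?_)
  · rw [mul_pow]
    have e1 : ((4 * Real.pi * L) ^ (-γ)) ^ 2 = (4 * Real.pi * L) ^ (-(2 * γ)) := by
      rw [← Real.rpow_natCast, ← Real.rpow_mul (by positivity)]
      congr 1; push_cast; ring
    have e2 : (4 * Real.pi * (8 * cc * D + 1)) ^ (-(2 * γ)) * η ^ (2 * γ)
        = (4 * Real.pi * ((8 * cc * D + 1) / η)) ^ (-(2 * γ)) := by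
      rw [← mul_div_assoc, Real.div_rpow (by positivity) hη0.le, Real.rpow_neg hη0.le,
        div_inv_eq_mul]
    have e3 : (4 * Real.pi * ((8 * cc * D + 1) / η)) ^ (-(2 * γ))
        ≤ (4 * Real.pi * L) ^ (-(2 * γ)) :=
      Real.rpow_le_rpow_of_nonpos (by positivity) (by gcongr) (by linarith)
    rw [e1, mul_assoc, e2]
    calc _ ≤ A ^ 2 / 4 * (4 * Real.pi * L) ^ (-(2 * γ)) := by gcongr
      _ = _ := by ring
  · refine le_trans (le_of_eq ?_) (Nat.le_ceil _)
    field_simp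

lemma exists_optimalBandwidth (hε : IsErrorSequence μ ε) (hd : IsDifferenceSequence d)
    (hKw : IsWeight K) (hK : WeightBounds K M c τ) (hD : 0 < D)
    (hx : ∀ n : ℕ, 1 ≤ n → HasMesh (x n) n (D / n)) (hC₁ : 0 < C₁) (hC₂ : 0 < C₂) (hγ : 0 < γ)
    (hp : strictFloor γ < p) :
    ∃ b₁ b₂ : ℝ, 0 < b₁ ∧ b₁ ≤ b₂ ∧ ∀ β : ℝ, γ / (4 * γ + 2) < β → ∀ᶠ n : ℕ in atTop,
      (∃ h : ℝ, IsOptimalBandwidth μ ε d p K n (x n) β γ C₁ C₂ h) ∧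
      ∀ h : ℝ, IsOptimalBandwidth μ ε d p K n (x n) β γ C₁ C₂ h →
        b₁ * (n : ℝ) ^ (-(1 / (2 * γ + 1))) ≤ h ∧ h ≤ b₂ * (n : ℝ) ^ (-(1 / (2 * γ + 1))) := by
  obtain ⟨hs0, hs1, he0, hse, hse2⟩ := exponent_facts hγ
  obtain ⟨B, hB, hupper⟩ := exists_risk_le (x := x) hε hd hKw hK hD hx hC₁ hC₂ hγ hp one_pos le_rfl
  obtain ⟨S, hS, hvar⟩ := exists_le_risk (x := x) hε hd hKw hx hγ p hC₂
  obtain ⟨T, hT, hbias⟩ := exists_le_worstRisk (x := x) hε hd hKw hK hD hx hC₁ hC₂ hγ p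
  set s := 1 / (2 * γ + 1) with hs
  set e := 2 * γ / (2 * γ + 1) with he
  -- With `b₁ * B ≤ S / 4` and `B * n ^ (-e) ≤ S / 4`, the product of `B * n ^ (-e)` with `1 + 2 *
  -- b₁ * n ^ e` is at most `3 * S / 4`: smaller bandwidths lose to n^(-s) through their variance.
  set b₁ := min 1 (S / (4 * B)) with hb₁
  -- Chosen so that `T * b₂ ^ (2 * γ) ≥ 2 * B`: larger bandwidths lose to n^(-s) through their bias.
  set b₂ := max 1 ((2 * B / T) ^ (1 / (2 * γ))) with hb₂
  have hb₁0 : 0 < b₁ := by positivity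
  have hb₁1 : b₁ ≤ 1 := min_le_left _ _
  have hb₂1 : 1 ≤ b₂ := le_max_left _ _
  refine ⟨b₁, b₂, hb₁0, hb₁1.trans hb₂1, fun β hβ => ?_⟩
  filter_upwards [hupper β hβ, hbias β, eventually_ge_atTop 1,
    eventually_rpow_le he0 B (by positivity : 0 < S / 4),
    eventually_rpow_le he0 B (by positivity : 0 < T / 2)] with n hup hbi hn1 hsm1 hsm2
  have hn0 : (0 : ℝ) < n := by exact_mod_cast hn1
  rw [neg_zero, Real.rpow_zero, mul_one] at hsm1 hsm2
  have hns : (0 : ℝ) < (n : ℝ) ^ (-s) := by positivity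
  have hne : (0 : ℝ) < (n : ℝ) ^ (-e) := by positivity
  have hne' : (0 : ℝ) < (n : ℝ) ^ e := by positivity
  have hinv : (n : ℝ) ^ (-e) * (n : ℝ) ^ e = 1 := by
    rw [← Real.rpow_add hn0, neg_add_cancel, Real.rpow_zero]
  set W := fun h => worstRisk μ ε d p K n (x n) β γ C₁ C₂ h with hW
  have hWν : W ((n : ℝ) ^ (-s)) ≤ ENNReal.ofReal (B * (n : ℝ) ^ (-e)) :=
    iSup_le fun g => iSup_le fun V => iSup_le fun hg => iSup_le fun hV =>
      hup _ (one_mul _).le (one_mul _).ge g V hg hV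
  have hsmall : ∀ h, 0 < h → h < b₁ * (n : ℝ) ^ (-s) → W ((n : ℝ) ^ (-s)) < W h := by
    intro h hh hlt
    have h1 := hvar n hn1 b₁ h hh hlt.le (fun _ => 0) (fun _ => C₂) continuousOn_const
      fun _ _ => le_rfl
    have h2 := h1.trans (risk_le_worstRisk d p K n (x n)
      (holderClass_const (γ := β) (c := 0) hC₁.le (by simpa using hC₂.le))
      (varianceClass_const (γ := γ) hC₁.le hC₂.le) h)
    refine hWν.trans_lt (lt_of_lt_of_le ?_ h2)
    refine (ENNReal.ofReal_lt_ofReal_iff (by positivity)).2 ?_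
    rw [lt_div_iff₀ (by positivity)]
    have h3 : b₁ * B ≤ S / 4 := by
      have : b₁ ≤ S / (4 * B) := min_le_right _ _
      rw [le_div_iff₀ (by positivity)] at this
      linarith
    have h4 : B * (n : ℝ) ^ (-e) * (1 + 2 * b₁ * (n : ℝ) ^ e)
        = B * (n : ℝ) ^ (-e) + 2 * (b₁ * B) * ((n : ℝ) ^ (-e) * (n : ℝ) ^ e) := by ring
    rw [h4, hinv]
    linarith
  have hlarge : ∀ h, b₂ * (n : ℝ) ^ (-s) < h → W ((n : ℝ) ^ (-s)) < W h := by
    intro h hlt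
    have h1 := hbi h ((mul_le_mul_of_nonneg_right hb₂1 hns.le).trans hlt.le)
    refine hWν.trans_lt (lt_of_lt_of_le ?_ h1)
    have hh : 0 < h := (by positivity : 0 < b₂ * (n : ℝ) ^ (-s)).trans hlt
    refine (ENNReal.ofReal_lt_ofReal_iff (by positivity)).2 ?_
    -- For `h` above 1 the bias bound is the constant `T`, which exceeds `B * n ^ (-e)` for large
    -- `n`.
    rcases min_choice h 1 with hm | hm <;> rw [hm]
    · have h2 : (b₂ * (n : ℝ) ^ (-s)) ^ (2 * γ) ≤ h ^ (2 * γ) := by gcongr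
      rw [Real.mul_rpow (by positivity) hns.le, ← Real.rpow_mul hn0.le, neg_mul, hse2] at h2
      have h3 : 2 * B / T ≤ b₂ ^ (2 * γ) := by
        have h4 : ((2 * B / T) ^ (1 / (2 * γ))) ^ (2 * γ) = 2 * B / T := by
          rw [← Real.rpow_mul (by positivity), one_div_mul_cancel (by positivity), Real.rpow_one]
        rw [← h4]
        gcongr
        exact le_max_right _ _
      rw [div_le_iff₀ hT] at h3
      calc B * (n : ℝ) ^ (-e) < 2 * B * (n : ℝ) ^ (-e) := by nlinarith [mul_pos hB hne]
        _ ≤ b₂ ^ (2 * γ) * T * (n : ℝ) ^ (-e) := by gcongr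
        _ = T * (b₂ ^ (2 * γ) * (n : ℝ) ^ (-e)) := by ring
        _ ≤ _ := by gcongr
    · rw [Real.one_rpow]
      linarith
  refine ⟨?_, ?_⟩
  -- A lower semicontinuous function attains its minimum on the compact interval; every bandwidth
  -- outside does worse than n^(-s), which lies inside.
  · have hlsc : LowerSemicontinuousOn W (Icc (b₁ * (n : ℝ) ^ (-s)) (b₂ * (n : ℝ) ^ (-s))) := by
      intro h hh
      exact (lowerSemicontinuousAt_worstRisk hε d p hKw n (x n) β γ C₁ C₂
        ((by positivity : 0 < b₁ * (n : ℝ) ^ (-s)).trans_le hh.1)).lowerSemicontinuousWithinAt _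
    have hmemν : (n : ℝ) ^ (-s) ∈ Icc (b₁ * (n : ℝ) ^ (-s)) (b₂ * (n : ℝ) ^ (-s)) :=
      ⟨mul_le_of_le_one_left hns.le hb₁1, le_mul_of_one_le_left hns.le hb₂1⟩
    obtain ⟨h, hh, hmin⟩ := hlsc.exists_isMinOn ⟨_, hmemν⟩ isCompact_Icc
    refine ⟨h, (by positivity : 0 < b₁ * (n : ℝ) ^ (-s)).trans_le hh.1, fun h' hh' => ?_⟩
    by_cases hin : h' ∈ Icc (b₁ * (n : ℝ) ^ (-s)) (b₂ * (n : ℝ) ^ (-s))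
    · exact hmin hin
    · have hlt : W ((n : ℝ) ^ (-s)) < W h' := by
        rcases lt_or_ge h' (b₁ * (n : ℝ) ^ (-s)) with h1 | h1
        · exact hsmall h' hh' h1
        · refine hlarge h' ?_
          by_contra! h2
          exact hin ⟨h1, h2⟩
      exact (hmin hmemν).trans hlt.le
  · intro h hopt
    have hle : W h ≤ W ((n : ℝ) ^ (-s)) := hopt.2 _ hns
    constructor
    · by_contra! hlt
      exact absurd (hsmall h hopt.1 hlt) (not_lt.2 hle)
    · by_contra! hlt
      exact absurd (hlarge h hlt) (not_lt.2 hle)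

lemma exists_le_risk_of_bandwidth_le (hε : IsErrorSequence μ ε) (hd : IsDifferenceSequence d)
    (hKw : IsWeight K) (hx : ∀ n : ℕ, 1 ≤ n → HasMesh (x n) n (D / n)) (hγ : 0 < γ) (p : ℕ)
    {b δ : ℝ} (hb : 0 < b) (hδ : 0 < δ) :
    ∃ B : ℝ, 0 < B ∧ ∀ n : ℕ, 1 ≤ n → ∀ h : ℝ, 0 < h →
      h ≤ b * (n : ℝ) ^ (-(1 / (2 * γ + 1))) → ∀ g V : ℝ → ℝ, ContinuousOn V (Icc 0 1) →
      (∀ t ∈ Icc (0 : ℝ) 1, δ ≤ V t) →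
      ENNReal.ofReal (B * (n : ℝ) ^ (-(2 * γ / (2 * γ + 1))))
        ≤ risk μ ε d p K n (x n) g V h := by
  obtain ⟨-, -, he0, -, -⟩ := exponent_facts hγ
  obtain ⟨S, hS, hvar⟩ := exists_le_risk (x := x) (p := p) hε hd hKw hx hγ hδ
  refine ⟨S / (1 + 2 * b), by positivity, fun n hn1 h hh hhb g V hVc hV => ?_⟩
  refine le_trans (ENNReal.ofReal_le_ofReal ?_) (hvar n hn1 b h hh hhb g V hVc hV)
  have hn1' : (1 : ℝ) ≤ n := by exact_mod_cast hn1
  have hn0 : (0 : ℝ) < n := by linarith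
  have h1 : (1 : ℝ) ≤ (n : ℝ) ^ (2 * γ / (2 * γ + 1)) := Real.one_le_rpow hn1' he0.le
  rw [Real.rpow_neg hn0.le, ← div_eq_mul_inv, div_div]
  gcongr
  nlinarith

end Main

end VarDiff

end

theorem theorem2p7
    {Ω : Type*} [MeasurableSpace Ω] (μ : Measure Ω) [IsProbabilityMeasure μ]
    (ε : ℕ → Ω → ℝ) (hε : VarDiff.IsErrorSequence μ ε)
    (x : ℕ → ℕ → ℝ) (hx : VarDiff.IsDesign x)
    {r : ℕ} (d : Fin (r + 1) → ℝ) (hd : VarDiff.IsDifferenceSequence d)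
    (K : ℝ → ℝ) (hK : VarDiff.IsWeight K)
    (C₁ C₂ γ : ℝ) (hC₁ : 0 < C₁) (hC₂ : 0 < C₂) (hγ : 0 < γ)
    (p : ℕ) (hp : VarDiff.strictFloor γ < p) :
    -- the optimal bandwidth exists and has exact order `n^{-1/(2γ+1)}`
    (∃ b₁ b₂ : ℝ, 0 < b₁ ∧ b₁ ≤ b₂ ∧ ∀ β : ℝ, γ / (4 * γ + 2) < β → ∀ᶠ n : ℕ in atTop,
      (∃ h : ℝ, VarDiff.IsOptimalBandwidth μ ε d p K n (x n) β γ C₁ C₂ h) ∧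
      ∀ h : ℝ, VarDiff.IsOptimalBandwidth μ ε d p K n (x n) β γ C₁ C₂ h →
        b₁ * (n : ℝ) ^ (-(1 / (2 * γ + 1))) ≤ h ∧ h ≤ b₂ * (n : ℝ) ^ (-(1 / (2 * γ + 1)))) ∧
    ∀ a a' : ℝ, 0 < a → a ≤ a' →
      -- two-sided bound on the worst-case risk, uniformly in the bandwidth
      (∃ B B' : ℝ, 0 < B ∧ B ≤ B' ∧ ∀ β : ℝ, γ / (4 * γ + 2) < β → ∀ᶠ n : ℕ in atTop,
        ∀ h : ℝ, a ≤ (n : ℝ) ^ (1 / (2 * γ + 1)) * h → (n : ℝ) ^ (1 / (2 * γ + 1)) * h ≤ a' →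
          (∀ t ∈ Icc (0 : ℝ) 1, ∀ z : ℕ → ℝ, ∃! c : Fin (p + 1) → ℝ,
            VarDiff.IsLocalFit p K h (x n) (VarDiff.residualIndices r n) z t c) ∧
          (∀ g V : ℝ → ℝ, VarDiff.HolderClass β C₁ C₂ g → VarDiff.VarianceClass γ C₁ C₂ V →
            VarDiff.risk μ ε d p K n (x n) g V h
              ≤ ENNReal.ofReal (B' * (n : ℝ) ^ (-(2 * γ / (2 * γ + 1))))) ∧
          ENNReal.ofReal (B * (n : ℝ) ^ (-(2 * γ / (2 * γ + 1))))
            ≤ VarDiff.worstRisk μ ε d p K n (x n) β γ C₁ C₂ h) ∧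
      -- lower bound for each single pair `(g, V)` with `V` bounded below
      (∀ δ : ℝ, 0 < δ → ∃ B : ℝ, 0 < B ∧ ∀ β : ℝ, γ / (4 * γ + 2) < β → ∀ᶠ n : ℕ in atTop,
        ∀ h : ℝ, a ≤ (n : ℝ) ^ (1 / (2 * γ + 1)) * h → (n : ℝ) ^ (1 / (2 * γ + 1)) * h ≤ a' →
          ∀ g V : ℝ → ℝ, VarDiff.HolderClass β C₁ C₂ g → VarDiff.VarianceClass γ C₁ C₂ V →
            (∀ t ∈ Icc (0 : ℝ) 1, δ ≤ V t) →
            ENNReal.ofReal (B * (n : ℝ) ^ (-(2 * γ / (2 * γ + 1))))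
              ≤ VarDiff.risk μ ε d p K n (x n) g V h) := by
  obtain ⟨D, hD, hmesh⟩ := hx.exists_hasMesh
  obtain ⟨M, c, τ, hKb⟩ := hK.exists_bounds
  obtain ⟨hs0, hs1, -, -, -⟩ := VarDiff.exponent_facts hγ
  refine ⟨VarDiff.exists_optimalBandwidth hε hd hK hKb hD hmesh hC₁ hC₂ hγ hp,
    fun a a' ha haa => ?_⟩
  have ha' : 0 < a' := ha.trans_le haa
  have hlo : ∀ n : ℕ, 1 ≤ n → ∀ h : ℝ, a ≤ (n : ℝ) ^ (1 / (2 * γ + 1)) * h →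
      a * (n : ℝ) ^ (-(1 / (2 * γ + 1))) ≤ h ∧ 0 < h := by
    intro n hn h h1
    have hn0 : (0 : ℝ) < n := by exact_mod_cast hn
    have hle : a * (n : ℝ) ^ (-(1 / (2 * γ + 1))) ≤ h := by
      rw [Real.rpow_neg hn0.le, ← div_eq_mul_inv, div_le_iff₀ (by positivity), mul_comm]
      exact h1
    exact ⟨hle, (by positivity : 0 < a * (n : ℝ) ^ (-(1 / (2 * γ + 1)))).trans_le hle⟩
  have hhi : ∀ n : ℕ, 1 ≤ n → ∀ h : ℝ, (n : ℝ) ^ (1 / (2 * γ + 1)) * h ≤ a' →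
      h ≤ a' * (n : ℝ) ^ (-(1 / (2 * γ + 1))) := by
    intro n hn h h1
    have hn0 : (0 : ℝ) < n := by exact_mod_cast hn
    rw [Real.rpow_neg hn0.le, ← div_eq_mul_inv, le_div_iff₀ (by positivity), mul_comm]
    exact h1
  constructor
  · obtain ⟨B', hB', hupper⟩ :=
      VarDiff.exists_risk_le (x := x) hε hd hK hKb hD hmesh hC₁ hC₂ hγ hp ha haa
    obtain ⟨B, hB, hlower⟩ :=
      VarDiff.exists_le_risk_of_bandwidth_le (x := x) hε hd hK hmesh hγ p ha' hC₂
    -- The minimum secures the order of the two constants. The lower bound needs only the variance,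
    -- with zero mean function and constant variance function `C₂`.
    refine ⟨min B B', B', by positivity, min_le_right _ _, fun β hβ => ?_⟩
    filter_upwards [hupper β hβ, eventually_ge_atTop 1, eventually_ge_atTop r,
      VarDiff.eventually_div_le_min hs1 (4 * (p + 1) * (r + 2) * D) hKb.τ_pos ha]
      with n hup hn1 hnr hwin h h1 h2
    obtain ⟨hle, hpos⟩ := hlo n hn1 h h1
    have hge := hhi n hn1 h h2
    refine ⟨fun t ht z => ?_, hup h hle hge, ?_⟩
    · refine (VarDiff.existsUnique_isLocalFit_iff hK.nonneg).2 ?_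
      refine ((hmesh n hn1).localFit_bounds hnr hKb hpos (p := p) ?_ ht).1
      rw [← mul_div_assoc]
      exact hwin h hle
    · refine le_trans (ENNReal.ofReal_le_ofReal ?_)
        ((hlower n hn1 h hpos hge (fun _ => 0) (fun _ => C₂) continuousOn_const
          fun _ _ => le_rfl).trans (VarDiff.risk_le_worstRisk d p K n (x n)
            (VarDiff.holderClass_const hC₁.le (by simpa using hC₂.le))
            (VarDiff.varianceClass_const hC₁.le hC₂.le) h))
      gcongr
      exact min_le_left _ _
  · intro δ hδ
    obtain ⟨B, hB, hlower⟩ :=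
      VarDiff.exists_le_risk_of_bandwidth_le (x := x) hε hd hK hmesh hγ p ha' hδ
    refine ⟨B, hB, fun β _ => ?_⟩
    filter_upwards [eventually_ge_atTop 1] with n hn1 h h1 h2 g V _ hV hVδ
    exact hlower n hn1 h (hlo n hn1 h h1).2 (hhi n hn1 h h2) g V hV.holderClass.continuousOn hVδ
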